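/- **Setting.** Let $E\subset\mathbb R^N$ be a linear subspace of dimension $d$, let $\pi,\pi^\perp$ be the orthogonal projections onto $E$ and $E^\perp$, let $K=\pi^\perp([0,1]^N)$ be the canonical acceptance domain and $\Sigma=K+E$ the strip. A point $v\in\mathbb R^N$ is non-singular if $\partial\Sigma\cap(\mathbb Z^N+v)=\emptyset$; $NS$ is the set of non-singular points. Put $\widetilde P_v=\Sigma\cap(\mathbb Z^N+v)$ and $P_v=\pi(\widetilde P_v)$. Let $B(r)$ be the closed $r$-ball of $E$. For a closed set $S$ ($S=\Sigma$ or $S=E$) and closed $A,A'\subset S$ put $A[r]=(A\cap\pi^{-1}(B(r)))\cup(S\cap\pi^{-1}(\partial B(r)))$ and $D_S(A,A')=\inf\{1/(r+1) : d_r(A[r],A'[r])<1/r\}$, with $d_r$ the Hausdorff metric. Fix $u\in NS$. Let $M\widetilde P_u$ be the $D_\Sigma$-closure of $\{\widetilde P_v : v\in E+u\}$ among the closed subsets of $\Sigma$, let $MP_u$ be the $D_E$-closure of $\{P_v : v\in E+u\}$ among the closed subsets of $E$, and let $\pi_*:M\widetilde P_u\to MP_u$, $A\mapsto\pi(A)$.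 A *canonical projection method pattern* $\mathcal T$ with data $(E,u)$ is a pattern whose continuous hull $M\mathcal T$ (a Hausdorff space with a continuous action of $E$ by translation) comes with continuous $E$-equivariant surjections $M\widetilde P_u\to M\mathcal T\to MP_u$ whose composition is $\pi_*$. Assume, as a standing assumption, that $M\widetilde P_u\to M\mathcal T$ is injective, i.e. $M\mathcal T=M\widetilde P_u$ (equivalently, the group $\mathcal S_{\mathcal T}$ of lattice translations of $\mathcal T$ is $\mathbb Z^N$). Writing $\pi_*$ also for $M\mathcal T\to MP_u$, the *pattern groupoid* is $$\mathcal{GT}=\{(S,v)\in M\mathcal T\times E : 0\in\pi_*(S),\ v\in\pi_*(S)\}$$ with the subspace topology and the product $(S,v)(S-v,w)=(S,v+w)$; $H^*(\mathcal{GT})$ is its continuous groupoid cohomology with coefficients in $\mathbb Z$. Let $F$ be any linear complement of $E$, of dimension $n$, let $\pi'$ be the projection onto $F$ parallel to $E$, let $V$ be the connected component of $0$ in $\overline{\pi'(\mathbb Z^N)}$ (a linear subspace of $F$) and $m=\dim V$. For $J\subset\{1,\dots,N\}$ let $e^J$ be the span of the standard basis vectors $e_j$, $j\in J$. Let $\mathcal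 I^*$ be the set of inclusion-minimal elements of $\{J:\dim\pi'(e^J)=n-1\}$, let $\mathcal I^*(V)=\{J\in\mathcal I^*:\dim(\pi'(e^J)\cap V)=m-1\}$, and let $\mathcal C_u$ be the set of singular hyperplanes $\pi'(e^J+v-u)\cap V$ of $V$ with $J\in\mathcal I^*(V)$, $v\in\mathbb Z^N$. Let $\mathcal P$ be the set of points of $V$ which are the $0$-dimensional intersection of $m$ elements of $\mathcal C_u$, and let $\Gamma_{\mathcal T}=\{v\in\mathbb Z^N:\pi'(v)\in V\}$ act on $V$ by translation by $\pi'(v)$. This action preserves $\mathcal P$. **Theorem.** If $\mathcal P$ is not a finite union of $\Gamma_{\mathcal T}$-orbits, then the abelian group $H^d(\mathcal{GT})$ is not finitely generated and the $\mathbb Q$-vector space $H^d(\mathcal{GT})\otimes\mathbb Q$ is infinite dimensional. -/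

import Mathlib

open CategoryTheory
open scoped ENNReal TensorProduct

noncomputable section

/-! ### The canonical projection method: strip, non-singular points, point patterns -/

namespace CanonicalProjection

/-- Euclidean `N`-space. -/
abbrev Space (N : ℕ) : Type := EuclideanSpace ℝ (Fin N)

variable {N : ℕ}

/-- The standard integer lattice `ℤ^N` in `ℝ^N`. -/
def lattice (N : ℕ) : AddSubgroup (Space N) where
  carrier := {x | ∀ i, ∃ k : ℤ, x i = k}
  zero_mem' := fun _ => ⟨0, by simp⟩
  add_mem' := by
    intro a b ha hb i
    obtain ⟨k, hk⟩ := ha i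
    obtain ⟨l, hl⟩ := hb i
    exact ⟨k + l, by simp [hk, hl]⟩
  neg_mem' := by
    intro a ha i
    obtain ⟨k, hk⟩ := ha i
    exact ⟨-k, by simp [hk]⟩

/-- The closed unit cube `[0,1]^N`. -/
def unitCube (N : ℕ) : Set (Space N) := {x | ∀ i, x i ∈ Set.Icc (0 : ℝ) 1}

/-- The canonical acceptance domain `K = π^⊥([0,1]^N)`, with `π^⊥` the orthogonal projection
onto the orthocomplement of `E`. -/
def acceptanceDomain (E : Submodule ℝ (Space N)) : Set (Space N) :=
  (fun x => Eᗮ.starProjection x) '' unitCube N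

/-- The strip `Σ = K + E`. -/
def strip (E : Submodule ℝ (Space N)) : Set (Space N) :=
  {x | ∃ k ∈ acceptanceDomain E, ∃ e ∈ E, x = k + e}

/-- The set `NS` of non-singular points: the boundary of the strip misses `ℤ^N + v`. -/
def nonSingular (E : Submodule ℝ (Space N)) : Set (Space N) :=
  {v | ∀ z ∈ lattice N, z + v ∉ frontier (strip E)}

/-- The strip point pattern `P̃_v = Σ ∩ (ℤ^N + v)`. -/
def stripPattern (E : Submodule ℝ (Space N)) (v : Space N) : Set (Space N) :=
  {x | x ∈ strip E ∧ x - v ∈ lattice N}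

/-- The projection point pattern `P_v = π(P̃_v) ⊆ E`, with `π` the orthogonal projection onto
`E`. -/
def pointPattern (E : Submodule ℝ (Space N)) (v : Space N) : Set (Space N) :=
  (fun x => E.starProjection x) '' stripPattern E v

/-! ### The metrics comparing patterns, and the continuous hulls -/

/-- `A[r] = (A ∩ C(r)) ∪ ∂C(r)`, where `C(r)` is the part of `S` lying above the closed `r`-ball
`B(r)` of `E` and `∂C(r)` the part of `S` lying above the sphere `∂B(r)`. For `S = E` these are
`B(r)` and `∂B(r)` themselves. -/
def window (E : Submodule ℝ (Space N)) (S A : Set (Space N)) (r : ℝ) : Set (Space N) :=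
  (A ∩ {x | x ∈ S ∧ ‖E.starProjection x‖ ≤ r}) ∪ {x | x ∈ S ∧ ‖E.starProjection x‖ = r}

/-- `inf {1/(r+1) | d_r(A[r], A'[r]) < 1/r}`, where `d_r` is the Hausdorff metric. With `S = E`
this is the metric `D` comparing closed subsets of `E`, with `S = Σ` it is the metric `D'`
comparing closed subsets of the strip. -/
def patternDist (E : Submodule ℝ (Space N)) (S A A' : Set (Space N)) : ℝ≥0∞ :=
  sInf {t | ∃ r : ℝ, 0 < r ∧
    Metric.hausdorffEDist (window E S A r) (window E S A' r) < ENNReal.ofReal (1 / r) ∧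
    t = ENNReal.ofReal (1 / (r + 1))}

/-- The closed subsets of `ℝ^N` contained in `S`. -/
@[ext]
structure ClosedIn (E : Submodule ℝ (Space N)) (S : Set (Space N)) where
  /-- the underlying set -/
  carrier : Set (Space N)
  isClosed : IsClosed carrier
  subset : carrier ⊆ S

/-- The topology defined by `patternDist`. -/
instance (E : Submodule ℝ (Space N)) (S : Set (Space N)) : TopologicalSpace (ClosedIn E S) where
  IsOpen U := ∀ A ∈ U, ∃ ε : ℝ≥0∞, 0 < ε ∧
    ∀ A' : ClosedIn E S, patternDist E S A.carrier A'.carrier < ε → A' ∈ U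
  isOpen_univ := fun _ _ => ⟨1, one_pos, fun _ _ => trivial⟩
  isOpen_inter := by
    intro U V hU hV A hA
    obtain ⟨ε, hε, h⟩ := hU A hA.1
    obtain ⟨δ, hδ, k⟩ := hV A hA.2
    exact ⟨min ε δ, lt_min hε hδ, fun A' hA' =>
      ⟨h A' (lt_of_lt_of_le hA' (min_le_left _ _)), k A' (lt_of_lt_of_le hA' (min_le_right _ _))⟩⟩
  isOpen_sUnion := by
    intro 𝒰 h𝒰 A hA
    obtain ⟨U, hU, hAU⟩ := hA
    obtain ⟨ε, hε, h⟩ := h𝒰 U hU A hAU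
    exact ⟨ε, hε, fun A' hA' => ⟨U, hU, h A' hA'⟩⟩

/-- The hull `MP̃_u`: the `D'`-closure of `{P̃_v | v ∈ E + u}`. -/
abbrev StripHull (E : Submodule ℝ (Space N)) (u : Space N) : Type :=
  ↥(closure {A : ClosedIn E (strip E) | ∃ e ∈ E, A.carrier = stripPattern E (e + u)})

/-- The hull `MP_u`: the `D`-closure of `{P_v | v ∈ E + u}`. -/
abbrev PointHull (E : Submodule ℝ (Space N)) (u : Space N) : Type :=
  ↥(closure {A : ClosedIn E (E : Set (Space N)) | ∃ e ∈ E, A.carrier = pointPattern E (e + u)})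

/-- The translate `A + e`. -/
def translate (A : Set (Space N)) (e : Space N) : Set (Space N) := (fun x => x + e) '' A

/-- A projection method pattern `𝒯` with canonical acceptance domain and data `(E, u)`, given by
its pattern dynamical system (the continuous hull `M𝒯` with its action of `E` by translation) and
two continuous `E`-equivariant surjections `MP̃_u → M𝒯 → MP_u` whose composition is the map `π_*`
induced by `π`. All constructions below depend on `𝒯` only through these. -/
structure ProjectionPattern (E : Submodule ℝ (Space N)) (u : Space N) where
  /-- the continuous hull `M𝒯` -/
  Hull : Type*
  [topology : TopologicalSpace Hull]
  [t2 : T2Space Hull]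
  [action : AddAction E Hull]
  [continuousAction : ContinuousVAdd E Hull]
  /-- the surjection `MP̃_u → M𝒯` -/
  fromStrip : StripHull E u → Hull
  /-- the surjection `M𝒯 → MP_u` -/
  toPoint : Hull → PointHull E u
  continuous_fromStrip : Continuous fromStrip
  continuous_toPoint : Continuous toPoint
  surjective_fromStrip : Function.Surjective fromStrip
  surjective_toPoint : Function.Surjective toPoint
  fromStrip_equivariant : ∀ (e : E) (A B : StripHull E u),
    B.1.carrier = translate A.1.carrier (e : Space N) → fromStrip B = e +ᵥ fromStrip A
  toPoint_equivariant : ∀ (e : E) (x : Hull),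
    (toPoint (e +ᵥ x)).1.carrier = translate (toPoint x).1.carrier (e : Space N)
  toPoint_fromStrip : ∀ A : StripHull E u,
    (toPoint (fromStrip A)).1.carrier = (fun x => E.starProjection x) '' A.1.carrier

attribute [instance] ProjectionPattern.topology ProjectionPattern.t2
  ProjectionPattern.action ProjectionPattern.continuousAction

end CanonicalProjection

/-! ### Continuous cohomology of a topological groupoid -/

namespace ContinuousGroupoidCohomology

universe v w

variable (C : Type w) [Groupoid.{v} C] [TopologicalSpace (Arrow C)]

/-- The chains `x₀ → x₁ → ⋯ → xₙ` of `n` composable arrows of the groupoid `C`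
(for `n = 0`: the units). -/
structure Chain (n : ℕ) where
  /-- the chain, as a functor -/
  toFunctor : Fin (n + 1) ⥤ C

variable {C}

/-- The composite arrow `xᵢ → xⱼ` of a chain (the unit at `xᵢ` if `i = j`). -/
def Chain.arrow {n : ℕ} (x : Chain C n) (p : {p : Fin (n + 1) × Fin (n + 1) // p.1 ≤ p.2}) :
    Arrow C :=
  Arrow.mk (x.toFunctor.map (homOfLE p.2))

/-- The space of chains carries the topology for which a chain varies continuously if and only if
all its arrows do. Since composition and units are continuous in a topological groupoid, this is
the topology of `C` on `0`-chains, and the subspace topology from the `n`-fold product of the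
arrow space on `n`-chains, `n ≥ 1`. -/
instance (n : ℕ) : TopologicalSpace (Chain C n) :=
  TopologicalSpace.induced Chain.arrow inferInstance

/-- The `i`-th face of a chain, which leaves out the vertex `xᵢ` (the two arrows meeting at an
inner vertex are composed). -/
def Chain.face {n : ℕ} (i : Fin (n + 2)) (x : Chain C (n + 1)) : Chain C n :=
  ⟨(Fin.succAboveOrderEmb i).monotone.functor ⋙ x.toFunctor⟩

theorem Chain.continuous_face {n : ℕ} (i : Fin (n + 2)) :
    Continuous (Chain.face i : Chain C (n + 1) → Chain C n) := by
  rw [continuous_induced_rng]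
  refine continuous_pi fun p => ?_
  have h : Continuous (Chain.arrow : Chain C (n + 1) → _) := continuous_induced_dom
  exact (continuous_apply (⟨(i.succAbove p.1.1, i.succAbove p.1.2),
    (Fin.succAboveOrderEmb i).monotone p.2⟩ :
      {q : Fin (n + 2) × Fin (n + 2) // q.1 ≤ q.2})).comp h

variable (C)

/-- Continuous integer valued `n`-cochains. -/
abbrev Cochain (n : ℕ) : Type _ := C(Chain C n, ℤ)

/-- The coboundary `(δf)(x) = ∑ᵢ (-1)ⁱ f(dᵢ x)`, that is,
`(δf)(g₀,…,gₙ) = f(g₁,…,gₙ) + ∑ (-1)ⁱ f(…,gᵢ₋₁gᵢ,…) + (-1)ⁿ⁺¹ f(g₀,…,gₙ₋₁)`. -/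
def coboundary (n : ℕ) : Cochain C n →+ Cochain C (n + 1) where
  toFun f := ∑ i : Fin (n + 2), (-1 : ℤ) ^ (i : ℕ) • f.comp ⟨Chain.face i, Chain.continuous_face i⟩
  map_zero' := by
    refine Finset.sum_eq_zero fun i _ => ?_
    ext x
    simp
  map_add' f g := by
    rw [← Finset.sum_add_distrib]
    refine Finset.sum_congr rfl fun i _ => ?_
    ext x
    simp

/-- The continuous `n`-cocycles. -/
def cocycles (n : ℕ) : AddSubgroup (Cochain C n) := (coboundary C n).ker

/-- The continuous `n`-coboundaries. -/
def coboundaries : (n : ℕ) → AddSubgroup (Cochain C n)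
  | 0 => ⊥
  | n + 1 => (coboundary C n).range

/-- The continuous groupoid cohomology `Hⁿ(C; ℤ)`. -/
abbrev Cohomology (n : ℕ) : Type _ :=
  cocycles C n ⧸ (coboundaries C n).addSubgroupOf (cocycles C n)

end ContinuousGroupoidCohomology

namespace CanonicalProjection

variable {N : ℕ} {E : Submodule ℝ (Space N)} {u : Space N}

theorem mem_translate {A : Set (Space N)} {e x : Space N} :
    x ∈ translate A e ↔ x - e ∈ A := by
  constructor
  · rintro ⟨y, hy, rfl⟩
    simpa using hy
  · intro h
    exact ⟨x - e, h, by simp⟩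

/-! ### The pattern groupoid -/

/-- The discrete hull `Ω_𝒯 = {S ∈ M𝒯 | 0 ∈ π_*(S)}`, the unit space of the pattern groupoid. -/
structure PatternGroupoid (T : ProjectionPattern E u) where
  /-- the underlying point of the hull -/
  point : T.Hull
  zero_mem : (0 : Space N) ∈ (T.toPoint point).1.carrier

/-- The elements `(S, v)` of the pattern groupoid `𝒢𝒯 = {(S, v) ∈ Ω_𝒯 × E | v ∈ π_*(S)}` with range
`S` and source `S' = S - v`. -/
@[ext]
structure PatternArrow (T : ProjectionPattern E u) (S S' : PatternGroupoid T) where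
  /-- the translation `v` -/
  vec : E
  vec_mem : (vec : Space N) ∈ (T.toPoint S.point).1.carrier
  source_eq : S'.point = -vec +ᵥ S.point

/-- The pattern groupoid, with product `(S, v) (S - v, w) = (S, v + w)`. Composition in the category
reads products from left to right. -/
instance (T : ProjectionPattern E u) : Groupoid (PatternGroupoid T) where
  Hom S S' := PatternArrow T S S'
  id S := ⟨0, by simpa using S.zero_mem, by simp⟩
  comp {S S' S''} g h := ⟨g.vec + h.vec, by
    have k := h.vec_mem
    rw [g.source_eq, T.toPoint_equivariant, mem_translate] at k
    simpa [add_comm] using k, by rw [h.source_eq, g.source_eq, vadd_vadd, neg_add_rev]⟩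
  inv {S S'} g := ⟨-g.vec, by
    have k := S.zero_mem
    rw [g.source_eq, T.toPoint_equivariant, mem_translate]
    simpa using k, by rw [g.source_eq, vadd_vadd]; simp⟩
  id_comp g := PatternArrow.ext (zero_add _)
  comp_id g := PatternArrow.ext (add_zero _)
  assoc a b c := PatternArrow.ext (add_assoc _ _ _)
  inv_comp g := PatternArrow.ext (neg_add_cancel _)
  comp_inv g := PatternArrow.ext (add_neg_cancel _)

/-- The arrow space of the pattern groupoid is topologised as a subspace of `M𝒯 × E`. -/
instance (T : ProjectionPattern E u) : TopologicalSpace (Arrow (PatternGroupoid T)) :=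
  TopologicalSpace.induced
    (fun a => ((a.left.point, PatternArrow.vec a.hom) : T.Hull × E)) inferInstance

/-- The pattern cohomology `Hⁿ(𝒢𝒯)`. -/
abbrev PatternCohomology (T : ProjectionPattern E u) (n : ℕ) : Type _ :=
  ContinuousGroupoidCohomology.Cohomology (PatternGroupoid T) n

/-! ### Singular hyperplanes and singular points

`F` is a linear complement of `E`, and `π'` the projection onto `F` parallel to `E`. -/

/-- The projection `π'` of `ℝ^N` onto `F` parallel to `E`. -/
def skewProjection {E F : Submodule ℝ (Space N)} (hEF : IsCompl E F) : Space N →ₗ[ℝ] Space N :=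
  F.projection E hEF.symm

/-- The space `V`: the connected component of `0` in the closure of `π'(ℤ^N)`. This component is a
linear subspace, so that taking the span adds nothing. -/
def contSpace {E F : Submodule ℝ (Space N)} (hEF : IsCompl E F) : Submodule ℝ (Space N) :=
  Submodule.span ℝ (connectedComponentIn
    (closure ((fun x => skewProjection hEF x) '' (lattice N : Set (Space N)))) 0)

/-- The coordinate subspace `e^J` spanned by the `e_j`, `j ∈ J`. -/
def coordSpace (J : Finset (Fin N)) : Submodule ℝ (Space N) :=
  Submodule.span ℝ ((fun j => EuclideanSpace.single j (1 : ℝ)) '' (J : Set (Fin N)))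

/-- The collection `ℐ` of index sets `J` with `dim π'(e^J) = dim F - 1`. -/
def hyperIndex {E F : Submodule ℝ (Space N)} (hEF : IsCompl E F) : Set (Finset (Fin N)) :=
  {J | Module.finrank ℝ ((coordSpace J).map (skewProjection hEF)) + 1 = Module.finrank ℝ F}

/-- The collection `ℐ^*(V)`: those minimal elements `J` of `ℐ` for which
`dim (π'(e^J) ∩ V) = dim V - 1`. -/
def hyperIndexV {E F : Submodule ℝ (Space N)} (hEF : IsCompl E F) : Set (Finset (Fin N)) :=
  {J | Minimal (fun J' => J' ∈ hyperIndex hEF) J ∧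
    Module.finrank ℝ
      ((coordSpace J).map (skewProjection hEF) ⊓ contSpace hEF : Submodule ℝ (Space N)) + 1 =
        Module.finrank ℝ (contSpace hEF)}

/-- The collection `𝒞_u` of singular hyperplanes `π'(e^J + v - u) ∩ V` of `V`, where
`J ∈ ℐ^*(V)` and `v ∈ ℤ^N`. -/
def singularHyperplanes {E F : Submodule ℝ (Space N)} (hEF : IsCompl E F) (u : Space N) :
    Set (Set (Space N)) :=
  {W | ∃ J ∈ hyperIndexV hEF, ∃ v ∈ lattice N,
    W = {x | x ∈ contSpace hEF ∧ ∃ y ∈ coordSpace J, x = skewProjection hEF (y + v - u)}}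

/-- The set `𝒫` of singular points: the points of `V` which are the `0`-dimensional intersection of
`m = dim V` elements of `𝒞_u`. -/
def singularPoints {E F : Submodule ℝ (Space N)} (hEF : IsCompl E F) (u : Space N) :
    Set (Space N) :=
  {x | ∃ W : Fin (Module.finrank ℝ (contSpace hEF)) → Set (Space N),
    (∀ i, W i ∈ singularHyperplanes hEF u) ∧
    (contSpace hEF : Set (Space N)) ∩ ⋂ i, W i = {x}}

/-- The group `Γ_𝒯 = {v ∈ ℤ^N | π'(v) ∈ V}`, acting on `V` by translation by `π'(v)`. -/
def translationGroup {E F : Submodule ℝ (Space N)} (hEF : IsCompl E F) :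
    AddSubgroup (Space N) :=
  lattice N ⊓ (contSpace hEF).toAddSubgroup.comap (skewProjection hEF).toAddMonoidHom

/-- `𝒫` is finitely generated: it is the union of finitely many `Γ_𝒯`-orbits. -/
def SingularPointsFinitelyGenerated {E F : Submodule ℝ (Space N)} (hEF : IsCompl E F)
    (u : Space N) : Prop :=
  ∃ R : Set (Space N), R.Finite ∧ R ⊆ singularPoints hEF u ∧
    ∀ x ∈ singularPoints hEF u, ∃ y ∈ R, ∃ γ ∈ translationGroup hEF,
      x = y + skewProjection hEF γ

end CanonicalProjection

end

open CategoryTheory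
open scoped ENNReal TensorProduct Pointwise
open Filter Topology

noncomputable section

/-! In top degree `d = dim E`, cohomology counts points. A clopen set of patterns containing the
origin marks a set of points in every pattern, and the dual cocycle sends a simplex to the signed
number of marked points inside it. The proof produces infinitely many such classes and shows that
they are linearly independent over `ℤ`.

Source of infinity. A point of `𝒫` is cut out by walls whose functionals `ℓ i` are coordinates on
`V`. Singular points with given wall directions have coordinates in a fixed translate of the product
of the groups `ℓ i (ℤ^N)`, and `Γ` moves them by `ℓ(Γ)`. If `ℓ(Γ)` met each of these axis groups in
finite index, there would be finitely many orbits. So the hypothesis gives a frame with a free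
direction (`exists_frame`). Free directions leave room for a sequence of boxes in `V`, bounded by
walls, such that modulo `Γ` and in the free coordinates the lower corner of each box differs from
its other vertices and from all vertices of earlier boxes (`exists_boxSequence`).

Cocycles. Near a wall, its lower side is covered by finitely many lattice translates of the strip
(`IsWall.exists_cover`). Hence the patterns see on which side of a wall a point lies, and a box
defines a clopen set (`BoxData.eventually_mem_clopen`). Its cocycle sums, over the marked points, a
cup product of coboundaries of Heaviside functions of additive coordinates `θ` on `E`
(`BoxData.coboundary_cochain`).

Detection. Let `M` be the last box in a combination. Cochains are evaluated on the Kuhn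
triangulation of a large integer box, carried into the pattern at base points close to the corner of
box `M`, and the values are alternated over the signs of an infinitesimal displacement in the free
directions (`Germ`, `Splitting.pairing`). The alternation kills whatever ignores the sign in one
free direction. Earlier boxes therefore contribute `0`, while box `M` contributes at least `R ^
|I|`, with `R` the side length of the integer box in the directions `I` generated by elements of `Γ`
with vanishing free coordinates.

For a coboundary, Stokes' formula leaves sums over faces. In the directions `I`, telescoping saves a
factor `R`. In the other directions the alternating face sums vanish beyond a fixed distance: a
continuous cochain depends on finitely many half-space conditions (`exists_local_determination`),
and a surviving term would solve one of finitely many triangular systems (`finite_triangular`). So a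
coboundary pairs to `O(R ^ (|I| - 1))`, which is impossible for large `R`. -/

namespace CanonicalProjection

variable {N : ℕ} {E F : Submodule ℝ (Space N)} {u : Space N}

/-! ### Polyhedra -/

section Polyhedra

variable {X : Type*} [AddCommGroup X] [Module ℝ X]

/-- A finite intersection of closed half-spaces. -/
def IsPolyhedron (s : Set X) : Prop :=
  ∃ Q : Finset (Module.Dual ℝ X × ℝ), ∀ x, x ∈ s ↔ ∀ q ∈ Q, q.1 x ≤ q.2

theorem exists_between_finite_bounds {ι κ : Type*} (s : Finset ι) (t : Finset κ) (f : ι → ℝ)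
    (g : κ → ℝ) (h : ∀ i ∈ s, ∀ j ∈ t, f i ≤ g j) :
    ∃ c, (∀ i ∈ s, f i ≤ c) ∧ ∀ j ∈ t, c ≤ g j := by
  rcases s.eq_empty_or_nonempty with rfl | hs
  · rcases t.eq_empty_or_nonempty with rfl | ht
    · exact ⟨0, by simp, by simp⟩
    · exact ⟨t.inf' ht g, by simp, fun j hj => Finset.inf'_le _ hj⟩
  · refine ⟨s.sup' hs f, fun i hi => Finset.le_sup' f hi, fun j hj => ?_⟩
    exact Finset.sup'_le _ _ fun i hi => h i hi j hj

/-- Fourier–Motzkin elimination of one direction. -/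
theorem IsPolyhedron.add_line {s : Set X} (hs : IsPolyhedron s) (v : X) :
    IsPolyhedron {x | ∃ t : ℝ, x - t • v ∈ s} := by
  classical
  obtain ⟨Q, hQ⟩ := hs
  -- For fixed `x`, the constraints in `P` bound `t` from below and those in `M` from above. A
  -- suitable `t` exists exactly when each lower bound is at most each upper bound, which is one
  -- inequality, linear in `x`, per pair.
  let Z := Q.filter fun q => q.1 v = 0
  let P := Q.filter fun q => 0 < q.1 v
  let M := Q.filter fun q => q.1 v < 0
  refine ⟨Z ∪ (P ×ˢ M).image fun p =>
    ((p.1.1 v)⁻¹ • p.1.1 - (p.2.1 v)⁻¹ • p.2.1, (p.1.1 v)⁻¹ * p.1.2 - (p.2.1 v)⁻¹ * p.2.2),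
    fun x => ?_⟩
  have key : ∀ t : ℝ, x - t • v ∈ s ↔
      (∀ q ∈ Z, q.1 x ≤ q.2) ∧ (∀ q ∈ P, (q.1 v)⁻¹ * (q.1 x - q.2) ≤ t) ∧
        ∀ q ∈ M, t ≤ (q.1 v)⁻¹ * (q.1 x - q.2) := by
    intro t
    rw [hQ]
    simp only [map_sub, map_smul, smul_eq_mul]
    constructor
    · intro h
      refine ⟨fun q hq => ?_, fun q hq => ?_, fun q hq => ?_⟩
      · have h1 := h q (Finset.mem_filter.1 hq).1
        rw [(Finset.mem_filter.1 hq).2] at h1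
        linarith
      · have h1 := h q (Finset.mem_filter.1 hq).1
        have h2 := (Finset.mem_filter.1 hq).2
        rw [inv_mul_le_iff₀ h2]
        linarith
      · have h1 := h q (Finset.mem_filter.1 hq).1
        have h2 := (Finset.mem_filter.1 hq).2
        rw [inv_mul_eq_div, le_div_iff_of_neg h2]
        linarith
    · rintro ⟨h0, hp, hm⟩ q hq
      rcases lt_trichotomy (q.1 v) 0 with h2 | h2 | h2
      · have h1 := hm q (Finset.mem_filter.2 ⟨hq, h2⟩)
        rw [inv_mul_eq_div, le_div_iff_of_neg h2] at h1
        linarith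
      · have h1 := h0 q (Finset.mem_filter.2 ⟨hq, h2⟩)
        rw [h2]
        linarith
      · have h1 := hp q (Finset.mem_filter.2 ⟨hq, h2⟩)
        rw [inv_mul_le_iff₀ h2] at h1
        linarith
  constructor
  · rintro ⟨t, ht⟩ q hq
    obtain ⟨h0, hp, hm⟩ := (key t).1 ht
    rcases Finset.mem_union.1 hq with hq | hq
    · exact h0 q hq
    · obtain ⟨⟨a, b⟩, hab, rfl⟩ := Finset.mem_image.1 hq
      have h1 := hp a (Finset.mem_product.1 hab).1
      have h2 := hm b (Finset.mem_product.1 hab).2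
      simp only [LinearMap.sub_apply, LinearMap.smul_apply, smul_eq_mul]
      simp only [mul_sub] at h1 h2
      linarith
  · intro h
    obtain ⟨t, h1, h2⟩ := exists_between_finite_bounds P M
      (fun q => (q.1 v)⁻¹ * (q.1 x - q.2)) (fun q => (q.1 v)⁻¹ * (q.1 x - q.2)) (by
        intro a ha b hb
        have := h _ (Finset.mem_union_right _ (Finset.mem_image.2
          ⟨(a, b), Finset.mem_product.2 ⟨ha, hb⟩, rfl⟩))
        simp only [LinearMap.sub_apply, LinearMap.smul_apply, smul_eq_mul] at this
        simp only [mul_sub]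
        linarith)
    exact ⟨t, (key t).2 ⟨fun q hq => h q (Finset.mem_union_left _ hq), h1, h2⟩⟩

theorem IsPolyhedron.add_span {s : Set X} (hs : IsPolyhedron s) (B : Finset X) :
    IsPolyhedron {x | ∃ e ∈ Submodule.span ℝ (B : Set X), x - e ∈ s} := by
  classical
  induction B using Finset.induction_on with
  | empty => simpa using hs
  | insert v B _ ih =>
    have h := ih.add_line v
    convert h using 1
    ext x
    simp only [Set.mem_ofPred_eq, Finset.coe_insert, Submodule.mem_span_insert]
    constructor
    · rintro ⟨e, ⟨t, z, hz, rfl⟩, h⟩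
      exact ⟨t, z, hz, by rwa [sub_sub]⟩
    · rintro ⟨t, z, hz, h⟩
      exact ⟨t • v + z, ⟨t, z, hz, rfl⟩, by rwa [← sub_sub]⟩

end Polyhedra

/-! ### The strip -/

/-- Orthogonal projection changes a point of the cube only by a vector of `E`, so the strip is the
cube thickened by `E`. In this form any complement of `E` can be used. -/
theorem mem_strip_iff {x : Space N} : x ∈ strip E ↔ ∃ c ∈ unitCube N, x - c ∈ E := by
  constructor
  · rintro ⟨_, ⟨c, hc, rfl⟩, e, he, rfl⟩
    refine ⟨c, hc, ?_⟩
    have : (Eᗮ.starProjection c + e) - c = e - E.starProjection c := by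
      have h := E.starProjection_add_starProjection_orthogonal c
      rw [← sub_eq_zero]
      nth_rewrite 2 [← h]
      abel
    simp only [this]
    exact E.sub_mem he (Submodule.starProjection_apply_mem _ _)
  · rintro ⟨c, hc, h⟩
    refine ⟨_, ⟨c, hc, rfl⟩, x - c + E.starProjection c,
      E.add_mem h (Submodule.starProjection_apply_mem _ _), ?_⟩
    have h : Eᗮ.starProjection c = c - E.starProjection c :=
      eq_sub_of_add_eq' (E.starProjection_add_starProjection_orthogonal c)
    simp only [h]
    abel

theorem add_mem_strip_iff {x e : Space N} (he : e ∈ E) : x + e ∈ strip E ↔ x ∈ strip E := by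
  simp only [mem_strip_iff]
  refine exists_congr fun c => and_congr_right fun _ => ?_
  rw [add_sub_right_comm, E.add_mem_iff_left he]

theorem isCompact_unitCube : IsCompact (unitCube N) := by
  have : unitCube N = (EuclideanSpace.equiv (Fin N) ℝ).toHomeomorph ⁻¹'
      (Set.pi Set.univ fun _ => Set.Icc (0 : ℝ) 1) := by
    ext x
    simp [unitCube, Pi.le_def, forall_and]
  rw [this]
  exact (Homeomorph.isCompact_preimage _).2 (isCompact_univ_pi fun _ => isCompact_Icc)

theorem isClosed_strip : IsClosed (strip E) := by
  have : strip E = unitCube N + (E : Set (Space N)) := by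
    ext x
    rw [mem_strip_iff, Set.mem_add]
    constructor
    · rintro ⟨c, hc, h⟩
      exact ⟨c, hc, x - c, h, by abel⟩
    · rintro ⟨c, hc, e, he, rfl⟩
      exact ⟨c, hc, by simpa using he⟩
  rw [this]
  exact IsClosed.add_left_of_isCompact E.closed_of_finiteDimensional isCompact_unitCube

theorem exists_norm_sub_starProjection_le (E : Submodule ℝ (Space N)) :
    ∃ C : ℝ, ∀ x ∈ strip E, ‖x - E.starProjection x‖ ≤ C := by
  obtain ⟨C, hC⟩ := (isCompact_unitCube (N := N)).isBounded.exists_norm_le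
  refine ⟨C, fun x hx => ?_⟩
  obtain ⟨c, hc, h⟩ := mem_strip_iff.1 hx
  have h1 : x - E.starProjection x = c - E.starProjection c := by
    have := Submodule.starProjection_eq_self_iff.2 h
    rw [map_sub] at this
    rw [sub_eq_sub_iff_sub_eq_sub]
    exact this.symm
  have h2 : c - E.starProjection c = Eᗮ.starProjection c := by
    rw [sub_eq_iff_eq_add, add_comm]
    exact (E.starProjection_add_starProjection_orthogonal c).symm
  rw [h1, h2]
  exact (Submodule.norm_starProjection_apply_le _ _).trans (hC c hc)

theorem isCompact_strip_ball (E : Submodule ℝ (Space N)) (r : ℝ) :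
    IsCompact {x | x ∈ strip E ∧ ‖E.starProjection x‖ ≤ r} := by
  obtain ⟨C, hC⟩ := exists_norm_sub_starProjection_le E
  refine Metric.isCompact_of_isClosed_isBounded ?_ ?_
  · exact isClosed_strip.inter
      (isClosed_le (continuous_norm.comp E.starProjection.continuous) continuous_const)
  · refine Metric.isBounded_iff_subset_closedBall 0 |>.2 ⟨C + r, fun x hx => ?_⟩
    rw [mem_closedBall_zero_iff]
    calc ‖x‖ = ‖(x - E.starProjection x) + E.starProjection x‖ := by rw [sub_add_cancel]
      _ ≤ _ := norm_add_le _ _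
      _ ≤ _ := add_le_add (hC x hx.1) hx.2

theorem isPolyhedron_strip (E : Submodule ℝ (Space N)) : IsPolyhedron (strip E) := by
  classical
  have hc : IsPolyhedron (unitCube N) := by
    let p : Fin N → Module.Dual ℝ (Space N) := fun i =>
      (EuclideanSpace.proj i : Space N →L[ℝ] ℝ).toLinearMap
    refine ⟨Finset.univ.image (fun i => (p i, 1)) ∪ Finset.univ.image (fun i => (-p i, 0)),
      fun x => ?_⟩
    constructor
    · intro h q hq
      rcases Finset.mem_union.1 hq with hq | hq
      · obtain ⟨i, -, rfl⟩ := Finset.mem_image.1 hq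
        exact (h i).2
      · obtain ⟨i, -, rfl⟩ := Finset.mem_image.1 hq
        simpa [p] using (h i).1
    · intro h i
      constructor
      · simpa [p] using h (-p i, 0) (Finset.mem_union_right _ (Finset.mem_image_of_mem _
          (Finset.mem_univ _)))
      · simpa [p] using h (p i, 1) (Finset.mem_union_left _ (Finset.mem_image_of_mem _
          (Finset.mem_univ _)))
  obtain ⟨B, hB⟩ := IsNoetherian.noetherian E
  have := hc.add_span B
  rw [hB] at this
  convert this using 1
  ext x
  rw [mem_strip_iff]
  constructor
  · rintro ⟨c, hc, h⟩
    exact ⟨x - c, h, by simpa using hc⟩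
  · rintro ⟨e, he, h⟩
    exact ⟨x - e, h, by simpa using he⟩

/-- The strip is a finite intersection of half-spaces, whose normals annihilate `E`. -/
theorem exists_strip_halfspaces (E : Submodule ℝ (Space N)) :
    ∃ Q : Finset (Module.Dual ℝ (Space N) × ℝ), (∀ q ∈ Q, ∀ e ∈ E, q.1 e = 0) ∧
      ∀ x, x ∈ strip E ↔ ∀ q ∈ Q, q.1 x ≤ q.2 := by
  obtain ⟨Q, hQ⟩ := isPolyhedron_strip E
  refine ⟨Q, fun q hq e he => ?_, hQ⟩
  have h0 : (0 : Space N) ∈ strip E := mem_strip_iff.2 ⟨0, fun i => by simp, by simp⟩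
  -- The strip contains the whole line `ℝ e`, and a linear functional bounded above on a line
  -- through `0` vanishes on it.
  have hb : ∀ t : ℝ, t * q.1 e ≤ q.2 := by
    intro t
    have := (hQ _).1 ((add_mem_strip_iff (E.smul_mem t he)).2 h0) q hq
    simpa using this
  by_contra hne
  have := hb ((q.2 + 1) / q.1 e)
  rw [div_mul_cancel₀ _ hne] at this
  linarith

end CanonicalProjection

namespace CanonicalProjection

/-! ### Closed subgroups of Euclidean spaces -/

section ClosedSubgroup

variable {X : Type*} [NormedAddCommGroup X] [InnerProductSpace ℝ X]

/-- The largest linear subspace contained in a subgroup. -/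
def largestSubspace (C : AddSubgroup X) : Submodule ℝ X where
  carrier := {v | ∀ t : ℝ, t • v ∈ C}
  zero_mem' := fun t => by simp
  add_mem' := fun ha hb t => by
    rw [smul_add]
    exact C.add_mem (ha t) (hb t)
  smul_mem' := fun s x hx t => by
    rw [smul_smul]
    exact hx _

theorem largestSubspace_le {C : AddSubgroup X} {v : X} (hv : v ∈ largestSubspace C) : v ∈ C := by
  simpa using hv 1

variable [FiniteDimensional ℝ X]

/-- Otherwise there are nonzero elements of `C` orthogonal to the subspace and tending to `0`.
Integer multiples of them fill up a line in a limiting direction `w`, so the unit vector `w` would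
lie both in the subspace and in its orthocomplement. -/
theorem exists_isolating_radius {C : AddSubgroup X} (hC : IsClosed (C : Set X)) :
    ∃ r : ℝ, 0 < r ∧ ∀ c ∈ C, ‖c - (largestSubspace C).starProjection c‖ < r →
      c ∈ largestSubspace C := by
  set W := largestSubspace C
  by_contra! hcon
  choose c hcC hc hcW using fun n : ℕ => hcon (1 / ((n : ℝ) + 1)) (by positivity)
  let e : ℕ → X := fun n => c n - W.starProjection (c n)
  have heC : ∀ n, e n ∈ C := fun n =>
    C.sub_mem (hcC n) (largestSubspace_le (Submodule.starProjection_apply_mem _ _))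
  have heo : ∀ n, e n ∈ Wᗮ := fun n => Submodule.sub_starProjection_mem_orthogonal _
  have he0 : ∀ n, e n ≠ 0 := fun n h => hcW n (by
    rw [sub_eq_zero.1 h]
    exact Submodule.starProjection_apply_mem _ _)
  have hlim : Tendsto (fun n => ‖e n‖) atTop (𝓝 0) :=
    squeeze_zero (fun n => norm_nonneg _) (fun n => (hc n).le)
      tendsto_one_div_add_atTop_nhds_zero_nat
  have hsph : ∀ n, (‖e n‖)⁻¹ • e n ∈ Metric.sphere (0 : X) 1 := fun n => by
    rw [mem_sphere_zero_iff_norm, norm_smul, norm_inv, norm_norm,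
      inv_mul_cancel₀ (norm_ne_zero_iff.2 (he0 n))]
  obtain ⟨w, hw, φ, hφ, hφw⟩ := (isCompact_sphere (0 : X) 1).tendsto_subseq hsph
  have hwW : w ∈ W := by
    intro t
    -- These integer multiples have length within `‖e (φ n)‖` of `t`, and their direction tends to
    -- that of `w`.
    have h1 : Tendsto (fun n => ⌊t / ‖e (φ n)‖⌋ • e (φ n)) atTop (𝓝 (t • w)) := by
      have h2 : Tendsto (fun n => ((⌊t / ‖e (φ n)‖⌋ : ℝ) * ‖e (φ n)‖)) atTop (𝓝 t) := by
        have h3 : Tendsto (fun n => t - ‖e (φ n)‖) atTop (𝓝 (t - 0)) :=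
          tendsto_const_nhds.sub (hlim.comp hφ.tendsto_atTop)
        rw [sub_zero] at h3
        refine tendsto_of_tendsto_of_tendsto_of_le_of_le h3 tendsto_const_nhds ?_ ?_
        · intro n
          have hp : 0 < ‖e (φ n)‖ := norm_pos_iff.2 (he0 _)
          have := Int.lt_floor_add_one (t / ‖e (φ n)‖)
          rw [div_lt_iff₀ hp] at this
          simp only
          linarith
        · intro n
          have hp : 0 < ‖e (φ n)‖ := norm_pos_iff.2 (he0 _)
          have := Int.floor_le (t / ‖e (φ n)‖)
          rwa [le_div_iff₀ hp] at this
      refine (h2.smul hφw).congr fun n => ?_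
      simp only [Function.comp]
      rw [smul_smul, mul_assoc, mul_inv_cancel₀ (norm_ne_zero_iff.2 (he0 _)), mul_one,
        Int.cast_smul_eq_zsmul]
    exact hC.mem_of_tendsto h1 (Eventually.of_forall fun n => C.zsmul_mem (heC _) _)
  have hwo : w ∈ Wᗮ := (Submodule.isClosed_orthogonal W).mem_of_tendsto hφw
    (Eventually.of_forall fun n => Submodule.smul_mem _ _ (heo _))
  have h0 : w = 0 := by
    have := Submodule.inner_right_of_mem_orthogonal hwW hwo
    exact inner_self_eq_zero.1 this
  rw [h0] at hw
  simp at hw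

/-- The isolating radius leaves a gap in the distances from points of `C` to the subspace, and a
connected set containing `0` cannot jump over it. -/
theorem connectedComponentIn_zero_eq {C : AddSubgroup X} (hC : IsClosed (C : Set X)) :
    connectedComponentIn (C : Set X) 0 = largestSubspace C := by
  set W := largestSubspace C
  obtain ⟨r, hr, h⟩ := exists_isolating_radius hC
  apply Set.Subset.antisymm
  · have hcont : Continuous fun x : X => ‖x - W.starProjection x‖ := by fun_prop
    have hsub : connectedComponentIn (C : Set X) 0 ⊆ {x | ‖x - W.starProjection x‖ < r / 2} := by
      refine IsPreconnected.subset_left_of_subset_union (v := {x | r / 2 < ‖x - W.starProjection x‖})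
        (isOpen_lt hcont continuous_const) (isOpen_lt continuous_const hcont) ?_ ?_ ?_
        isPreconnected_connectedComponentIn
      · rw [Set.disjoint_left]
        intro x hx hx'
        exact lt_asymm (b := r / 2) hx hx'
      · intro x hx
        have hxC := connectedComponentIn_subset _ _ hx
        rcases lt_or_ge ‖x - W.starProjection x‖ r with h1 | h1
        · left
          have := Submodule.starProjection_eq_self_iff.2 (h x hxC h1)
          change ‖x - W.starProjection x‖ < r / 2
          rw [this]
          simpa using hr
        · right
          change r / 2 < ‖x - W.starProjection x‖
          linarith
      · exact ⟨0, mem_connectedComponentIn C.zero_mem, by simpa using hr⟩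
    intro x hx
    refine h x (connectedComponentIn_subset _ _ hx) ((hsub hx).trans (by linarith))
  · refine IsPreconnected.subset_connectedComponentIn ?_ W.zero_mem fun v hv =>
      largestSubspace_le hv
    exact W.convex.isPreconnected

end ClosedSubgroup

/-! ### The space `V` and the group `Γ` -/

variable {N : ℕ} {E F : Submodule ℝ (Space N)} {u : Space N}

section Skew

variable (hEF : IsCompl E F)

theorem skewProjection_mem (x : Space N) : skewProjection hEF x ∈ F :=
  Submodule.projection_apply_mem _ x

theorem skewProjection_eq_zero_iff {x : Space N} : skewProjection hEF x = 0 ↔ x ∈ E :=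
  Submodule.projection_apply_eq_zero_iff _

theorem skewProjection_of_mem {x : Space N} (hx : x ∈ F) : skewProjection hEF x = x :=
  Submodule.projection_apply_left hEF.symm ⟨x, hx⟩

theorem sub_skewProjection_mem (x : Space N) : x - skewProjection hEF x ∈ E := by
  rw [← skewProjection_eq_zero_iff hEF, map_sub,
    skewProjection_of_mem hEF (skewProjection_mem hEF x), sub_self]

theorem continuous_skewProjection : Continuous (skewProjection hEF) :=
  LinearMap.continuous_of_finiteDimensional _

/-- The projected lattice. -/
def projLattice : AddSubgroup (Space N) :=
  (lattice N).map (skewProjection hEF).toAddMonoidHom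

theorem contSpace_eq : contSpace hEF = largestSubspace (projLattice hEF).topologicalClosure := by
  have h := connectedComponentIn_zero_eq
    (AddSubgroup.isClosed_topologicalClosure (projLattice hEF))
  unfold contSpace
  have h2 : closure ((fun x => skewProjection hEF x) '' (lattice N : Set (Space N))) =
      ((projLattice hEF).topologicalClosure : Set (Space N)) := rfl
  rw [h2, h, Submodule.span_eq]

theorem mem_translationGroup {z : Space N} :
    z ∈ translationGroup hEF ↔ z ∈ lattice N ∧ skewProjection hEF z ∈ contSpace hEF := Iff.rfl

/-- Makes lying over `V` an open condition on lattice points: it suffices to be close to `V`. This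
is what lets the condition pass between a net of patterns and its limit. -/
theorem exists_contSpace_radius : ∃ r : ℝ, 0 < r ∧ ∀ z ∈ lattice N, ∀ v ∈ contSpace hEF,
    ‖skewProjection hEF z - v‖ < r → skewProjection hEF z ∈ contSpace hEF := by
  obtain ⟨r, hr, h⟩ := exists_isolating_radius
    (AddSubgroup.isClosed_topologicalClosure (projLattice hEF))
  rw [← contSpace_eq] at h
  refine ⟨r, hr, fun z hz v hv hzv => h _ ?_ (lt_of_le_of_lt ?_ hzv)⟩
  · exact AddSubgroup.le_topologicalClosure _ ⟨z, hz, rfl⟩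
  · set W := contSpace hEF
    set y := skewProjection hEF z
    have h1 : y - W.starProjection y = Wᗮ.starProjection (y - v) := by
      rw [Submodule.starProjection_orthogonal_val, map_sub,
        Submodule.starProjection_eq_self_iff.2 hv]
      abel
    rw [h1]
    exact Submodule.norm_starProjection_apply_le _ _

theorem contSpace_le : contSpace hEF ≤ F := by
  intro v hv
  rw [contSpace_eq] at hv
  have h1 := largestSubspace_le hv
  have h2 : ((projLattice hEF).topologicalClosure : Set (Space N)) ⊆ F := by
    refine closure_minimal ?_ F.closed_of_finiteDimensional
    rintro _ ⟨z, -, rfl⟩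
    exact skewProjection_mem hEF z
  exact h2 h1

/-- `V` lies in the closure of the projected lattice, and the isolating radius forces the
approximating lattice points to belong to `Γ`. -/
theorem exists_translationGroup_near {v : Space N} (hv : v ∈ contSpace hEF) {ε : ℝ} (hε : 0 < ε) :
    ∃ γ ∈ translationGroup hEF, ‖skewProjection hEF γ - v‖ < ε := by
  obtain ⟨r, hr, h⟩ := exists_contSpace_radius hEF
  have hv' := hv
  rw [contSpace_eq] at hv'
  have h1 : v ∈ closure ((projLattice hEF : Set (Space N))) := largestSubspace_le hv'
  obtain ⟨_, ⟨z, hz, rfl⟩, h2⟩ := Metric.mem_closure_iff.1 h1 (min ε r) (lt_min hε hr)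
  rw [dist_comm, dist_eq_norm] at h2
  exact ⟨z, ⟨hz, h z hz v hv (h2.trans_le (min_le_right _ _))⟩, h2.trans_le (min_le_left _ _)⟩

end Skew

/-- The integer part of a vector. -/
def latticeFloor (x : Space N) : Space N := WithLp.toLp 2 fun i => (⌊x i⌋ : ℝ)

theorem latticeFloor_mem (x : Space N) : latticeFloor x ∈ lattice N :=
  fun i => ⟨⌊x i⌋, rfl⟩

theorem sub_latticeFloor_mem (x : Space N) : x - latticeFloor x ∈ unitCube N := by
  intro i
  simp only [latticeFloor, PiLp.sub_apply]
  exact ⟨by linarith [Int.floor_le (x i)], by linarith [Int.lt_floor_add_one (x i)]⟩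

theorem finite_lattice_of_isBounded {s : Set (Space N)} (hs : Bornology.IsBounded s) :
    (s ∩ lattice N).Finite := by
  obtain ⟨R, hR⟩ := hs.exists_norm_le
  let T : Set (Fin N → ℤ) := Set.pi Set.univ fun _ => Set.Icc (-⌈R⌉) ⌈R⌉
  have hT : T.Finite := Set.Finite.pi fun _ => Set.finite_Icc _ _
  refine (hT.image fun k => (WithLp.toLp 2 fun i => (k i : ℝ) : Space N)).subset ?_
  rintro x ⟨hx, hL⟩
  choose k hk using hL
  refine ⟨k, fun i _ => ?_, ?_⟩
  · have h1 : |x i| ≤ R := by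
      have := PiLp.norm_apply_le x i
      rw [Real.norm_eq_abs] at this
      exact this.trans (hR x hx)
    rw [hk, abs_le] at h1
    have h2 := Int.le_ceil R
    constructor
    · have : (-(⌈R⌉ : ℝ)) ≤ k i := by linarith
      exact_mod_cast this
    · have : (k i : ℝ) ≤ ⌈R⌉ := by linarith
      exact_mod_cast this
  · ext i
    simp [hk]

section Skew

variable (hEF : IsCompl E F)

/-- Real multiples of a vector over `V` are approximated by `Γ` up to bounded error. -/
theorem span_translationGroup :
    Submodule.span ℝ (translationGroup hEF : Set (Space N)) =
      (contSpace hEF).comap (skewProjection hEF) := by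
  apply le_antisymm
  · rw [Submodule.span_le]
    intro z hz
    exact hz.2
  · intro x hx
    obtain ⟨r, hr, h⟩ := exists_contSpace_radius hEF
    obtain ⟨C, hC⟩ := (isCompact_unitCube (N := N)).isBounded.exists_norm_le
    set W := contSpace hEF
    -- Along a subsequence the remainders `q` converge, so differences of the integer parts of
    -- multiples of `x` project close to `V` and hence lie in `Γ`. Dividing them by `φ n` recovers
    -- `x`.
    let z : ℕ → Space N := fun n => latticeFloor ((n : ℝ) • x)
    let q : ℕ → Space N := fun n => (n : ℝ) • x - z n
    have hqC : ∀ n, q n ∈ unitCube N := fun n => sub_latticeFloor_mem _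
    obtain ⟨q₀, hq₀, φ, hφ, hφq⟩ := isCompact_unitCube.tendsto_subseq hqC
    have hq' : Tendsto (fun n => skewProjection hEF (q (φ n))) atTop
        (𝓝 (skewProjection hEF q₀)) := ((continuous_skewProjection hEF).tendsto _).comp hφq
    obtain ⟨M, hM⟩ := (Metric.tendsto_atTop.1 hq') (r / 2) (by positivity)
    have hΓ : ∀ n ≥ M, z (φ n) - z (φ M) ∈ translationGroup hEF := by
      intro n hn
      have hL : z (φ n) - z (φ M) ∈ lattice N :=
        (lattice N).sub_mem (latticeFloor_mem _) (latticeFloor_mem _)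
      refine ⟨hL, h _ hL (skewProjection hEF (((φ n : ℝ) - φ M) • x)) ?_ ?_⟩
      · rw [map_smul]
        exact W.smul_mem _ hx
      · rw [← map_sub]
        have : z (φ n) - z (φ M) - ((φ n : ℝ) - φ M) • x = q (φ M) - q (φ n) := by
          simp only [q, sub_smul]
          abel
        rw [this, map_sub, ← dist_eq_norm]
        have h1 := hM n hn
        have h2 := hM M le_rfl
        have := dist_triangle_right (skewProjection hEF (q (φ M))) (skewProjection hEF (q (φ n)))
          (skewProjection hEF q₀)
        linarith
    have hlim : Tendsto (fun n => ((φ n : ℝ))⁻¹ • (z (φ n) - z (φ M))) atTop (𝓝 x) := by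
      have hinv : Tendsto (fun n => ((φ n : ℝ))⁻¹) atTop (𝓝 0) :=
        tendsto_inv_atTop_zero.comp
          (tendsto_natCast_atTop_atTop.comp hφ.tendsto_atTop)
      have h1 : Tendsto (fun n => ((φ n : ℝ))⁻¹ • (q (φ n) + z (φ M))) atTop (𝓝 0) := by
        have := hinv.smul (hφq.add_const (z (φ M)))
        rwa [zero_smul] at this
      have h2 : Tendsto (fun n => x - ((φ n : ℝ))⁻¹ • (q (φ n) + z (φ M))) atTop (𝓝 (x - 0)) :=
        tendsto_const_nhds.sub h1
      rw [sub_zero] at h2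
      refine h2.congr' ?_
      filter_upwards [eventually_ge_atTop 1] with n hn
      have hne : ((φ n : ℝ)) ≠ 0 := by
        have := hφ.id_le n
        have h3 : 0 < φ n := lt_of_lt_of_le hn this
        exact_mod_cast h3.ne'
      have : z (φ n) - z (φ M) = (φ n : ℝ) • x - (q (φ n) + z (φ M)) := by
        simp only [q]
        abel
      rw [this, smul_sub, smul_smul, inv_mul_cancel₀ hne, one_smul]
    refine (Submodule.closed_of_finiteDimensional _).mem_of_tendsto hlim ?_
    filter_upwards [eventually_ge_atTop M] with n hn
    exact Submodule.smul_mem _ _ (Submodule.subset_span (hΓ n hn))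

theorem inner_mem_int {z w : Space N} (hz : z ∈ lattice N) (hw : w ∈ lattice N) :
    ∃ k : ℤ, inner ℝ z w = k := by
  choose a ha using hz
  choose b hb using hw
  refine ⟨∑ i, b i * a i, ?_⟩
  simp [PiLp.inner_apply, ha, hb]

/-- If `z` is orthogonal to `E`, then the inner product with `z` factors through `π'` and is
integral on the lattice. But `π'(Γ)` is dense in `V`, which contains `π'(z)`, so nonintegral values
would be approximated. The consequence used throughout is that `Γ` embeds into `E` by orthogonal
projection. -/
theorem eq_zero_of_mem_translationGroup {z : Space N} (hz : z ∈ translationGroup hEF)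
    (h0 : E.starProjection z = 0) : z = 0 := by
  have horth : z ∈ Eᗮ := (Submodule.starProjection_apply_eq_zero_iff _).1 h0
  have hskew : ∀ x, inner ℝ z x = inner ℝ z (skewProjection hEF x) := by
    intro x
    rw [← sub_eq_zero, ← inner_sub_right]
    exact Submodule.inner_left_of_mem_orthogonal (sub_skewProjection_mem hEF x) horth
  by_contra hne
  have hpos : 0 < inner ℝ z z := real_inner_self_pos.2 hne
  set v := skewProjection hEF z
  have hvV : v ∈ contSpace hEF := hz.2
  have hzv : inner ℝ z v = inner ℝ z z := (hskew z).symm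
  -- Chosen so that the inner product of `z` with `s • v` is `1/2`; an error of at most `1/4` still
  -- excludes every integer.
  set s := (2 * inner ℝ z z)⁻¹
  obtain ⟨γ, hγ, hγv⟩ := exists_translationGroup_near hEF ((contSpace hEF).smul_mem s hvV)
    (ε := (4 * ‖z‖)⁻¹) (by have := norm_pos_iff.2 hne; positivity)
  obtain ⟨k, hk⟩ := inner_mem_int hz.1 hγ.1
  have h1 : |inner ℝ z (skewProjection hEF γ - s • v)| ≤ 1 / 4 := by
    refine (abs_real_inner_le_norm _ _).trans ?_
    have := mul_le_mul_of_nonneg_left hγv.le (norm_nonneg z)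
    refine this.trans (le_of_eq ?_)
    have := norm_ne_zero_iff.2 hne
    field_simp
  have h2 : s * inner ℝ z z = 1 / 2 := by
    simp only [s]
    field_simp
  rw [inner_sub_right, inner_smul_right, ← hskew, hzv, hk, h2, abs_le] at h1
  obtain ⟨h3, h4⟩ := h1
  have h5 : (0 : ℝ) < k := by linarith
  have h6 : (k : ℝ) < 1 := by linarith
  have h7 : 0 < k := by exact_mod_cast h5
  have h8 : k < 1 := by exact_mod_cast h6
  omega

end Skew

end CanonicalProjection

namespace CanonicalProjection

variable {N : ℕ} {E F : Submodule ℝ (Space N)} {u : Space N}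

/-! ### The space of closed subsets of the strip -/

theorem patternDist_comm (S A A' : Set (Space N)) :
    patternDist E S A A' = patternDist E S A' A := by
  unfold patternDist
  simp only [Metric.hausdorffEDist_comm]

/-- The margin `1` between `x` and the radius guarantees that the point found near `x` belongs to
`A'` and not to the sphere that windows add artificially. -/
theorem exists_near_of_patternDist_lt {S A A' : Set (Space N)} (hAS : A ⊆ S) {r : ℝ} (hr : 1 ≤ r)
    (h : patternDist E S A A' < ENNReal.ofReal (1 / (r + 1))) {x : Space N} (hx : x ∈ A)
    (hxr : ‖E.starProjection x‖ + 1 ≤ r) : ∃ y ∈ A', dist x y < 1 / r := by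
  obtain ⟨_, ⟨s, hs, hd, rfl⟩, hlt⟩ := sInf_lt_iff.1 h
  have hrs : r < s := by
    rw [ENNReal.ofReal_lt_ofReal_iff (by positivity)] at hlt
    have := (one_div_lt_one_div (by positivity) (by positivity)).1 hlt
    linarith
  have hxw : x ∈ window E S A s := Or.inl ⟨hx, hAS hx, by linarith⟩
  obtain ⟨y, hy, hxy⟩ := Metric.exists_edist_lt_of_hausdorffEDist_lt hxw hd
  rw [edist_dist, ENNReal.ofReal_lt_ofReal_iff (by positivity)] at hxy
  have hxy' : dist x y < 1 / r := hxy.trans (one_div_lt_one_div_of_lt (by positivity) hrs)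
  rcases hy with hy | hy
  · exact ⟨y, hy.1, hxy'⟩
  · exfalso
    have h1 : ‖E.starProjection y‖ ≤ ‖E.starProjection x‖ + dist x y := by
      have : E.starProjection y = E.starProjection x - E.starProjection (x - y) := by
        rw [map_sub]
        abel
      rw [this, dist_eq_norm]
      exact (norm_sub_le _ _).trans
        (add_le_add_right (Submodule.norm_starProjection_apply_le _ _) _)
    have h2 : 1 / r ≤ 1 := by
      rw [div_le_one (by positivity)]
      exact hr
    have h3 : ‖E.starProjection y‖ = s := hy.2
    linarith

/-- With `isOpen_miss` this shows that the pattern topology refines the hit-or-miss topology. Only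
this and compactness are used of the metric from here on. -/
theorem isOpen_hit (S : Set (Space N)) {O : Set (Space N)} (hO : IsOpen O) :
    IsOpen {A : ClosedIn E S | ∃ x ∈ A.carrier, x ∈ O} := by
  rintro A ⟨x, hx, hxO⟩
  obtain ⟨δ, hδ, hball⟩ := Metric.isOpen_iff.1 hO x hxO
  set r : ℝ := max (‖E.starProjection x‖ + 1) (1 / δ)
  have h1 : 1 ≤ r := le_max_of_le_left (by linarith [norm_nonneg (E.starProjection x)])
  refine ⟨ENNReal.ofReal (1 / (r + 1)), ENNReal.ofReal_pos.2 (by positivity), fun A' hA' => ?_⟩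
  obtain ⟨y, hy, hxy⟩ := exists_near_of_patternDist_lt A.subset h1 hA' hx (le_max_left _ _)
  refine ⟨y, hy, hball ?_⟩
  rw [Metric.mem_ball, dist_comm]
  refine hxy.trans_le ?_
  rw [div_le_iff₀ (by positivity), ← div_le_iff₀' hδ]
  exact le_max_right _ _

theorem isOpen_miss (S : Set (Space N)) {C : Set (Space N)} (hC : IsCompact C) :
    IsOpen {A : ClosedIn E S | ∀ x ∈ A.carrier, x ∉ C} := by
  intro A hA
  obtain ⟨δ, hδ, hth⟩ := hC.exists_thickening_subset_open A.isClosed.isOpen_compl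
    (fun x hx hxA => hA x hxA hx)
  obtain ⟨R, hR⟩ := hC.isBounded.exists_norm_le
  set r : ℝ := max (max 1 (R + 1)) (1 / δ)
  have h1 : 1 ≤ r := le_max_of_le_left (le_max_left _ _)
  refine ⟨ENNReal.ofReal (1 / (r + 1)), ENNReal.ofReal_pos.2 (by positivity),
    fun A' hA' y hy hyC => ?_⟩
  rw [patternDist_comm] at hA'
  have hyr : ‖E.starProjection y‖ + 1 ≤ r := by
    have h2 := (Submodule.norm_starProjection_apply_le E y).trans (hR y hyC)
    exact le_trans (by linarith) (le_max_of_le_left (le_max_right _ _) : R + 1 ≤ r)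
  obtain ⟨x, hx, hxy⟩ := exists_near_of_patternDist_lt A'.subset h1 hA' hy hyr
  refine hth (Metric.mem_thickening_iff.2 ⟨y, hyC, ?_⟩) hx
  rw [dist_comm]
  refine hxy.trans_le ?_
  rw [div_le_iff₀ (by positivity), ← div_le_iff₀' hδ]
  exact le_max_right _ _

/-- A point of the strip just outside `C(r)` is close to a point of the strip above the sphere. -/
theorem exists_sphere_point {x y : Space N} {r : ℝ} (hr : 0 < r) (hx : ‖E.starProjection x‖ ≤ r)
    (hy : y ∈ strip E) (hyr : r < ‖E.starProjection y‖) :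
    ∃ y' ∈ strip E, ‖E.starProjection y'‖ = r ∧ dist y y' ≤ dist x y := by
  set p := E.starProjection y with hp
  have hpos : 0 < ‖p‖ := hr.trans hyr
  have hpE : p ∈ E := Submodule.starProjection_apply_mem _ _
  have hpp : E.starProjection p = p := Submodule.starProjection_eq_self_iff.2 hpE
  refine ⟨y + (r / ‖p‖ - 1) • p, (add_mem_strip_iff (E.smul_mem _ hpE)).2 hy, ?_, ?_⟩
  · rw [map_add, map_smul, hpp, ← hp]
    have : p + (r / ‖p‖ - 1) • p = (r / ‖p‖) • p := by
      rw [sub_smul, one_smul]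
      abel
    rw [this, norm_smul, Real.norm_of_nonneg (by positivity), div_mul_cancel₀ _ hpos.ne']
  · rw [dist_eq_norm, sub_add_cancel_left, norm_neg, norm_smul]
    have h1 : r / ‖p‖ - 1 ≤ 0 := by
      rw [sub_nonpos, div_le_one hpos]
      exact hyr.le
    rw [Real.norm_of_nonpos h1]
    have h2 : -(r / ‖p‖ - 1) * ‖p‖ = ‖p‖ - r := by
      field_simp
      ring
    rw [h2]
    have h3 : ‖p‖ ≤ ‖E.starProjection x‖ + dist x y := by
      have : p = E.starProjection x - E.starProjection (x - y) := by
        rw [map_sub]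
        abel
      rw [this, dist_eq_norm]
      exact (norm_sub_le _ _).trans
        (add_le_add_right (Submodule.norm_starProjection_apply_le _ _) _)
    linarith

/-- The Kuratowski limit of closed subsets along an ultrafilter. -/
def limitSet (S : Set (Space N)) (hS : IsClosed S) (𝒰 : Ultrafilter (ClosedIn E S)) :
    ClosedIn E S where
  carrier := {x | ∀ δ > 0, ∀ᶠ A : ClosedIn E S in 𝒰, ∃ y ∈ A.carrier, dist x y < δ}
  isClosed := by
    refine isClosed_of_closure_subset fun x hx δ hδ => ?_
    obtain ⟨x', hx', hxx'⟩ := Metric.mem_closure_iff.1 hx (δ / 2) (by positivity)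
    filter_upwards [hx' (δ / 2) (by positivity)] with A hA
    obtain ⟨y, hy, hxy⟩ := hA
    exact ⟨y, hy, by linarith [dist_triangle x x' y]⟩
  subset := by
    intro x hx
    refine hS.closure_subset (Metric.mem_closure_iff.2 fun δ hδ => ?_)
    obtain ⟨A, y, hy, hxy⟩ := (hx δ hδ).exists
    exact ⟨y, A.subset hy, hxy⟩

theorem Ultrafilter.exists_limit_of_mem {ι X : Type*} [TopologicalSpace X] (𝒰 : Ultrafilter ι)
    {f : ι → X} {K : Set X} (hK : IsCompact K) (h : ∀ᶠ i in 𝒰, f i ∈ K) :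
    ∃ x ∈ K, Tendsto f 𝒰 (𝓝 x) := by
  obtain ⟨x, hx, hle⟩ := hK.ultrafilter_le_nhds (𝒰.map f) (le_principal_iff.2 h)
  exact ⟨x, hx, hle⟩

/-- The strip is bounded across `E`, so windows lie in compact sets. If one window were not close to
the other along the ultrafilter, the offending points would have a limit, which contradicts the
definition of the limit set. -/
theorem tendsto_limitSet (𝒰 : Ultrafilter (ClosedIn E (strip E))) :
    (𝒰 : Filter _) ≤ 𝓝 (limitSet (strip E) isClosed_strip 𝒰) := by
  classical
  set A := limitSet (strip E) isClosed_strip 𝒰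
  have hmem : ∀ x, x ∈ A.carrier ↔
    ∀ δ > 0, ∀ᶠ A' : ClosedIn E (strip E) in 𝒰, ∃ y ∈ A'.carrier, dist x y < δ := fun x => Iff.rfl
  have key : ∀ r > (0 : ℝ), ∀ᶠ A' : ClosedIn E (strip E) in 𝒰,
      Metric.hausdorffEDist (window E (strip E) A.carrier r) (window E (strip E) A'.carrier r) <
        ENNReal.ofReal (1 / r) := by
    intro r hr
    set δ : ℝ := 1 / (2 * r)
    have hδpos : 0 < δ := by positivity
    have hδr : ENNReal.ofReal δ < ENNReal.ofReal (1 / r) := by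
      rw [ENNReal.ofReal_lt_ofReal_iff (by positivity)]
      exact one_div_lt_one_div_of_lt hr (by linarith)
    have d1 : ∀ᶠ A' : ClosedIn E (strip E) in 𝒰, ∀ y ∈ window E (strip E) A'.carrier r,
        ∃ x ∈ window E (strip E) A.carrier r, edist y x ≤ ENNReal.ofReal δ := by
      by_contra hcon
      rw [← Ultrafilter.eventually_not] at hcon
      have hch : ∀ A' : ClosedIn E (strip E), ∃ y, (¬ ∀ y ∈ window E (strip E) A'.carrier r,
        ∃ x ∈ window E (strip E) A.carrier r, edist y x ≤ ENNReal.ofReal δ) →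
        y ∈ window E (strip E) A'.carrier r ∧
          ∀ x ∈ window E (strip E) A.carrier r, ¬ edist y x ≤ ENNReal.ofReal δ := by
        intro A'
        by_cases hh : ∀ y ∈ window E (strip E) A'.carrier r,
          ∃ x ∈ window E (strip E) A.carrier r, edist y x ≤ ENNReal.ofReal δ
        · exact ⟨0, fun h => absurd hh h⟩
        · push Not at hh
          obtain ⟨y, hy, hy'⟩ := hh
          exact ⟨y, fun _ => ⟨hy, fun x hx => not_le.2 (hy' x hx)⟩⟩
      choose y hy using hch
      have hy2 : ∀ᶠ A' in 𝒰, y A' ∈ A'.carrier ∧ (y A' ∈ strip E ∧ ‖E.starProjection (y A')‖ ≤ r) ∧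
          ∀ x ∈ window E (strip E) A.carrier r, ¬ edist (y A') x ≤ ENNReal.ofReal δ := by
        filter_upwards [hcon] with A' h
        obtain ⟨h1, h2⟩ := hy A' h
        rcases h1 with h1 | h1
        · exact ⟨h1.1, h1.2, h2⟩
        · exact absurd (by simp) (h2 _ (Or.inr h1))
      obtain ⟨y₀, hy₀, hlim⟩ := Ultrafilter.exists_limit_of_mem 𝒰 (isCompact_strip_ball E r)
        (hy2.mono fun _ h => h.2.1)
      have hy₀A : y₀ ∈ A.carrier := by
        intro η hη
        filter_upwards [hy2, Metric.tendsto_nhds.1 hlim η hη] with A' h1 h2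
        exact ⟨y A', h1.1, by rwa [dist_comm]⟩
      obtain ⟨A', h1, h2⟩ := (hy2.and (Metric.tendsto_nhds.1 hlim δ hδpos)).exists
      refine h1.2.2 y₀ (Or.inl ⟨hy₀A, hy₀⟩) ?_
      rw [edist_dist]
      exact ENNReal.ofReal_le_ofReal h2.le
    have d2 : ∀ᶠ A' : ClosedIn E (strip E) in 𝒰, ∀ x ∈ window E (strip E) A.carrier r,
        ∃ y ∈ window E (strip E) A'.carrier r, edist x y ≤ ENNReal.ofReal δ := by
      by_contra hcon
      rw [← Ultrafilter.eventually_not] at hcon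
      have hch : ∀ A' : ClosedIn E (strip E), ∃ x, (¬ ∀ x ∈ window E (strip E) A.carrier r,
        ∃ y ∈ window E (strip E) A'.carrier r, edist x y ≤ ENNReal.ofReal δ) →
        x ∈ window E (strip E) A.carrier r ∧
          ∀ y ∈ window E (strip E) A'.carrier r, ¬ edist x y ≤ ENNReal.ofReal δ := by
        intro A'
        by_cases hh : ∀ x ∈ window E (strip E) A.carrier r,
          ∃ y ∈ window E (strip E) A'.carrier r, edist x y ≤ ENNReal.ofReal δ
        · exact ⟨0, fun h => absurd hh h⟩
        · push Not at hh
          obtain ⟨y, hy, hy'⟩ := hh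
          exact ⟨y, fun _ => ⟨hy, fun x hx => not_le.2 (hy' x hx)⟩⟩
      choose x hx using hch
      have hx2 : ∀ᶠ A' in 𝒰, x A' ∈ A.carrier ∩ {x | x ∈ strip E ∧ ‖E.starProjection x‖ ≤ r} ∧
          ∀ y ∈ window E (strip E) A'.carrier r, ¬ edist (x A') y ≤ ENNReal.ofReal δ := by
        filter_upwards [hcon] with A' h
        obtain ⟨h1, h2⟩ := hx A' h
        rcases h1 with h1 | h1
        · exact ⟨h1, h2⟩
        · exact absurd (by simp) (h2 _ (Or.inr h1))
      obtain ⟨x₀, hx₀, hlim⟩ := Ultrafilter.exists_limit_of_mem 𝒰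
        ((isCompact_strip_ball E r).inter_left A.isClosed) (hx2.mono fun _ h => h.1)
      obtain ⟨A', ⟨h1, h2⟩, h3, y, hyA, h4⟩ := (hx2.and ((Metric.tendsto_nhds.1 hlim (δ / 4)
        (by positivity)).and (hx₀.1 (δ / 4) (by positivity)))).exists
      rcases le_or_gt ‖E.starProjection y‖ r with h5 | h5
      · refine h2 y (Or.inl ⟨hyA, A'.subset hyA, h5⟩) ?_
        rw [edist_dist]
        refine ENNReal.ofReal_le_ofReal ?_
        linarith [dist_triangle (x A') x₀ y]
      -- The approximating point may have slipped out of the window. Since windows contain the part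
      -- of the strip above the sphere, it can be replaced by a point there at a comparable
      -- distance.
      · obtain ⟨y', hy', hyr', hd⟩ := exists_sphere_point hr hx₀.2.2 (A'.subset hyA) h5
        refine h2 y' (Or.inr ⟨hy', hyr'⟩) ?_
        rw [edist_dist]
        refine ENNReal.ofReal_le_ofReal ?_
        linarith [dist_triangle (x A') x₀ y, dist_triangle (x A') y y']
    filter_upwards [d1, d2] with A' h1 h2
    exact (Metric.hausdorffEDist_le_of_mem_edist h2 h1).trans_lt hδr
  intro U hU
  obtain ⟨O, hOU, hO, hAO⟩ := mem_nhds_iff.1 hU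
  obtain ⟨ε, hε, hball⟩ := hO A hAO
  obtain ⟨r, hr, hrε⟩ : ∃ r : ℝ, 0 < r ∧ ENNReal.ofReal (1 / (r + 1)) < ε := by
    obtain ⟨n, hn⟩ := ENNReal.exists_inv_nat_lt hε.ne'
    refine ⟨n + 1, by positivity, lt_of_le_of_lt ?_ hn⟩
    rw [one_div, ENNReal.ofReal_inv_of_pos (by positivity), ENNReal.inv_le_inv]
    rw [← ENNReal.ofReal_natCast]
    exact ENNReal.ofReal_le_ofReal (by linarith)
  refine mem_of_superset (key r hr) fun A' hA' => hOU (hball A' (lt_of_le_of_lt ?_ hrε))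
  exact sInf_le ⟨r, hr, hA', rfl⟩

instance : CompactSpace (ClosedIn E (strip E)) :=
  ⟨isCompact_iff_ultrafilter_le_nhds.2 fun 𝒰 _ => ⟨_, trivial, tendsto_limitSet 𝒰⟩⟩

instance : CompactSpace (StripHull E u) :=
  isCompact_iff_compactSpace.1 isClosed_closure.isCompact

/-! ### The hull as a space of closed subsets of the strip -/

theorem isClosed_lattice : IsClosed (lattice N : Set (Space N)) := by
  have : (lattice N : Set (Space N)) = ⋂ i, (fun x : Space N => x i) ⁻¹' Set.range ((↑) : ℤ → ℝ) := by
    ext x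
    simp only [Set.mem_iInter, Set.mem_preimage, Set.mem_range]
    exact forall_congr' fun i => exists_congr fun k => eq_comm
  rw [this]
  refine isClosed_iInter fun i => IsClosed.preimage (by fun_prop) ?_
  exact Int.isClosedEmbedding_coe_real.isClosed_range

/-- `P̃_v` as a closed subset of the strip. -/
def stripPatternIn (E : Submodule ℝ (Space N)) (v : Space N) : ClosedIn E (strip E) where
  carrier := stripPattern E v
  isClosed := isClosed_strip.inter (isClosed_lattice.preimage (continuous_id.sub continuous_const))
  subset := fun _ h => h.1

theorem translate_stripPattern {v e : Space N} (he : e ∈ E) :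
    translate (stripPattern E v) e = stripPattern E (v + e) := by
  ext x
  rw [mem_translate]
  have h1 : x - e ∈ strip E ↔ x ∈ strip E := by
    rw [← add_mem_strip_iff he, sub_add_cancel]
  have h2 : x - e - v = x - (v + e) := by abel
  change x - e ∈ strip E ∧ x - e - v ∈ lattice N ↔ x ∈ strip E ∧ x - (v + e) ∈ lattice N
  rw [h1, h2]

namespace ProjectionPattern

variable (T : ProjectionPattern E u)

/-- The element of the hull given by `P̃_{e+u}`. -/
def reg (e : E) : T.Hull :=
  T.fromStrip ⟨stripPatternIn E (e + u), subset_closure ⟨e, e.2, rfl⟩⟩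

/-- The closed subset of the strip corresponding to a point of the hull. -/
def car (h : T.Hull) : Set (Space N) :=
  (Function.surjInv T.surjective_fromStrip h).1.carrier

instance : CompactSpace T.Hull :=
  ⟨by
    rw [← T.surjective_fromStrip.range_eq]
    exact isCompact_range T.continuous_fromStrip⟩

theorem vadd_reg (e e' : E) : e +ᵥ T.reg e' = T.reg (e + e') := by
  refine (T.fromStrip_equivariant e _ _ ?_).symm
  change stripPattern E _ = translate (stripPattern E _) _
  rw [translate_stripPattern e.2]
  congr 1
  push_cast
  abel

theorem denseRange_reg : DenseRange T.reg := by
  have h1 : DenseRange fun e : E => (⟨stripPatternIn E (e + u), subset_closure ⟨e, e.2, rfl⟩⟩ :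
      StripHull E u) := by
    rw [DenseRange, Subtype.dense_iff]
    intro A hA
    refine closure_mono ?_ hA
    rintro B ⟨e, he, hB⟩
    exact ⟨_, ⟨⟨e, he⟩, rfl⟩, ClosedIn.ext hB.symm⟩
  exact T.surjective_fromStrip.denseRange.comp h1 T.continuous_fromStrip

variable {T}

theorem car_fromStrip (hT : Function.Injective T.fromStrip) (A : StripHull E u) : T.car (T.fromStrip A) = A.1.carrier := by
  unfold car
  rw [hT (Function.surjInv_eq T.surjective_fromStrip (T.fromStrip A))]

end ProjectionPattern

end CanonicalProjection

/-! ### Limits of patterns in the hull -/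

namespace CanonicalProjection

variable {N : ℕ} {E F : Submodule ℝ (Space N)} {u : Space N}

namespace ProjectionPattern

variable {T : ProjectionPattern E u}

theorem car_reg (hT : Function.Injective T.fromStrip) (e : E) :
    T.car (T.reg e) = stripPattern E (e + u) := car_fromStrip hT _

theorem isClosed_car (h : T.Hull) : IsClosed (T.car h) := ClosedIn.isClosed _

theorem car_subset_strip (h : T.Hull) : T.car h ⊆ strip E := ClosedIn.subset _

theorem car_injective : Function.Injective T.car := by
  intro h h' hh
  rw [← Function.surjInv_eq T.surjective_fromStrip h, ← Function.surjInv_eq T.surjective_fromStrip h']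
  congr 1
  exact Subtype.ext (ClosedIn.ext hh)

theorem toPoint_carrier (h : T.Hull) :
    (T.toPoint h).1.carrier = (fun x => E.starProjection x) '' T.car h := by
  have := T.toPoint_fromStrip (Function.surjInv T.surjective_fromStrip h)
  rwa [Function.surjInv_eq T.surjective_fromStrip h] at this

/-- Open sets of the hull are detected on the strip hull. -/
theorem isOpen_of_preimage (hT : Function.Injective T.fromStrip) {U : Set T.Hull}
    (hU : IsOpen (T.fromStrip ⁻¹' U)) : IsOpen U := by
  have := (Continuous.homeoOfEquivCompactToT2
    (f := Equiv.ofBijective T.fromStrip ⟨hT, T.surjective_fromStrip⟩)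
    T.continuous_fromStrip).isOpen_preimage (s := U)
  exact this.1 hU

theorem isOpen_car_hit (hT : Function.Injective T.fromStrip) {O : Set (Space N)} (hO : IsOpen O) :
    IsOpen {h : T.Hull | ∃ x ∈ T.car h, x ∈ O} := by
  refine isOpen_of_preimage hT ?_
  have := (isOpen_hit (E := E) (strip E) hO).preimage
    (continuous_subtype_val : Continuous (Subtype.val : StripHull E u → _))
  convert this using 1
  ext A
  simp only [Set.mem_preimage, Set.mem_ofPred_eq, car_fromStrip hT]

theorem isOpen_car_miss (hT : Function.Injective T.fromStrip) {C : Set (Space N)}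
    (hC : IsCompact C) : IsOpen {h : T.Hull | ∀ x ∈ T.car h, x ∉ C} := by
  refine isOpen_of_preimage hT ?_
  have := (isOpen_miss (E := E) (strip E) hC).preimage
    (continuous_subtype_val : Continuous (Subtype.val : StripHull E u → _))
  convert this using 1
  ext A
  simp only [Set.mem_preimage, Set.mem_ofPred_eq, car_fromStrip hT]

/-- Convergence in the hull implies Kuratowski convergence of the underlying closed sets: hitting
balls gives one direction, missing closed balls the other. -/
theorem mem_car_iff_of_tendsto (hT : Function.Injective T.fromStrip) {ι : Type*}
    {𝒰 : Filter ι} [𝒰.NeBot] {f : ι → T.Hull} {h : T.Hull} (hf : Tendsto f 𝒰 (𝓝 h)) {x : Space N} :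
    x ∈ T.car h ↔ ∀ δ > 0, ∀ᶠ i in 𝒰, ∃ y ∈ T.car (f i), dist x y < δ := by
  constructor
  · intro hx δ hδ
    have := hf.eventually ((isOpen_car_hit hT (Metric.isOpen_ball (x := x) (ε := δ))).mem_nhds
      ⟨x, hx, Metric.mem_ball_self hδ⟩)
    filter_upwards [this] with i hi
    obtain ⟨y, hy, hxy⟩ := hi
    exact ⟨y, hy, by rwa [dist_comm]⟩
  · intro H
    by_contra hx
    obtain ⟨δ, hδ, hb⟩ := Metric.isOpen_iff.1 (isClosed_car h).isOpen_compl x hx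
    have := hf.eventually ((isOpen_car_miss hT (isCompact_closedBall x (δ / 2))).mem_nhds
      (fun y hy hyb => hb (Metric.closedBall_subset_ball (by linarith) hyb) hy))
    obtain ⟨i, hi, y, hy, hxy⟩ := (this.and (H (δ / 2) (by positivity))).exists
    refine hi y hy ?_
    rw [Metric.mem_closedBall, dist_comm]
    exact hxy.le

theorem mem_car_of_tendsto (hT : Function.Injective T.fromStrip) {ι : Type*}
    {𝒰 : Filter ι} [𝒰.NeBot] {f : ι → T.Hull} {h : T.Hull} (hf : Tendsto f 𝒰 (𝓝 h))
    {g : ι → Space N} {x : Space N} (hg : Tendsto g 𝒰 (𝓝 x)) (hgf : ∀ᶠ i in 𝒰, g i ∈ T.car (f i)) :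
    x ∈ T.car h := by
  rw [mem_car_iff_of_tendsto hT hf]
  intro δ hδ
  filter_upwards [hgf, Metric.tendsto_nhds.1 hg δ hδ] with i h1 h2
  exact ⟨g i, h1, by rwa [dist_comm]⟩

theorem exists_ultrafilter_reg (h : T.Hull) :
    ∃ 𝒰 : Ultrafilter E, Tendsto T.reg 𝒰 (𝓝 h) := by
  obtain ⟨𝒱, h1, h2⟩ := mem_closure_iff_ultrafilter.1 (T.denseRange_reg h)
  exact ⟨𝒱.ofComapInfPrincipal (m := T.reg) (s := Set.univ) (by simpa using h1), by
    rw [Tendsto, ← Ultrafilter.coe_map, Ultrafilter.ofComapInfPrincipal_eq_of_map]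
    exact h2⟩

/-- Points `y` of `h` can be approximated along any net converging to `h`. -/
theorem exists_tendsto_of_mem_car (hT : Function.Injective T.fromStrip) {ι : Type*}
    {𝒰 : Filter ι} [𝒰.NeBot] {f : ι → T.Hull} {h : T.Hull} (hf : Tendsto f 𝒰 (𝓝 h)) {x : Space N}
    (hx : x ∈ T.car h) :
    ∃ g : ι → Space N, Tendsto g 𝒰 (𝓝 x) ∧ ∀ᶠ i in 𝒰, g i ∈ T.car (f i) := by
  have H := (mem_car_iff_of_tendsto hT hf).1 hx
  have hne : ∀ᶠ i in 𝒰, (T.car (f i)).Nonempty := by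
    filter_upwards [H 1 one_pos] with i hi
    exact ⟨_, hi.choose_spec.1⟩
  have hch : ∀ i, ∃ y, (T.car (f i)).Nonempty →
      y ∈ T.car (f i) ∧ dist x y = Metric.infDist x (T.car (f i)) := by
    intro i
    by_cases hn : (T.car (f i)).Nonempty
    · obtain ⟨y, hy, hd⟩ := (isClosed_car (f i)).exists_infDist_eq_dist hn x
      exact ⟨y, fun _ => ⟨hy, hd.symm⟩⟩
    · exact ⟨0, fun h => absurd h hn⟩
  choose g hg using hch
  refine ⟨g, Metric.tendsto_nhds.2 fun δ hδ => ?_, hne.mono fun i hi => (hg i hi).1⟩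
  filter_upwards [hne, H δ hδ] with i h1 h2
  obtain ⟨y, hy, hxy⟩ := h2
  rw [dist_comm, (hg i h1).2]
  exact (Metric.infDist_le_dist_of_mem hy).trans_lt hxy

theorem car_vadd (hT : Function.Injective T.fromStrip) (e : E) (h : T.Hull) :
    T.car (e +ᵥ h) = translate (T.car h) e := by
  obtain ⟨𝒰, h𝒰⟩ := exists_ultrafilter_reg h
  have h2 : Tendsto (fun i => e +ᵥ T.reg i) 𝒰 (𝓝 (e +ᵥ h)) := h𝒰.const_vadd e
  ext x
  rw [mem_translate, mem_car_iff_of_tendsto hT h2, mem_car_iff_of_tendsto hT h𝒰]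
  refine forall_congr' fun δ => forall_congr' fun _ => ?_
  refine iff_of_eq (congrArg (fun p => ∀ᶠ i in (𝒰 : Filter E), p i) (funext fun i => propext ?_))
  rw [vadd_reg, car_reg hT, car_reg hT]
  have : ((e + i : E) : Space N) + u = (i + u) + e := by
    push_cast
    abel
  rw [this, ← translate_stripPattern e.2]
  constructor
  · rintro ⟨y, hy, hxy⟩
    refine ⟨y - e, mem_translate.1 hy, ?_⟩
    rwa [dist_sub_right]
  · rintro ⟨y, hy, hxy⟩
    refine ⟨y + e, ⟨y, hy, rfl⟩, ?_⟩
    rwa [← dist_sub_right _ _ (e : Space N), add_sub_cancel_right]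

/-- A regular pattern lies in one coset of the lattice, and the lattice is closed, so the property
survives in limits. -/
theorem sub_mem_lattice (hT : Function.Injective T.fromStrip) {h : T.Hull} {x y : Space N}
    (hx : x ∈ T.car h) (hy : y ∈ T.car h) : x - y ∈ lattice N := by
  obtain ⟨𝒰, h𝒰⟩ := exists_ultrafilter_reg h
  obtain ⟨f, hf, hf'⟩ := exists_tendsto_of_mem_car hT h𝒰 hx
  obtain ⟨g, hg, hg'⟩ := exists_tendsto_of_mem_car hT h𝒰 hy
  refine isClosed_lattice.mem_of_tendsto (hf.sub hg) ?_
  filter_upwards [hf', hg'] with i h1 h2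
  rw [car_reg hT] at h1 h2
  have := (lattice N).sub_mem h1.2 h2.2
  rwa [sub_sub_sub_cancel_right] at this

/-- A bounded family of lattice vectors is constant along an ultrafilter. -/
theorem _root_.CanonicalProjection.exists_eventually_eq_of_isBounded {ι : Type*} (𝒰 : Ultrafilter ι)
    {s : Set (Space N)} (hs : Bornology.IsBounded s) {z : ι → Space N}
    (hz : ∀ᶠ i in 𝒰, z i ∈ s ∧ z i ∈ lattice N) : ∃ w ∈ lattice N, ∀ᶠ i in 𝒰, z i = w := by
  have hfin := finite_lattice_of_isBounded hs
  have h1 : ∀ᶠ i in 𝒰, ∃ w ∈ s ∩ lattice N, z i = w := hz.mono fun i hi => ⟨_, hi, rfl⟩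
  obtain ⟨w, hw, h⟩ := (Ultrafilter.eventually_exists_mem_iff hfin).1 h1
  exact ⟨w, hw.2, h⟩

theorem exists_eventually_eq_of_tendsto {ι : Type*} (𝒰 : Ultrafilter ι) {z : ι → Space N}
    {x : Space N} (hz : Tendsto z 𝒰 (𝓝 x)) (hL : ∀ᶠ i in 𝒰, z i ∈ lattice N) :
    x ∈ lattice N ∧ ∀ᶠ i in 𝒰, z i = x := by
  obtain ⟨w, hw, h⟩ := exists_eventually_eq_of_isBounded 𝒰
    (Metric.isBounded_ball (x := x) (r := 1))
    ((hz.eventually (Metric.ball_mem_nhds x one_pos)).and hL)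
  have : w = x := tendsto_nhds_unique_of_eventuallyEq tendsto_const_nhds hz
      (h.mono fun i hi => hi.symm)
  subst this
  exact ⟨hw, h⟩

end ProjectionPattern

end CanonicalProjection

/-! ### Evaluation of continuous cochains on regular chains -/

namespace CanonicalProjection

open ContinuousGroupoidCohomology

variable {N : ℕ} {E F : Submodule ℝ (Space N)} {u : Space N}

/-- The orthogonal projection with values in `E`. -/
def projE (E : Submodule ℝ (Space N)) : Space N →ₗ[ℝ] E :=
  E.starProjection.toLinearMap.codRestrict E fun _ => Submodule.starProjection_apply_mem _ _

@[simp] theorem coe_projE (x : Space N) : (projE E x : Space N) = E.starProjection x := rfl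

theorem projE_coe (e : E) : projE E (e : Space N) = e :=
  Subtype.ext (Submodule.starProjection_eq_self_iff.2 e.2)

theorem norm_sub_starProjection_le_skew (hEF : IsCompl E F) (x : Space N) :
    ‖x - E.starProjection x‖ ≤ ‖skewProjection hEF x‖ := by
  have h : x - E.starProjection x = Eᗮ.starProjection (skewProjection hEF x) := by
    have h1 := Submodule.starProjection_eq_self_iff.2 (sub_skewProjection_mem hEF x)
    rw [map_sub] at h1
    rw [Submodule.starProjection_orthogonal_val, sub_eq_sub_iff_sub_eq_sub, h1]
  rw [h]
  exact Submodule.norm_starProjection_apply_le _ _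

namespace ProjectionPattern

variable {T : ProjectionPattern E u}

theorem mem_toPoint_iff {h : T.Hull} {w : E} :
    (w : Space N) ∈ (T.toPoint h).1.carrier ↔ ∃ x ∈ T.car h, projE E x = w := by
  rw [toPoint_carrier]
  exact exists_congr fun x => and_congr_right fun _ => by rw [← Subtype.coe_inj]; rfl

/-- The chain of the pattern groupoid through the points `w₀, …, w_q` of `π_*(h)`. -/
def chainOf (h : T.Hull) {q : ℕ} (w : Fin (q + 1) → E)
    (hw : ∀ i, ((w i : E) : Space N) ∈ (T.toPoint h).1.carrier) : Chain (PatternGroupoid T) q where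
  toFunctor :=
    { obj := fun i => ⟨-w i +ᵥ h, by
        rw [T.toPoint_equivariant, mem_translate]
        simpa using hw i⟩
      map := fun {i j} _ => ⟨w j - w i, by
        rw [T.toPoint_equivariant, mem_translate]
        simpa using hw j, by
        rw [vadd_vadd]
        rw [show -(w j - w i) + -w i = -w j by abel]⟩
      map_id := fun i => PatternArrow.ext (sub_self _)
      map_comp := fun {i j k} _ _ => PatternArrow.ext (by
        change w k - w i = (w j - w i) + (w k - w j)
        abel) }

theorem tendsto_chain_iff {ι : Type*} {l : Filter ι} {q : ℕ} {f : ι → Chain (PatternGroupoid T) q}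
    {x : Chain (PatternGroupoid T) q} :
    Tendsto f l (𝓝 x) ↔ ∀ p : {p : Fin (q + 1) × Fin (q + 1) // p.1 ≤ p.2},
      Tendsto (fun i => ((f i).arrow p).left.point) l (𝓝 (x.arrow p).left.point) ∧
      Tendsto (fun i => PatternArrow.vec ((f i).arrow p).hom) l
        (𝓝 (PatternArrow.vec (x.arrow p).hom)) := by
  have h1 : Topology.IsInducing (Chain.arrow : Chain (PatternGroupoid T) q → _) := ⟨rfl⟩
  have h2 : Topology.IsInducing (fun a : Arrow (PatternGroupoid T) =>
    ((a.left.point, PatternArrow.vec a.hom) : T.Hull × E)) := ⟨rfl⟩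
  rw [h1.tendsto_nhds_iff, tendsto_pi_nhds]
  refine forall_congr' fun p => ?_
  rw [h2.tendsto_nhds_iff, nhds_prod_eq, tendsto_prod_iff']
  rfl

open Classical in
/-- The value of a cochain on the chain through the points `w₀, …, w_q` of `π_*(h)`, and zero if
these are no points of `π_*(h)`. -/
def evalCochain (h : T.Hull) {q : ℕ} (b : Cochain (PatternGroupoid T) q) (w : Fin (q + 1) → E) : ℤ :=
  if hw : ∀ i, ((w i : E) : Space N) ∈ (T.toPoint h).1.carrier then b (chainOf h w hw) else 0

theorem evalCochain_of_mem {h : T.Hull} {q : ℕ} {b : Cochain (PatternGroupoid T) q}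
    {w : Fin (q + 1) → E} (hw : ∀ i, ((w i : E) : Space N) ∈ (T.toPoint h).1.carrier) :
    evalCochain h b w = b (chainOf h w hw) := dif_pos hw

theorem evalCochain_coboundary {h : T.Hull} {q : ℕ} (b : Cochain (PatternGroupoid T) q)
    {w : Fin (q + 2) → E} (hw : ∀ i, ((w i : E) : Space N) ∈ (T.toPoint h).1.carrier) :
    evalCochain h (coboundary (PatternGroupoid T) q b) w =
      ∑ k : Fin (q + 2), (-1 : ℤ) ^ (k : ℕ) * evalCochain h b (fun i => w (k.succAbove i)) := by
  rw [evalCochain_of_mem hw]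
  change (∑ k : Fin (q + 2), (-1 : ℤ) ^ (k : ℕ) •
    b.comp ⟨Chain.face k, Chain.continuous_face k⟩ : C(_, ℤ)) _ = _
  rw [ContinuousMap.sum_apply]
  refine Finset.sum_congr rfl fun k _ => ?_
  rw [evalCochain_of_mem fun i => hw _]
  rfl

theorem projE_mem_reg (hT : Function.Injective T.fromStrip) {x : Space N}
    (hx : x ∈ stripPattern E u) : ((projE E x : E) : Space N) ∈ (T.toPoint (T.reg 0)).1.carrier := by
  rw [mem_toPoint_iff]
  refine ⟨x, ?_, rfl⟩
  rw [car_reg hT]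
  simpa using hx

/-- Convergence of regular chains. -/
theorem eventually_evalCochain_eq (hT : Function.Injective T.fromStrip) {ι : Type*}
    (𝒰 : Ultrafilter ι) {q : ℕ} (b : Cochain (PatternGroupoid T) q) (a : Fin (q + 1) → Space N)
    (ha : ∀ i, a i ∈ lattice N) (f : ι → Space N) (hf : ∀ n, f n - u ∈ lattice N)
    (hfa : ∀ n i, f n + a i ∈ strip E) {h : T.Hull}
    (hh : Tendsto (fun n => T.reg (-projE E (f n))) 𝒰 (𝓝 h)) :
    ∀ᶠ n in 𝒰, evalCochain (T.reg 0) b (fun i => projE E (f n + a i)) =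
      evalCochain h b (fun i => projE E (a i)) := by
  have hmem : ∀ n i, f n + a i ∈ stripPattern E u := fun n i =>
    ⟨hfa n i, by
      rw [add_sub_right_comm]
      exact (lattice N).add_mem (hf n) (ha i)⟩
  have hw : ∀ i, ((projE E (a i) : E) : Space N) ∈ (T.toPoint h).1.carrier := by
    intro i
    have hg : ∀ n, f n + a i - E.starProjection (f n) ∈ T.car (T.reg (-projE E (f n))) := by
      intro n
      rw [car_reg hT]
      refine ⟨?_, ?_⟩
      · rw [sub_eq_add_neg]
        exact (add_mem_strip_iff (E.neg_mem (Submodule.starProjection_apply_mem _ _))).2 (hfa n i)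
      · have : f n + a i - E.starProjection (f n) - (((-projE E (f n) : E) : Space N) + u) =
            (f n - u) + a i := by
          push_cast
          rw [coe_projE]
          abel
        rw [this]
        exact (lattice N).add_mem (hf n) (ha i)
    have hpi : ∀ n, E.starProjection (f n + a i - E.starProjection (f n)) =
        E.starProjection (a i) := by
      intro n
      rw [map_sub, map_add,
        Submodule.starProjection_eq_self_iff.2 (Submodule.starProjection_apply_mem E (f n))]
      abel
    obtain ⟨y, hy, hlim⟩ := Ultrafilter.exists_limit_of_mem 𝒰
      (isCompact_strip_ball E ‖E.starProjection (a i)‖)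
      (Eventually.of_forall fun n => (⟨car_subset_strip _ (hg n), (by rw [hpi n])⟩ :
        f n + a i - E.starProjection (f n) ∈
          {x | x ∈ strip E ∧ ‖E.starProjection x‖ ≤ ‖E.starProjection (a i)‖}))
    rw [mem_toPoint_iff]
    refine ⟨y, mem_car_of_tendsto hT hh hlim (Eventually.of_forall hg), Subtype.ext ?_⟩
    have := (E.starProjection.continuous.tendsto y).comp hlim
    refine tendsto_nhds_unique this ?_
    refine (tendsto_const_nhds (x := E.starProjection (a i))).congr fun n => (hpi n).symm
  -- Translating by `projE E (f n)` turns the chain of `T.reg 0` through the points `f n + a i` into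
  -- the chain of `T.reg (-projE E (f n))` through the fixed points `a i`, so only the pattern
  -- varies.
  have hlim : Tendsto (fun n => chainOf (T.reg 0) (fun i => projE E (f n + a i))
      (fun i => projE_mem_reg hT (hmem n i))) 𝒰 (𝓝 (chainOf h _ hw)) := by
    rw [tendsto_chain_iff]
    rintro ⟨⟨i, j⟩, hij⟩
    constructor
    · have := hh.const_vadd (-projE E (a i))
      refine this.congr fun n => ?_
      change -projE E (a i) +ᵥ T.reg _ = -projE E (f n + a i) +ᵥ T.reg 0
      rw [vadd_reg, vadd_reg, map_add]
      congr 1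
      abel
    · refine (tendsto_const_nhds (x := projE E (a j) - projE E (a i))).congr fun n => ?_
      change _ = projE E (f n + a j) - projE E (f n + a i)
      rw [map_add, map_add]
      abel
  have hb := (b.continuous.tendsto _).comp hlim
  have := hb.eventually (isOpen_discrete {b (chainOf h _ hw)} |>.mem_nhds rfl)
  filter_upwards [this] with n hn
  rw [evalCochain_of_mem hw, evalCochain_of_mem fun i => projE_mem_reg hT (hmem n i)]
  exact hn

/-- Two families of regular patterns which asymptotically agree have the same limit. -/
theorem car_subset_of_agree (hT : Function.Injective T.fromStrip) (hEF : IsCompl E F)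
    (𝒰 : Ultrafilter ℕ) {a : Space N} {f f' : ℕ → Space N}
    (hf : ∀ n, f n - u ∈ lattice N) (hf' : ∀ n, f' n - u ∈ lattice N)
    (hfa : ∀ n, f n + a ∈ strip E) 
    (hdist : Tendsto (fun n => ‖skewProjection hEF (f n) - skewProjection hEF (f' n)‖) 𝒰 (𝓝 0))
    (hagree : ∀ z ∈ lattice N, ∀ᶠ n in 𝒰, f n + z ∈ strip E → f' n + z ∈ strip E) {h h' : T.Hull}
    (hh : Tendsto (fun n => T.reg (-projE E (f n))) 𝒰 (𝓝 h))
    (hh' : Tendsto (fun n => T.reg (-projE E (f' n))) 𝒰 (𝓝 h')) : T.car h ⊆ T.car h' := by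
  intro y hy
  obtain ⟨g, hg, hgm⟩ := exists_tendsto_of_mem_car hT hh hy
  obtain ⟨C, hC⟩ := exists_norm_sub_starProjection_le E
  have hgm' : ∀ᶠ n in 𝒰, g n + E.starProjection (f n) ∈ strip E ∧
      g n + E.starProjection (f n) - u ∈ lattice N := by
    filter_upwards [hgm] with n hn
    rw [car_reg hT] at hn
    refine ⟨(add_mem_strip_iff (Submodule.starProjection_apply_mem _ _)).2 hn.1, ?_⟩
    have := hn.2
    push_cast [coe_projE] at this
    convert this using 1
    abel
  -- The point of the pattern close to `y` differs from the base point `f n` by a lattice vector of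
  -- bounded length, hence by an eventually constant `w`. The same `w` is then applied to `f' n`.
  have hbd : ∀ᶠ n in 𝒰, g n + E.starProjection (f n) - f n ∈
      Metric.closedBall (0 : Space N) (‖y‖ + 1 + (C + ‖a - E.starProjection a‖)) ∧
      g n + E.starProjection (f n) - f n ∈ lattice N := by
    filter_upwards [hgm', Metric.tendsto_nhds.1 hg 1 one_pos] with n h1 h2
    constructor
    · rw [mem_closedBall_zero_iff]
      have h3 : ‖f n - E.starProjection (f n)‖ ≤ C + ‖a - E.starProjection a‖ := by
        have h4 := hC _ (hfa n)
        have h5 : f n - E.starProjection (f n) =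
            (f n + a - E.starProjection (f n + a)) - (a - E.starProjection a) := by
          rw [map_add]
          abel
        rw [h5]
        exact (norm_sub_le _ _).trans (add_le_add_left h4 _)
      have h6 : ‖g n‖ ≤ ‖y‖ + 1 := by
        rw [dist_eq_norm] at h2
        have := norm_sub_norm_le (g n) y
        linarith
      have h7 : g n + E.starProjection (f n) - f n = g n - (f n - E.starProjection (f n)) := by abel
      rw [h7]
      exact (norm_sub_le _ _).trans (add_le_add h6 h3)
    · have := (lattice N).sub_mem h1.2 (hf n)
      rwa [sub_sub_sub_cancel_right] at this
  obtain ⟨w, hw, hwe⟩ := exists_eventually_eq_of_isBounded 𝒰 Metric.isBounded_closedBall hbd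
  have hlim : Tendsto (fun n => f' n - E.starProjection (f' n) + w) 𝒰 (𝓝 y) := by
    have h1 : Tendsto (fun n => (f' n - f n) - E.starProjection (f' n - f n)) 𝒰 (𝓝 0) := by
      refine squeeze_zero_norm (fun n => ?_) hdist
      refine (norm_sub_starProjection_le_skew hEF _).trans (le_of_eq ?_)
      rw [map_sub, norm_sub_rev]
    have h2 := hg.add h1
    rw [add_zero] at h2
    refine h2.congr' ?_
    filter_upwards [hwe] with n hn
    rw [← hn, map_sub]
    abel
  refine mem_car_of_tendsto hT hh' hlim ?_
  filter_upwards [hwe, hgm', hagree w hw] with n h1 h2 h3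
  rw [car_reg hT]
  have h4 : f n + w ∈ strip E := by
    rw [← h1]
    convert h2.1 using 1
    abel
  refine ⟨?_, ?_⟩
  · have := (add_mem_strip_iff (E.neg_mem (Submodule.starProjection_apply_mem E (f' n)))).2 (h3 h4)
    convert this using 1
    abel
  · have := (lattice N).add_mem (hf' n) hw
    push_cast [coe_projE]
    convert this using 1
    abel

theorem exists_tendsto_ultrafilter {ι : Type*} (𝒰 : Ultrafilter ι) (f : ι → T.Hull) :
    ∃ h, Tendsto f 𝒰 (𝓝 h) := by
  obtain ⟨h, -, hh⟩ := Ultrafilter.exists_limit_of_mem 𝒰 (isCompact_univ (X := T.Hull))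
    (f := f) (Eventually.of_forall fun _ => trivial)
  exact ⟨h, hh⟩

/-- The values of a continuous cochain on regular chains are determined by finitely many
membership conditions. -/
theorem exists_local_determination (hT : Function.Injective T.fromStrip) (hEF : IsCompl E F) {q : ℕ}
    (b : Cochain (PatternGroupoid T) q) (a : Fin (q + 1) → Space N) (ha : ∀ i, a i ∈ lattice N) :
    ∃ ε > 0, ∃ Z : Finset (Space N), ∀ x x' : Space N, x - u ∈ lattice N → x' - u ∈ lattice N →
      (∀ i, x + a i ∈ strip E) → (∀ i, x' + a i ∈ strip E) →
      ‖skewProjection hEF x - skewProjection hEF x'‖ < ε →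
      (∀ z ∈ Z, (x + z ∈ strip E ↔ x' + z ∈ strip E)) →
      evalCochain (T.reg 0) b (fun i => projE E (x + a i)) =
        evalCochain (T.reg 0) b (fun i => projE E (x' + a i)) := by
  by_contra! hcon
  -- Compactness: counterexamples for `ε = 1 / (n + 1)` and all lattice vectors of norm at most `n`
  -- give two nets with the same limit in the hull. By continuity the cochain takes eventually the
  -- same value along both.
  choose f f' hf hf' hfa hfa' hd hag hne using fun n : ℕ => hcon (1 / ((n : ℝ) + 1))
    (by positivity) (finite_lattice_of_isBounded
      (Metric.isBounded_closedBall (x := (0 : Space N)) (r := n))).toFinset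
  let 𝒰 : Ultrafilter ℕ := hyperfilter ℕ
  have h𝒰 : (𝒰 : Filter ℕ) ≤ atTop := Nat.hyperfilter_le_atTop
  obtain ⟨h, hh⟩ := exists_tendsto_ultrafilter (T := T) 𝒰 (fun n => T.reg (-projE E (f n)))
  obtain ⟨h', hh'⟩ := exists_tendsto_ultrafilter (T := T) 𝒰 (fun n => T.reg (-projE E (f' n)))
  have hlim : Tendsto (fun n => ‖skewProjection hEF (f n) - skewProjection hEF (f' n)‖) 𝒰 (𝓝 0) :=
    squeeze_zero (fun n => norm_nonneg _) (fun n => (hd n).le)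
      (tendsto_one_div_add_atTop_nhds_zero_nat.mono_left h𝒰)
  have hiff : ∀ z ∈ lattice N, ∀ᶠ n in 𝒰, (f n + z ∈ strip E ↔ f' n + z ∈ strip E) := by
    intro z hz
    refine h𝒰 ?_
    filter_upwards [eventually_ge_atTop ⌈‖z‖⌉₊] with n hn
    refine hag n z ((Set.Finite.mem_toFinset _).2 ⟨?_, hz⟩)
    rw [mem_closedBall_zero_iff]
    exact (Nat.le_ceil _).trans (by exact_mod_cast hn)
  have heq : h = h' := car_injective (Set.Subset.antisymm
    (car_subset_of_agree hT hEF 𝒰 hf hf' (fun n => hfa n 0) hlim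
      (fun z hz => (hiff z hz).mono fun n hn => hn.1) hh hh')
    (car_subset_of_agree hT hEF 𝒰 hf' hf (fun n => hfa' n 0)
      (by simpa only [norm_sub_rev] using hlim)
      (fun z hz => (hiff z hz).mono fun n hn => hn.2) hh' hh))
  subst heq
  obtain ⟨n, h1, h2⟩ := ((eventually_evalCochain_eq hT 𝒰 b a ha f hf hfa hh).and
    (eventually_evalCochain_eq hT 𝒰 b a ha f' hf' hfa' hh')).exists
  exact hne n (h1.trans h2.symm)

/-- A continuous cochain is bounded on regular chains of a given shape. -/
theorem exists_bound_evalCochain (hT : Function.Injective T.fromStrip) {q : ℕ}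
    (b : Cochain (PatternGroupoid T) q) (a : Fin (q + 1) → Space N) (ha : ∀ i, a i ∈ lattice N) :
    ∃ M : ℕ, ∀ x : Space N, x - u ∈ lattice N → (∀ i, x + a i ∈ strip E) →
      (evalCochain (T.reg 0) b (fun i => projE E (x + a i))).natAbs ≤ M := by
  by_contra! hcon
  choose f hf hfa hM using hcon
  let 𝒰 : Ultrafilter ℕ := hyperfilter ℕ
  have h𝒰 : (𝒰 : Filter ℕ) ≤ atTop := Nat.hyperfilter_le_atTop
  obtain ⟨h, hh⟩ := exists_tendsto_ultrafilter (T := T) 𝒰 (fun n => T.reg (-projE E (f n)))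
  have h1 := eventually_evalCochain_eq hT 𝒰 b a ha f hf hfa hh
  have h2 : ∀ᶠ n in 𝒰, (evalCochain h b fun i => projE E (a i)).natAbs ≤ n :=
    h𝒰 (eventually_ge_atTop _)
  obtain ⟨n, h3, h4⟩ := (h1.and h2).exists
  have := hM n
  rw [h3] at this
  omega

end ProjectionPattern

end CanonicalProjection

namespace CanonicalProjection

open ContinuousGroupoidCohomology

variable {N : ℕ} {E F : Submodule ℝ (Space N)} {u : Space N}

/-! ### Cup products of differences -/

/-- The cup product of the coboundaries of the functions `H i`, evaluated on a tuple of points. -/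
def cupDiff {X : Type*} {d : ℕ} (H : Fin d → X → ℤ) (p : Fin (d + 1) → X) : ℤ :=
  ∏ i, (H i (p i.succ) - H i (p i.castSucc))

theorem cupDiff_succ {X : Type*} {d : ℕ} (H : Fin (d + 1) → X → ℤ) (p : Fin (d + 2) → X) :
    cupDiff H p = (H 0 (p 1) - H 0 (p 0)) * cupDiff (fun i => H i.succ) (fun i => p i.succ) := by
  unfold cupDiff
  rw [Fin.prod_univ_succ]
  rfl

/-- A cup product of coboundaries is a cocycle. Splitting off the first factor, all faces but the
first two keep the factor `H 0 (p 1) - H 0 (p 0)`, and those two differ by the same factor, so the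
alternating sum is a multiple of the one for the remaining functions. -/
theorem sum_cupDiff_face {X : Type*} : ∀ {d : ℕ} (H : Fin d → X → ℤ) (p : Fin (d + 2) → X),
    ∑ k : Fin (d + 2), (-1 : ℤ) ^ (k : ℕ) * cupDiff H (fun i => p (k.succAbove i)) = 0
  | 0, H, p => by simp [cupDiff]
  | d + 1, H, p => by
    have ih := sum_cupDiff_face (fun i => H i.succ) (fun i => p i.succ)
    rw [Fin.sum_univ_succ]
    rw [Fin.sum_univ_succ] at ih ⊢
    have h1 : ∀ k : Fin (d + 1),
        cupDiff H (fun i => p (k.succ.succ.succAbove i)) = (H 0 (p 1) - H 0 (p 0)) *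
          cupDiff (fun i => H i.succ) (fun i => p (k.succ.succAbove i).succ) := by
      intro k
      rw [cupDiff_succ]
      simp only [Fin.succ_succAbove_succ]
      rfl
    have h2 : cupDiff H (fun i => p ((0 : Fin (d + 2)).succ.succAbove i)) =
        (H 0 (p 2) - H 0 (p 0)) * cupDiff (fun i => H i.succ) (fun i => p i.succ.succ) := by
      rw [cupDiff_succ]
      simp only [Fin.succ_succAbove_succ]
      rfl
    have h3 : cupDiff H (fun i => p ((0 : Fin (d + 3)).succAbove i)) =
        (H 0 (p 2) - H 0 (p 1)) * cupDiff (fun i => H i.succ) (fun i => p i.succ.succ) := by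
      rw [cupDiff_succ]
      rfl
    simp only [h1, h2, h3]
    have h4 : ∑ k : Fin (d + 1), (-1 : ℤ) ^ ((k.succ.succ : Fin (d + 3)) : ℕ) *
        ((H 0 (p 1) - H 0 (p 0)) *
          cupDiff (fun i => H i.succ) (fun i => p (k.succ.succAbove i).succ)) =
        -((H 0 (p 1) - H 0 (p 0)) * ∑ k : Fin (d + 1), (-1 : ℤ) ^ ((k.succ : Fin (d + 2)) : ℕ) *
          cupDiff (fun i => H i.succ) (fun i => p (k.succ.succAbove i).succ)) := by
      rw [Finset.mul_sum, ← Finset.sum_neg_distrib]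
      refine Finset.sum_congr rfl fun k _ => ?_
      simp only [Fin.val_succ, pow_succ]
      ring
    rw [h4]
    simp only [Fin.val_zero, pow_zero, one_mul, Fin.zero_succAbove, Fin.val_succ, zero_add,
      pow_one] at ih ⊢
    linear_combination (-(H 0 (p 1) - H 0 (p 0))) * ih

/-! ### Walls -/

/-- A functional `ℓ` whose kernel is `E + e^J` for some `J`. -/
structure IsWall (E : Submodule ℝ (Space N)) (ℓ : Module.Dual ℝ (Space N)) (J : Finset (Fin N)) :
    Prop where
  vanish : ∀ e ∈ E, ℓ e = 0
  single : ∀ j ∈ J, ℓ (EuclideanSpace.single j 1) = 0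
  ker : ∀ x, ℓ x = 0 → ∃ y ∈ coordSpace J, x - y ∈ E
  ne_zero : ℓ ≠ 0

theorem dual_eq_sum (ℓ : Module.Dual ℝ (Space N)) (x : Space N) :
    ℓ x = ∑ j, x j * ℓ (EuclideanSpace.single j 1) := by
  have hx : x = ∑ j, x j • EuclideanSpace.single j (1 : ℝ) := by
    ext i
    simp [Finset.sum_apply, Pi.single_apply]
  conv_lhs => rw [hx]
  simp [map_sum]

theorem coordSpace_apply_eq_zero {J : Finset (Fin N)} {x : Space N} (hx : x ∈ coordSpace J)
    {j : Fin N} (hj : j ∉ J) : x j = 0 := by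
  unfold coordSpace at hx
  induction hx using Submodule.span_induction with
  | mem x hx =>
    obtain ⟨i, hi, rfl⟩ := hx
    have : j ≠ i := fun h => hj (h ▸ hi)
    simp [this]
  | zero => rfl
  | add x y _ _ h1 h2 => simp [h1, h2]
  | smul a x _ h => simp [h]

/-- The vertex of the cube at which `ℓ` is maximal. -/
def topVertex (ℓ : Module.Dual ℝ (Space N)) : Space N :=
  WithLp.toLp 2 fun j => if 0 < ℓ (EuclideanSpace.single j 1) then 1 else 0

theorem topVertex_mem (ℓ : Module.Dual ℝ (Space N)) : topVertex ℓ ∈ lattice N := by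
  intro j
  simp only [topVertex]
  split_ifs
  · exact ⟨1, by simp⟩
  · exact ⟨0, by simp⟩

theorem apply_le_topVertex {ℓ : Module.Dual ℝ (Space N)} {c : Space N} (hc : c ∈ unitCube N) :
    ℓ c ≤ ℓ (topVertex ℓ) := by
  rw [dual_eq_sum ℓ c, dual_eq_sum ℓ (topVertex ℓ)]
  refine Finset.sum_le_sum fun j _ => ?_
  simp only [topVertex]
  obtain ⟨h1, h2⟩ := hc j
  split_ifs with h
  · nlinarith
  · nlinarith

/-- Near the hyperplane `ℓ = ℓ v`, its lower side is covered by translates of the strip which lie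
below the hyperplane. -/
theorem IsWall.exists_cover (hEF : IsCompl E F) {ℓ : Module.Dual ℝ (Space N)} {J : Finset (Fin N)}
    (h : IsWall E ℓ J) {v : Space N} (hv : v ∈ lattice N) (R : ℝ) :
    ∃ δ > 0, ∃ Z : Set (Space N), Z.Finite ∧ (∀ z ∈ Z, z ∈ lattice N ∧
      ∀ x, x - z ∈ strip E → ℓ x ≤ ℓ v) ∧
      ∀ x, ‖skewProjection hEF x‖ ≤ R → ℓ v - δ < ℓ x → ℓ x ≤ ℓ v → ∃ z ∈ Z, x - z ∈ strip E := by
  classical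
  obtain ⟨j₀, hj₀⟩ : ∃ j, ℓ (EuclideanSpace.single j 1) ≠ 0 := by
    by_contra! hcon
    refine h.ne_zero (LinearMap.ext fun x => ?_)
    rw [dual_eq_sum]
    simp [hcon]
  set η := ℓ (EuclideanSpace.single j₀ 1) with hη
  have hj₀J : j₀ ∉ J := fun hj => hj₀ (h.single _ hj)
  let f : coordSpace J →ₗ[ℝ] Space N := (skewProjection hEF).domRestrict (coordSpace J)
  obtain ⟨g, hg⟩ := f.rangeRestrict.exists_rightInverse_of_surjective
    (LinearMap.range_eq_top.2 f.surjective_rangeRestrict)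
  -- A bounded section of `π'` on `e^J` lifts points with bounded image to vectors of bounded
  -- length, which keeps the set of translates finite.
  let G : LinearMap.range f →L[ℝ] coordSpace J := LinearMap.toContinuousLinearMap g
  obtain ⟨C, hC⟩ := (isCompact_unitCube (N := N)).isBounded.exists_norm_le
  set B : ℝ := ‖G‖ * (R + ‖skewProjection hEF v‖ +
    ‖skewProjection hEF (EuclideanSpace.single j₀ 1)‖) with hB
  -- The face of the cube on which `ℓ` is maximal contains a unit cube in the directions `J` at
  -- `topVertex ℓ`. Its translates by integer vectors of `e^J` cover the wall modulo `E`, and moving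
  -- inwards along `e_{j₀}` stays inside the cube up to depth `|η|`.
  let z : Space N → Space N := fun r => v - topVertex ℓ + latticeFloor r
  have hzL : ∀ r, z r ∈ lattice N := fun r =>
    (lattice N).add_mem ((lattice N).sub_mem hv (topVertex_mem ℓ)) (latticeFloor_mem r)
  have hfl : ∀ r ∈ coordSpace J, ℓ (latticeFloor r) = 0 := by
    intro r hr
    rw [dual_eq_sum]
    refine Finset.sum_eq_zero fun j _ => ?_
    by_cases hj : j ∈ J
    · rw [h.single j hj, mul_zero]
    · have : latticeFloor r j = 0 := by
        change ((⌊r j⌋ : ℤ) : ℝ) = 0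
        rw [coordSpace_apply_eq_zero hr hj]
        simp
      rw [this, zero_mul]
  refine ⟨|η|, abs_pos.2 hj₀, z '' {r | r ∈ coordSpace J ∧ ‖r‖ ≤ B}, ?_, ?_, ?_⟩
  · have hbd : Bornology.IsBounded (z '' {r | r ∈ coordSpace J ∧ ‖r‖ ≤ B}) := by
      rw [isBounded_iff_forall_norm_le]
      refine ⟨‖v - topVertex ℓ‖ + (B + C), ?_⟩
      rintro _ ⟨r, ⟨-, hr⟩, rfl⟩
      refine (norm_add_le _ _).trans (add_le_add_right ?_ _)
      have h1 := hC _ (sub_latticeFloor_mem r)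
      have h2 := norm_sub_norm_le (latticeFloor r) r
      rw [norm_sub_rev] at h2
      linarith
    refine (finite_lattice_of_isBounded hbd).subset ?_
    rintro _ ⟨r, hr, rfl⟩
    exact ⟨⟨r, hr, rfl⟩, hzL r⟩
  · rintro _ ⟨r, ⟨hr, -⟩, rfl⟩
    refine ⟨hzL r, fun x hx => ?_⟩
    obtain ⟨c, hc, hxc⟩ := mem_strip_iff.1 hx
    have h1 := h.vanish _ hxc
    have h2 := apply_le_topVertex (ℓ := ℓ) hc
    simp only [z, map_sub, map_add, hfl r hr] at h1
    linarith
  · intro x hxR hx1 hx2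
    set τ := (ℓ v - ℓ x) / η with hτ
    have hτη : τ * η = ℓ v - ℓ x := div_mul_cancel₀ _ hj₀
    have hτ1 : |τ| ≤ 1 := by
      rw [hτ, abs_div, div_le_one (abs_pos.2 hj₀), abs_of_nonneg (by linarith)]
      linarith
    set y := x - v + τ • EuclideanSpace.single j₀ (1 : ℝ) with hy
    have hℓy : ℓ y = 0 := by
      rw [hy, map_add, map_sub, map_smul, smul_eq_mul, hτη]
      ring
    obtain ⟨y', hy', hyy'⟩ := h.ker y hℓy
    have hyr : skewProjection hEF y ∈ LinearMap.range f :=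
      ⟨⟨y', hy'⟩, by
        change skewProjection hEF y' = skewProjection hEF y
        have := (skewProjection_eq_zero_iff hEF).2 hyy'
        rw [map_sub, sub_eq_zero] at this
        exact this.symm⟩
    set r : coordSpace J := G ⟨_, hyr⟩
    have hfr : skewProjection hEF (r : Space N) = skewProjection hEF y := by
      have := LinearMap.congr_fun hg ⟨_, hyr⟩
      exact congrArg (Subtype.val : LinearMap.range f → Space N) this
    have hrB : ‖(r : Space N)‖ ≤ B := by
      refine (G.le_opNorm ⟨_, hyr⟩).trans (mul_le_mul_of_nonneg_left ?_ (norm_nonneg G))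
      change ‖skewProjection hEF y‖ ≤ _
      rw [hy, map_add, map_sub, map_smul]
      refine (norm_add_le _ _).trans (add_le_add ((norm_sub_le _ _).trans
        (add_le_add_left hxR _)) ?_)
      rw [norm_smul]
      exact mul_le_of_le_one_left (norm_nonneg _) hτ1
    refine ⟨z r, ⟨r, ⟨r.2, hrB⟩, rfl⟩, mem_strip_iff.2
      ⟨topVertex ℓ - τ • EuclideanSpace.single j₀ (1 : ℝ) + (r - latticeFloor (r : Space N)),
        ?_, ?_⟩⟩
    · intro j
      have hfr := sub_latticeFloor_mem (r : Space N) j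
      by_cases hj : j ∈ J
      · have hjj : j ≠ j₀ := fun h => hj₀J (h ▸ hj)
        have h0 : topVertex ℓ j = 0 := by simp [topVertex, h.single j hj]
        simpa [h0, hjj] using hfr
      · have h0 : ((r : Space N) - latticeFloor (r : Space N)) j = 0 := by
          change (r : Space N) j - ((⌊(r : Space N) j⌋ : ℤ) : ℝ) = 0
          rw [coordSpace_apply_eq_zero r.2 hj]
          simp
        rw [PiLp.add_apply, h0, add_zero, PiLp.sub_apply, PiLp.smul_apply]
        obtain ⟨h3, h4⟩ := abs_le.1 hτ1
        by_cases hjj : j = j₀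
        · subst hjj
          simp only [topVertex, ← hη, PiLp.single_apply, if_true, smul_eq_mul, mul_one]
          have hnn : 0 ≤ τ * η := by rw [hτη]; linarith
          split_ifs with hs
          · have : 0 ≤ τ := nonneg_of_mul_nonneg_left hnn hs
            exact ⟨by linarith, by linarith⟩
          · have hneg : η < 0 := lt_of_le_of_ne (not_lt.1 hs) hj₀
            have : τ ≤ 0 := by
              by_contra! hcon
              nlinarith
            exact ⟨by linarith, by linarith⟩
        · simp only [topVertex, PiLp.single_apply, hjj, if_false, smul_zero, sub_zero]
          split_ifs <;> norm_num
    · rw [← skewProjection_eq_zero_iff hEF]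
      have : x - z ↑r - (topVertex ℓ - τ • EuclideanSpace.single j₀ (1 : ℝ) +
          (↑r - latticeFloor (r : Space N))) = y - r := by
        simp only [z, hy]
        abel
      rw [this, map_sub, hfr, sub_self]

/-- Points of `u + ℤ^N` do not lie on walls if `u` is non-singular. -/
theorem IsWall.apply_ne (hEF : IsCompl E F) {ℓ : Module.Dual ℝ (Space N)} {J : Finset (Fin N)}
    (h : IsWall E ℓ J) (hu : u ∈ nonSingular E) {v : Space N} (hv : v ∈ lattice N) {x : Space N}
    (hx : x - u ∈ lattice N) : ℓ x ≠ ℓ v := by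
  intro heq
  obtain ⟨δ, hδ, Z, -, hZ, hcov⟩ := h.exists_cover hEF hv ‖skewProjection hEF x‖
  -- A point on the wall lies in a translate of the strip that does not reach beyond the wall, so it
  -- is a boundary point of this translate: any step that increases `ℓ` leaves it. Non-singularity
  -- of `u` forbids this.
  obtain ⟨z, hz, hxz⟩ := hcov x le_rfl (by linarith) heq.le
  have hL : x - u - z ∈ lattice N := (lattice N).sub_mem hx (hZ z hz).1
  refine hu _ hL ?_
  have hxe : x - u - z + u = x - z := by abel
  rw [hxe, frontier, isClosed_strip.closure_eq]
  refine ⟨hxz, fun hint => ?_⟩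
  obtain ⟨w, hw⟩ : ∃ w, ℓ w ≠ 0 := by
    by_contra! hcon
    exact h.ne_zero (LinearMap.ext hcon)
  have hcont : Continuous fun t : ℝ => x - z + (t * ℓ w) • w := by fun_prop
  have h0 : Tendsto (fun t : ℝ => x - z + (t * ℓ w) • w) (𝓝[>] 0) (𝓝 (x - z)) := by
    have := hcont.tendsto 0
    simp only [zero_mul, zero_smul, add_zero] at this
    exact this.mono_left nhdsWithin_le_nhds
  obtain ⟨t, ht1, ht2⟩ := ((h0.eventually (mem_interior_iff_mem_nhds.1 hint)).and
    self_mem_nhdsWithin).exists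
  have hxt : x + (t * ℓ w) • w - z = x - z + (t * ℓ w) • w := by abel
  have h1 := (hZ z hz).2 (x + (t * ℓ w) • w) (by rw [hxt]; exact ht1)
  rw [map_add, map_smul, smul_eq_mul, heq] at h1
  have : 0 < t * ℓ w * ℓ w := by
    rw [mul_assoc]
    exact mul_pos ht2 (mul_self_pos.2 hw)
  linarith

end CanonicalProjection

/-! ### Clopen sets of patterns defined by boxes -/

namespace CanonicalProjection

open ContinuousGroupoidCohomology

variable {N : ℕ} {E F : Submodule ℝ (Space N)} {u : Space N}

namespace ProjectionPattern

variable {T : ProjectionPattern E u}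

theorem mem_car_reg_neg_projE (hT : Function.Injective T.fromStrip) {x y : Space N}
    (hx : x - u ∈ lattice N) : y ∈ T.car (T.reg (-projE E x)) ↔
      y + E.starProjection x ∈ strip E ∧ y + E.starProjection x - x ∈ lattice N := by
  rw [car_reg hT]
  have h1 : y ∈ strip E ↔ y + E.starProjection x ∈ strip E :=
    (add_mem_strip_iff (Submodule.starProjection_apply_mem _ _)).symm
  have h2 : y - (((-projE E x : E) : Space N) + u) = (y + E.starProjection x - x) + (x - u) := by
    push_cast [coe_projE]
    abel
  change y ∈ strip E ∧ y - (((-projE E x : E) : Space N) + u) ∈ lattice N ↔ _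
  rw [h1, h2, (lattice N).add_mem_cancel_right hx]

/-- A point of the limit of regular patterns differs from a limit of base points by a lattice
vector, and the patterns eventually contain the corresponding points. -/
theorem sub_mem_car_iff (hT : Function.Injective T.fromStrip) {κ : Type*} (𝒱 : Ultrafilter κ)
    {f : κ → Space N} (hf : ∀ n, f n - u ∈ lattice N) {h : T.Hull} {y : Space N}
    (hh : Tendsto (fun n => T.reg (-projE E (f n))) 𝒱 (𝓝 h))
    (hy : Tendsto (fun n => f n - E.starProjection (f n)) 𝒱 (𝓝 y)) {z : Space N}
    (hz : z ∈ lattice N) : y - z ∈ T.car h ↔ ∀ᶠ n in 𝒱, f n - z ∈ strip E := by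
  constructor
  · intro hm
    obtain ⟨g, hg, hgm⟩ := exists_tendsto_of_mem_car hT hh hm
    have h1 : Tendsto (fun n => g n - (f n - E.starProjection (f n))) 𝒱 (𝓝 (-z)) := by
      have := hg.sub hy
      rwa [sub_sub_cancel_left] at this
    obtain ⟨-, h2⟩ := exists_eventually_eq_of_tendsto 𝒱 h1 (by
      filter_upwards [hgm] with n hn
      rw [mem_car_reg_neg_projE hT (hf n)] at hn
      convert hn.2 using 1
      abel)
    filter_upwards [h2, hgm] with n h3 h4
    rw [mem_car_reg_neg_projE hT (hf n)] at h4
    have h5 : g n + E.starProjection (f n) = f n - z := by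
      rw [sub_eq_iff_eq_add] at h3
      rw [h3]
      abel
    rw [← h5]
    exact h4.1
  · intro hm
    refine mem_car_of_tendsto hT hh (hy.sub_const z) ?_
    filter_upwards [hm] with n hn
    rw [mem_car_reg_neg_projE hT (hf n)]
    have h5 : f n - E.starProjection (f n) - z + E.starProjection (f n) = f n - z := by abel
    rw [h5, sub_sub_cancel_left]
    exact ⟨hn, (lattice N).neg_mem hz⟩

theorem tendsto_apply_of_vanish {κ : Type*} {𝒱 : Filter κ} {f : κ → Space N} {y : Space N}
    (hy : Tendsto (fun n => f n - E.starProjection (f n)) 𝒱 (𝓝 y)) {ℓ : Module.Dual ℝ (Space N)}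
    (hℓ : ∀ e ∈ E, ℓ e = 0) : Tendsto (fun n => ℓ (f n)) 𝒱 (𝓝 (ℓ y)) := by
  have hc : Continuous ℓ := LinearMap.continuous_of_finiteDimensional _
  refine ((hc.tendsto y).comp hy).congr fun n => ?_
  simp only [Function.comp, map_sub]
  rw [hℓ _ (Submodule.starProjection_apply_mem _ _), sub_zero]

theorem tendsto_skew_of_tendsto (hEF : IsCompl E F) {κ : Type*} {𝒱 : Filter κ} {f : κ → Space N}
    {y : Space N} (hy : Tendsto (fun n => f n - E.starProjection (f n)) 𝒱 (𝓝 y)) :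
    Tendsto (fun n => skewProjection hEF (f n)) 𝒱 (𝓝 (skewProjection hEF y)) := by
  refine (((continuous_skewProjection hEF).tendsto y).comp hy).congr fun n => ?_
  simp only [Function.comp, map_sub]
  rw [(skewProjection_eq_zero_iff hEF).2 (Submodule.starProjection_apply_mem _ _), sub_zero]

/-- Patterns with the same limit lie on the same side of walls. -/
theorem eventually_lt_of_tendsto (hT : Function.Injective T.fromStrip) (hEF : IsCompl E F)
    {κ κ' : Type*} (𝒱 : Ultrafilter κ) (𝒰 : Ultrafilter κ')
    {f : κ → Space N} (hf : ∀ n, f n - u ∈ lattice N)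
    {f' : κ' → Space N} (hf' : ∀ n, f' n - u ∈ lattice N) {h : T.Hull} {y : Space N}
    (hh : Tendsto (fun n => T.reg (-projE E (f n))) 𝒱 (𝓝 h))
    (hy : Tendsto (fun n => f n - E.starProjection (f n)) 𝒱 (𝓝 y))
    (hh' : Tendsto (fun n => T.reg (-projE E (f' n))) 𝒰 (𝓝 h))
    (hy' : Tendsto (fun n => f' n - E.starProjection (f' n)) 𝒰 (𝓝 y))
    {ℓ : Module.Dual ℝ (Space N)} {J : Finset (Fin N)} (hℓ : IsWall E ℓ J) {v : Space N}
    (hv : v ∈ lattice N) (hlt : ∀ᶠ n in 𝒱, ℓ v < ℓ (f n)) : ∀ᶠ n in 𝒰, ℓ v < ℓ (f' n) := by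
  have h1 := tendsto_apply_of_vanish hy hℓ.vanish
  have h2 := tendsto_apply_of_vanish hy' hℓ.vanish
  have h3 := tendsto_skew_of_tendsto hEF hy'
  have h4 : ℓ v ≤ ℓ y := ge_of_tendsto h1 (hlt.mono fun _ h => h.le)
  rcases h4.lt_or_eq with h5 | h5
  · exact h2.eventually_const_lt h5
  by_contra hcon
  rw [← Ultrafilter.eventually_not] at hcon
  -- If the second net stayed on the lower side, one translate of the strip below the wall would
  -- contain its points along the ultrafilter. The limit pattern records this membership and hands
  -- it to the first net, which lies above the wall.
  obtain ⟨δ, hδ, Z, hZ, hZb, hcov⟩ := hℓ.exists_cover hEF hv (‖skewProjection hEF y‖ + 1)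
  have h6 : ∀ᶠ n in 𝒰, ∃ z ∈ Z, f' n - z ∈ strip E := by
    filter_upwards [hcon, h2.eventually_const_lt (by linarith : ℓ v - δ < ℓ y),
      h3.norm.eventually_lt_const (lt_add_one _)] with n h7 h8 h9
    exact hcov _ h9.le h8 (not_lt.1 h7)
  obtain ⟨z, hz, hze⟩ := (Ultrafilter.eventually_exists_mem_iff hZ).1 h6
  have h7 := (sub_mem_car_iff hT 𝒰 hf' hh' hy' (hZb z hz).1).2 hze
  have h8 := (sub_mem_car_iff hT 𝒱 hf hh hy (hZb z hz).1).1 h7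
  obtain ⟨n, h9, h10⟩ := (h8.and hlt).exists
  exact absurd ((hZb z hz).2 _ h9) (not_le.2 h10)

end ProjectionPattern

/-- The points of `u + ℤ^N` whose image lies in the open box of `V` given by the walls
`ℓᵢ = ℓᵢ(aᵢ)` and `ℓᵢ = ℓᵢ(bᵢ)`. -/
def latticeBox (hEF : IsCompl E F) (u o : Space N) {ι : Type*} (ℓ : ι → Module.Dual ℝ (Space N))
    (a b : ι → Space N) : Set (Space N) :=
  {x | x - u ∈ lattice N ∧ skewProjection hEF (x - o) ∈ contSpace hEF ∧
    ∀ i, ℓ i (a i) < ℓ i x ∧ ℓ i x < ℓ i (b i)}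

/-- Data describing a box of `V`, bounded by walls and lying inside the strip. -/
structure BoxData (hEF : IsCompl E F) (u : Space N) where
  /-- the base point -/
  o : Space N
  o_mem : o - u ∈ lattice N
  /-- the index set of the walls -/
  ι : Type
  [fin : Finite ι]
  /-- the functionals of the walls -/
  ℓ : ι → Module.Dual ℝ (Space N)
  /-- the index sets of the walls -/
  J : ι → Finset (Fin N)
  wall : ∀ i, IsWall E (ℓ i) (J i)
  /-- the lower walls -/
  a : ι → Space N
  a_mem : ∀ i, a i ∈ lattice N
  /-- the upper walls -/
  b : ι → Space N
  b_mem : ∀ i, b i ∈ lattice N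
  sub : ∀ x ∈ latticeBox hEF u o ℓ a b, x ∈ strip E

namespace BoxData

variable {hEF : IsCompl E F}

/-- The lattice points in the box. -/
def set (B : BoxData hEF u) : Set (Space N) := latticeBox hEF u B.o B.ℓ B.a B.b

variable (T : ProjectionPattern E u)

/-- The clopen set of patterns defined by a box. -/
def clopen (B : BoxData hEF u) : Set T.Hull :=
  closure ((fun x => T.reg (-projE E x)) '' B.set)

variable {T}

open ProjectionPattern

/-- Points of the box belong to their patterns, so a limit pattern contains a limit `y` of them over
the origin of `E`. This `y` plays the role of the marked point and carries the position relative to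
the walls. -/
theorem exists_net (hT : Function.Injective T.fromStrip) (B : BoxData hEF u) {h : T.Hull}
    (hh : h ∈ B.clopen T) : ∃ (𝒱 : Ultrafilter B.set) (y : Space N),
      Tendsto (fun x : B.set => T.reg (-projE E (x : Space N))) 𝒱 (𝓝 h) ∧
      Tendsto (fun x : B.set => (x : Space N) - E.starProjection (x : Space N)) 𝒱 (𝓝 y) ∧
      y ∈ T.car h ∧ projE E y = 0 := by
  have h1 : h ∈ closure (Set.range fun x : B.set => T.reg (-projE E (x : Space N))) := by
    convert hh using 2
    unfold clopen
    rw [Set.image_eq_range]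
  obtain ⟨𝒲, h2, h3⟩ := mem_closure_iff_ultrafilter.1 h1
  let 𝒱 := 𝒲.ofComapInfPrincipal (m := fun x : B.set => T.reg (-projE E (x : Space N)))
    (s := Set.univ) (by simpa using h2)
  have h4 : Tendsto (fun x : B.set => T.reg (-projE E (x : Space N))) 𝒱 (𝓝 h) := by
    rw [Tendsto, ← Ultrafilter.coe_map, Ultrafilter.ofComapInfPrincipal_eq_of_map]
    exact h3
  have hm : ∀ x : B.set, (x : Space N) - E.starProjection (x : Space N) ∈
      T.car (T.reg (-projE E (x : Space N))) := by
    intro x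
    rw [mem_car_reg_neg_projE hT x.2.1, sub_add_cancel, sub_self]
    exact ⟨B.sub x x.2, (lattice N).zero_mem⟩
  have hp : ∀ x : Space N, E.starProjection (x - E.starProjection x) = 0 := by
    intro x
    rw [map_sub, Submodule.starProjection_eq_self_iff.2 (Submodule.starProjection_apply_mem _ _),
      sub_self]
  obtain ⟨y, hy, hlim⟩ := Ultrafilter.exists_limit_of_mem 𝒱 (isCompact_strip_ball E 0)
    (Eventually.of_forall fun x : B.set => (⟨car_subset_strip _ (hm x), by rw [hp]; simp⟩ :
      (x : Space N) - E.starProjection (x : Space N) ∈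
        {x | x ∈ strip E ∧ ‖E.starProjection x‖ ≤ 0}))
  refine ⟨𝒱, y, h4, hlim, mem_car_of_tendsto hT h4 hlim (Eventually.of_forall hm),
    Subtype.ext ?_⟩
  exact norm_le_zero_iff.1 hy.2

/-- Patterns converging to a point of the clopen set eventually come from the box. -/
theorem eventually_mem_set (hT : Function.Injective T.fromStrip) (hu : u ∈ nonSingular E)
    (B : BoxData hEF u) {h : T.Hull} (hh : h ∈ B.clopen T) {κ : Type*} (𝒰 : Ultrafilter κ)
    {f : κ → Space N} (hf : ∀ n, f n ∈ stripPattern E u)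
    (hfh : Tendsto (fun n => T.reg (-projE E (f n))) 𝒰 (𝓝 h)) :
    ∀ᶠ n in 𝒰, ∃ x ∈ B.set, projE E x = projE E (f n) := by
  obtain ⟨𝒱, y, h1, h2, h3, h4⟩ := B.exists_net hT hh
  have := B.fin
  have h4' : E.starProjection y = 0 := congrArg Subtype.val h4
  obtain ⟨g, hg, hgm⟩ := exists_tendsto_of_mem_car hT hfh h3
  obtain ⟨C, hC⟩ := exists_norm_sub_starProjection_le E
  -- The pattern points tending to `y` need not come from `f n` itself. They come from `f n + w`
  -- with a constant lattice vector `w`, which turns out to be orthogonal to `E` and so does not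
  -- change the projection.
  obtain ⟨w, hw, hwe⟩ := exists_eventually_eq_of_isBounded 𝒰
    (Metric.isBounded_closedBall (x := (0 : Space N)) (r := ‖y‖ + 1 + C))
    (z := fun n => g n + E.starProjection (f n) - f n) (by
      filter_upwards [hgm, Metric.tendsto_nhds.1 hg 1 one_pos] with n h5 h6
      rw [mem_car_reg_neg_projE hT (hf n).2] at h5
      refine ⟨?_, h5.2⟩
      rw [mem_closedBall_zero_iff]
      have h7 : g n + E.starProjection (f n) - f n = g n - (f n - E.starProjection (f n)) := by abel
      rw [h7]
      refine (norm_sub_le _ _).trans (add_le_add ?_ (hC _ (hf n).1))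
      rw [dist_eq_norm] at h6
      have := norm_sub_norm_le (g n) y
      linarith)
  have hpw : E.starProjection w = 0 := by
    have h5 : Tendsto (fun n => E.starProjection (g n)) 𝒰 (𝓝 (E.starProjection y)) :=
      (E.starProjection.continuous.tendsto y).comp hg
    rw [h4'] at h5
    refine tendsto_nhds_unique_of_eventuallyEq tendsto_const_nhds h5 ?_
    filter_upwards [hwe] with n hn
    rw [← hn, map_sub, map_add,
      Submodule.starProjection_eq_self_iff.2 (Submodule.starProjection_apply_mem E (f n)),
      add_sub_cancel_right]
  have hwE : projE E w = 0 := Subtype.ext hpw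
  have hf'L : ∀ n, f n + w - u ∈ lattice N := fun n => by
    rw [add_sub_right_comm]
    exact (lattice N).add_mem (hf n).2 hw
  have hf'h : Tendsto (fun n => T.reg (-projE E (f n + w))) 𝒰 (𝓝 h) := by
    simpa only [map_add, hwE, add_zero] using hfh
  have hf'y : Tendsto (fun n => f n + w - E.starProjection (f n + w)) 𝒰 (𝓝 y) := by
    refine hg.congr' ?_
    filter_upwards [hwe] with n hn
    rw [map_add, hpw, ← hn]
    abel
  have hlow : ∀ i, ∀ᶠ n in 𝒰, B.ℓ i (B.a i) < B.ℓ i (f n + w) := fun i =>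
    eventually_lt_of_tendsto hT hEF 𝒱 𝒰 (fun x => x.2.1) hf'L h1 h2 hf'h hf'y (B.wall i)
      (B.a_mem i) (Eventually.of_forall fun x => (x.2.2.2 i).1)
  -- Only being above a wall is transported between nets. For upper walls the two nets are
  -- exchanged, after `IsWall.apply_ne` has excluded points on the wall.
  have hup : ∀ i, ∀ᶠ n in 𝒰, B.ℓ i (f n + w) < B.ℓ i (B.b i) := by
    intro i
    by_contra hcon
    rw [← Ultrafilter.eventually_not] at hcon
    have h5 : ∀ᶠ n in 𝒰, B.ℓ i (B.b i) < B.ℓ i (f n + w) := hcon.mono fun n hn =>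
      lt_of_le_of_ne (not_lt.1 hn) ((B.wall i).apply_ne hEF hu (B.b_mem i) (hf'L n)).symm
    have h6 := eventually_lt_of_tendsto hT hEF 𝒰 𝒱 hf'L (fun x => x.2.1) hf'h hf'y h1 h2 (B.wall i)
      (B.b_mem i) h5
    obtain ⟨x, hx⟩ := h6.exists
    exact lt_asymm hx (x.2.2.2 i).2
  have hV : ∀ᶠ n in 𝒰, skewProjection hEF (f n + w - B.o) ∈ contSpace hEF := by
    obtain ⟨r, hr, hrad⟩ := exists_contSpace_radius hEF
    have h5 : skewProjection hEF (y - B.o) ∈ contSpace hEF := by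
      have h6 := (tendsto_skew_of_tendsto hEF h2).sub_const (skewProjection hEF B.o)
      rw [map_sub]
      refine (contSpace hEF).closed_of_finiteDimensional.mem_of_tendsto h6
        (Eventually.of_forall fun x => ?_)
      rw [← map_sub]
      exact x.2.2.1
    filter_upwards [Metric.tendsto_nhds.1 (tendsto_skew_of_tendsto hEF hf'y) r hr] with n hn
    refine hrad _ ?_ _ h5 ?_
    · have := (lattice N).sub_mem (hf'L n) B.o_mem
      rwa [sub_sub_sub_cancel_right] at this
    · rw [← map_sub, sub_sub_sub_cancel_right, map_sub, ← dist_eq_norm]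
      exact hn
  have hall : ∀ᶠ n in 𝒰, ∀ i, B.ℓ i (B.a i) < B.ℓ i (f n + w) ∧
      B.ℓ i (f n + w) < B.ℓ i (B.b i) :=
    eventually_all.2 fun i => (hlow i).and (hup i)
  filter_upwards [hall, hV] with n h5 h6
  exact ⟨f n + w, ⟨hf'L n, h6, h5⟩, by rw [map_add, hwE, add_zero]⟩

/-- Taking the closure adds no regular patterns: `eventually_mem_set` is applied to a constant net.
-/
theorem reg_mem_clopen_iff (hT : Function.Injective T.fromStrip) (hu : u ∈ nonSingular E)
    (B : BoxData hEF u) (e : E) : T.reg e ∈ B.clopen T ↔ ∃ x ∈ B.set, -projE E x = e := by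
  constructor
  · intro h
    obtain ⟨-, y, -, -, h3, h4⟩ := B.exists_net hT h
    rw [car_reg hT] at h3
    have hx : y - e ∈ stripPattern E u := by
      refine ⟨?_, ?_⟩
      · rw [sub_eq_add_neg]
        exact (add_mem_strip_iff (E.neg_mem e.2)).2 h3.1
      · rw [sub_sub]
        exact h3.2
    have hxe : -projE E (y - (e : Space N)) = e := by
      rw [map_sub, h4, projE_coe]
      simp
    obtain ⟨𝒰⟩ : Nonempty (Ultrafilter Unit) := inferInstance
    obtain ⟨-, x, hx', hxx⟩ := (B.eventually_mem_set hT hu h 𝒰 (f := fun _ => y - (e : Space N))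
      (fun _ => hx) (by rw [hxe]; exact tendsto_const_nhds)).exists
    exact ⟨x, hx', by rw [hxx, hxe]⟩
  · rintro ⟨x, hx, rfl⟩
    exact subset_closure ⟨x, hx, rfl⟩

theorem zero_mem_of_mem_clopen (hT : Function.Injective T.fromStrip) (B : BoxData hEF u)
    {h : T.Hull} (hh : h ∈ B.clopen T) : ∃ y ∈ T.car h, projE E y = 0 := by
  obtain ⟨-, y, -, -, h3, h4⟩ := B.exists_net hT hh
  exact ⟨y, h3, h4⟩

/-- Regular patterns containing the origin are dense among all patterns containing it: an
approximating regular pattern is shifted by the small vector that moves its nearest point over the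
origin. -/
theorem exists_reg_mem (hT : Function.Injective T.fromStrip) {h : T.Hull}
    (h0 : ∃ y ∈ T.car h, projE E y = 0) {W : Set T.Hull} (hW : W ∈ 𝓝 h) :
    ∃ x ∈ stripPattern E u, T.reg (-projE E x) ∈ W := by
  obtain ⟨y, hy, hy0⟩ := h0
  obtain ⟨𝒰, h𝒰⟩ := exists_ultrafilter_reg h
  obtain ⟨g, hg, hgm⟩ := exists_tendsto_of_mem_car hT h𝒰 hy
  have hcp : Continuous (projE E) := LinearMap.continuous_of_finiteDimensional _
  have h1 : Tendsto (fun e => -projE E (g e) +ᵥ T.reg e) 𝒰 (𝓝 (-projE E y +ᵥ h)) :=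
    (((hcp.tendsto y).comp hg).neg).vadd h𝒰
  rw [hy0, neg_zero, zero_vadd] at h1
  obtain ⟨e, h2, h3⟩ := ((h1.eventually hW).and hgm).exists
  rw [car_reg hT] at h3
  refine ⟨g e - e, ⟨?_, ?_⟩, ?_⟩
  · rw [sub_eq_add_neg]
    exact (add_mem_strip_iff (E.neg_mem e.2)).2 h3.1
  · rw [sub_sub]
    exact h3.2
  · rw [vadd_reg] at h2
    have h4 : -projE E (g e - (e : Space N)) = -projE E (g e) + e := by
      rw [map_sub, projE_coe]
      abel
    rw [h4]
    exact h2

/-- The clopen set is open relative to the patterns containing the origin. -/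
theorem eventually_mem_clopen (hT : Function.Injective T.fromStrip) (hu : u ∈ nonSingular E)
    (B : BoxData hEF u) {h : T.Hull} (hh : h ∈ B.clopen T) {κ : Type*} (𝒰 : Ultrafilter κ)
    {f : κ → T.Hull} (hf : Tendsto f 𝒰 (𝓝 h))
    (hf0 : ∀ᶠ n in 𝒰, ∃ y ∈ T.car (f n), projE E y = 0) : ∀ᶠ n in 𝒰, f n ∈ B.clopen T := by
  by_contra hcon
  rw [← Ultrafilter.eventually_not] at hcon
  -- If the claim failed, `h` would be a limit of regular patterns that contain the origin but lie
  -- outside the closed set, against `eventually_mem_set`.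
  let D : Set (Space N) := {x | x ∈ stripPattern E u ∧ T.reg (-projE E x) ∉ B.clopen T}
  have h1 : h ∈ closure (Set.range fun x : D => T.reg (-projE E (x : Space N))) := by
    rw [mem_closure_iff_nhds]
    intro W hW
    obtain ⟨O, hOW, hO, hhO⟩ := mem_nhds_iff.1 hW
    obtain ⟨n, h2, h3, h4⟩ := (hcon.and ((hf.eventually (hO.mem_nhds hhO)).and hf0)).exists
    obtain ⟨x, hx, hx2⟩ := exists_reg_mem hT h4
      (inter_mem (hO.mem_nhds h3) ((isClosed_closure (s := ((fun x => T.reg (-projE E x)) ''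
        B.set))).isOpen_compl.mem_nhds h2))
    exact ⟨_, hOW hx2.1, ⟨x, hx, hx2.2⟩, rfl⟩
  obtain ⟨𝒲, h2, h3⟩ := mem_closure_iff_ultrafilter.1 h1
  let 𝒱 := 𝒲.ofComapInfPrincipal (m := fun x : D => T.reg (-projE E (x : Space N)))
    (s := Set.univ) (by simpa using h2)
  have h4 : Tendsto (fun x : D => T.reg (-projE E (x : Space N))) 𝒱 (𝓝 h) := by
    rw [Tendsto, ← Ultrafilter.coe_map, Ultrafilter.ofComapInfPrincipal_eq_of_map]
    exact h3
  obtain ⟨x, x', hx', hxx⟩ := (B.eventually_mem_set hT hu hh 𝒱 (fun x : D => x.2.1) h4).exists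
  refine x.2.2 ((B.reg_mem_clopen_iff hT hu _).2 ⟨x', hx', ?_⟩)
  rw [hxx]

end BoxData

end CanonicalProjection

/-! ### The cocycle of a box -/

namespace CanonicalProjection

open ContinuousGroupoidCohomology

variable {N : ℕ} {E F : Submodule ℝ (Space N)} {u : Space N}

/-- The Heaviside function of the `i`-th coordinate of `θ`, with jump at `w`. -/
def heaviside {X : Type*} [AddCommGroup X] {d : ℕ} (θ : X →+ (Fin d → ℝ)) (w : X) (i : Fin d) (p : X) : ℤ :=
  if 0 < θ (p - w) i then 1 else 0

theorem heaviside_sub {X : Type*} [AddCommGroup X] {d : ℕ} (θ : X →+ (Fin d → ℝ)) (w e : X) (i : Fin d) (p : X) :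
    heaviside θ (w - e) i (p - e) = heaviside θ w i p := by
  unfold heaviside
  rw [sub_sub_sub_cancel_right]

/-- Each factor is a difference of one Heaviside function at two vertices and vanishes unless the
jump lies between them. This makes the sum over the marked points finite. -/
theorem abs_le_of_cupDiff_ne_zero {X : Type*} [AddCommGroup X] {d : ℕ} {θ : X →+ (Fin d → ℝ)}
    {w : X} {p : Fin (d + 1) → X}
    {C : ℝ} (hC : ∀ j i, |θ (p j) i| ≤ C) (h : cupDiff (heaviside θ w) p ≠ 0) (i : Fin d) :
    |θ w i| ≤ C := by
  have h1 := Finset.prod_ne_zero_iff.1 h i (Finset.mem_univ _)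
  by_contra! hcon
  apply h1
  have h2 := abs_le.1 (hC i.succ i)
  have h3 := abs_le.1 (hC i.castSucc i)
  simp only [heaviside, map_sub, Pi.sub_apply, sub_pos]
  rcases lt_abs.1 hcon with h4 | h4
  · rw [if_neg (by linarith), if_neg (by linarith), sub_self]
  · rw [if_pos (by linarith), if_pos (by linarith), sub_self]

namespace BoxData

variable {hEF : IsCompl E F} {T : ProjectionPattern E u}

open ProjectionPattern

open Classical in
/-- The signed number of points of the pattern, of the type given by the box, between `p₀, …, p_d`. -/
def boxSum (B : BoxData hEF u) {d : ℕ} (θ : E →+ (Fin d → ℝ)) (h : T.Hull) (p : Fin (d + 1) → E) : ℤ :=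
  ∑ᶠ w : E, if -w +ᵥ h ∈ B.clopen T then cupDiff (heaviside θ w) p else 0

/-- The count depends only on the pattern and the points up to a common translation, as is needed
for a cochain of the groupoid. -/
theorem boxSum_vadd (B : BoxData hEF u) {d : ℕ} (θ : E →+ (Fin d → ℝ)) (h : T.Hull)
    (p : Fin (d + 1) → E) (e : E) :
    B.boxSum θ (-e +ᵥ h) (fun i => p i - e) = B.boxSum θ h p := by
  unfold boxSum
  rw [← finsum_comp_equiv (Equiv.subRight e)]
  refine finsum_congr fun w => ?_
  have h1 : -(Equiv.subRight e w) +ᵥ (-e +ᵥ h) = -w +ᵥ h := by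
    rw [vadd_vadd]
    congr 1
    rw [Equiv.subRight_apply]
    abel
  rw [h1]
  simp only [cupDiff, Equiv.subRight_apply, heaviside_sub]

/-- Finiteness of the set of lattice vectors near `V` with bounded coordinates. -/
def IsProper (hEF : IsCompl E F) {d : ℕ} (θ : E →+ (Fin d → ℝ)) : Prop :=
  ∀ C : ℝ, {z | z ∈ lattice N ∧ ‖skewProjection hEF z‖ ≤ C ∧ ∀ i, |θ (projE E z) i| ≤ C}.Finite

theorem exists_norm_skew_le (hEF : IsCompl E F) :
    ∃ C : ℝ, ∀ x ∈ strip E, ‖skewProjection hEF x‖ ≤ C := by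
  obtain ⟨C, hC⟩ := ((isCompact_unitCube (N := N)).image
    (continuous_skewProjection hEF)).isBounded.exists_norm_le
  refine ⟨C, fun x hx => ?_⟩
  obtain ⟨c, hc, h⟩ := mem_strip_iff.1 hx
  have := (skewProjection_eq_zero_iff hEF).2 h
  rw [map_sub, sub_eq_zero] at this
  rw [this]
  exact hC _ ⟨c, hc, rfl⟩

/-- A finite set outside which the summands defining `boxSum` vanish. -/
theorem exists_finset_support (hT : Function.Injective T.fromStrip) (B : BoxData hEF u) {d : ℕ}
    {θ : E →+ (Fin d → ℝ)} (hθ : IsProper hEF θ) {m : ℕ} (p : Fin m → E) :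
    ∃ W : Finset E, ∀ h : T.Hull, (∃ y ∈ T.car h, projE E y = 0) → ∀ q : Fin (d + 1) → Fin m,
      ∀ w : E, -w +ᵥ h ∈ B.clopen T → cupDiff (heaviside θ w) (fun i => p (q i)) ≠ 0 → w ∈ W := by
  classical
  obtain ⟨C, hC⟩ := exists_norm_skew_le (E := E) hEF
  obtain ⟨D, hD⟩ : ∃ D : ℝ, ∀ j i, |θ (p j) i| ≤ D := by
    obtain ⟨D, hD⟩ := (Set.finite_range fun ji : Fin m × Fin d => |θ (p ji.1) ji.2|).bddAbove
    exact ⟨D, fun j i => hD ⟨(j, i), rfl⟩⟩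
  refine ⟨(hθ (max (2 * C) D)).toFinset.image (projE E), ?_⟩
  rintro h ⟨y₀, hy₀, hy₀'⟩ q w hw hne
  obtain ⟨y, hy, hy'⟩ := B.zero_mem_of_mem_clopen hT hw
  rw [car_vadd hT, mem_translate] at hy
  set x := y - ((-w : E) : Space N) with hx
  have hxw : projE E x = w := by
    rw [hx, map_sub, hy', projE_coe, zero_sub, neg_neg]
  -- The marked vector `w` is the projection of a difference of two points of the same pattern. This
  -- is a lattice vector with bounded `π'` and bounded `θ`, so properness leaves finitely many.
  rw [Finset.mem_image]
  refine ⟨x - y₀, ?_, by rw [map_sub, hxw, hy₀', sub_zero]⟩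
  rw [Set.Finite.mem_toFinset]
  refine ⟨sub_mem_lattice hT hy hy₀, ?_, fun i => ?_⟩
  · rw [map_sub]
    refine (norm_sub_le _ _).trans (le_max_of_le_left ?_)
    linarith [hC _ (car_subset_strip _ hy), hC _ (car_subset_strip _ hy₀)]
  · rw [map_sub, hxw, hy₀', sub_zero]
    exact le_max_of_le_right (abs_le_of_cupDiff_ne_zero (fun j i => hD _ _) hne i)

open Classical in
theorem boxSum_eq_sum (B : BoxData hEF u) {d : ℕ} {θ : E →+ (Fin d → ℝ)} {h : T.Hull}
    {p : Fin (d + 1) → E} {W : Finset E}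
    (hW : ∀ w : E, -w +ᵥ h ∈ B.clopen T → cupDiff (heaviside θ w) p ≠ 0 → w ∈ W) :
    B.boxSum θ h p = ∑ w ∈ W, if -w +ᵥ h ∈ B.clopen T then cupDiff (heaviside θ w) p else 0 := by
  refine finsum_eq_sum_of_support_subset _ fun w hw => ?_
  rw [Function.mem_support] at hw
  split_ifs at hw with h1
  · exact hW w h1 hw
  · exact absurd rfl hw

/-- Translation vectors between points of convergent patterns are eventually constant. -/
theorem eventually_eq_of_tendsto (hT : Function.Injective T.fromStrip) {κ : Type*}
    (𝒰 : Ultrafilter κ) {f : κ → T.Hull} (hf0 : ∀ n, ∃ y ∈ T.car (f n), projE E y = 0)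
    {w : κ → E} {w₀ : E} (hw : ∀ᶠ n in 𝒰, ∃ y ∈ T.car (f n), projE E y = w n)
    (hlim : Tendsto w 𝒰 (𝓝 w₀)) : ∀ᶠ n in 𝒰, w n = w₀ := by
  obtain ⟨C, hC⟩ := exists_norm_sub_starProjection_le E
  choose y₀ hy₀ hy₀' using hf0
  have hch : ∀ n, ∃ y, (∃ y ∈ T.car (f n), projE E y = w n) → y ∈ T.car (f n) ∧ projE E y = w n := by
    intro n
    by_cases h : ∃ y ∈ T.car (f n), projE E y = w n
    · obtain ⟨y, hy⟩ := h
      exact ⟨y, fun _ => hy⟩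
    · exact ⟨0, fun h' => absurd h' h⟩
  choose y hy using hch
  obtain ⟨z, -, hz⟩ := exists_eventually_eq_of_isBounded 𝒰
    (Metric.isBounded_closedBall (x := (0 : Space N)) (r := ‖w₀‖ + 1 + 2 * C))
    (z := fun n => y n - y₀ n) (by
      filter_upwards [hw, Metric.tendsto_nhds.1 hlim 1 one_pos] with n h1 h2
      obtain ⟨h3, h4⟩ := hy n h1
      refine ⟨?_, sub_mem_lattice hT h3 (hy₀ n)⟩
      rw [mem_closedBall_zero_iff]
      have h5 : E.starProjection (y n) = w n := congrArg Subtype.val h4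
      have h6 : E.starProjection (y₀ n) = 0 := congrArg Subtype.val (hy₀' n)
      have h7 : y n - y₀ n = (w n : Space N) + ((y n - E.starProjection (y n)) -
          (y₀ n - E.starProjection (y₀ n))) := by
        rw [h5, h6]
        abel
      rw [h7]
      refine (norm_add_le _ _).trans (add_le_add ?_ ((norm_sub_le _ _).trans ?_))
      · rw [dist_eq_norm] at h2
        have := norm_sub_norm_le (w n) w₀
        have h8 : ‖(w n : Space N)‖ = ‖w n‖ := rfl
        linarith
      · linarith [hC _ (car_subset_strip _ h3), hC _ (car_subset_strip _ (hy₀ n))])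
  have hev : ∀ᶠ n in 𝒰, w n = projE E z := by
    filter_upwards [hz, hw] with n h1 h2
    rw [← h1, map_sub, (hy n h2).2, hy₀' n, sub_zero]
  have : projE E z = w₀ := tendsto_nhds_unique_of_eventuallyEq tendsto_const_nhds hlim
    (hev.mono fun n hn => hn.symm)
  rwa [this] at hev

/-- The tuple of translation vectors of a chain, starting at its first vertex. -/
def chainPoints {q : ℕ} (s : Chain (PatternGroupoid T) q) (i : Fin (q + 1)) : E :=
  PatternArrow.vec (s.toFunctor.map (homOfLE (Fin.zero_le i)))

theorem chain_zero_mem {q : ℕ} (s : Chain (PatternGroupoid T) q) :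
    ∃ y ∈ T.car (s.toFunctor.obj 0).point, projE E y = 0 :=
  mem_toPoint_iff.1 (s.toFunctor.obj 0).zero_mem

theorem chainPoints_mem {q : ℕ} (s : Chain (PatternGroupoid T) q) (i : Fin (q + 1)) :
    ∃ y ∈ T.car (s.toFunctor.obj 0).point, projE E y = chainPoints s i :=
  mem_toPoint_iff.1 (PatternArrow.vec_mem _)

-- Near a given chain the displacement vectors are constant, the same finite set of vectors `w`
-- matters for all patterns, and for each of them membership of the translate in the clopen set is
-- locally constant.
open Classical in
theorem continuous_boxSum (hT : Function.Injective T.fromStrip) (hu : u ∈ nonSingular E)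
    (B : BoxData hEF u) {d : ℕ} {θ : E →+ (Fin d → ℝ)} (hθ : IsProper hEF θ) :
    Continuous fun s : Chain (PatternGroupoid T) d =>
      B.boxSum θ (s.toFunctor.obj 0).point (chainPoints s) := by
  rw [continuous_iff_ultrafilter]
  intro s 𝒰 h𝒰
  have hlim := (tendsto_chain_iff (f := fun s : Chain (PatternGroupoid T) d => s)).1 h𝒰
  have hpt : Tendsto (fun s : Chain (PatternGroupoid T) d => (s.toFunctor.obj 0).point) 𝒰
    (𝓝 (s.toFunctor.obj 0).point) := (hlim ⟨(0, 0), le_rfl⟩).1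
  have hvec : ∀ i, ∀ᶠ s' : Chain (PatternGroupoid T) d in 𝒰, chainPoints s' i = chainPoints s i :=
    fun i => eventually_eq_of_tendsto hT 𝒰 chain_zero_mem
      (Eventually.of_forall fun s' => chainPoints_mem s' i) (hlim ⟨(0, i), Fin.zero_le i⟩).2
  obtain ⟨W, hW⟩ := B.exists_finset_support hT hθ (chainPoints s)
  have hmem : ∀ w : E, ∀ᶠ s' : Chain (PatternGroupoid T) d in 𝒰,
      (-w +ᵥ (s'.toFunctor.obj 0).point ∈ B.clopen T ↔
        -w +ᵥ (s.toFunctor.obj 0).point ∈ B.clopen T) := by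
    intro w
    have hlw := hpt.const_vadd (-w)
    by_cases h : -w +ᵥ (s.toFunctor.obj 0).point ∈ B.clopen T
    -- The closed set is open only relative to patterns containing the origin. Nearby patterns must
    -- therefore be shown to contain a point exactly over `w`, not merely close to it.
    · have h0 : ∀ᶠ s' : Chain (PatternGroupoid T) d in 𝒰,
          ∃ y ∈ T.car (-w +ᵥ (s'.toFunctor.obj 0).point), projE E y = 0 := by
        obtain ⟨y, hy, hy'⟩ := B.zero_mem_of_mem_clopen hT h
        rw [car_vadd hT, mem_translate] at hy
        obtain ⟨g, hg, hgm⟩ := exists_tendsto_of_mem_car hT hpt hy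
        have hcp : Continuous (projE E) := LinearMap.continuous_of_finiteDimensional _
        have h1 : projE E (y - ((-w : E) : Space N)) = w := by
          rw [map_sub, hy', projE_coe, zero_sub, neg_neg]
        have h2 : Tendsto (fun s' => projE E (g s')) 𝒰 (𝓝 w) := by
          rw [← h1]
          exact (hcp.tendsto _).comp hg
        have h3 := eventually_eq_of_tendsto hT 𝒰 chain_zero_mem
          (hgm.mono fun s' h => ⟨g s', h, rfl⟩) h2
        filter_upwards [h3, hgm] with s' h4 h5
        refine ⟨g s' + ((-w : E) : Space N), ?_, ?_⟩
        · rw [car_vadd hT, mem_translate, add_sub_cancel_right]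
          exact h5
        · rw [map_add, projE_coe, h4, add_neg_cancel]
      filter_upwards [B.eventually_mem_clopen hT hu h 𝒰 hlw h0] with s' hs'
      exact iff_of_true hs' h
    · filter_upwards [hlw.eventually (isClosed_closure.isOpen_compl.mem_nhds h)] with s' hs'
      exact iff_of_false hs' h
  have hW' : ∀ᶠ s' : Chain (PatternGroupoid T) d in 𝒰, ∀ w ∈ W,
      (-w +ᵥ (s'.toFunctor.obj 0).point ∈ B.clopen T ↔
        -w +ᵥ (s.toFunctor.obj 0).point ∈ B.clopen T) :=
    (eventually_all_finset W).2 fun w _ => hmem w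
  refine tendsto_nhds_of_eventually_eq ?_ 
  filter_upwards [hW', eventually_all.2 hvec] with s' h1 h2
  have h3 : chainPoints s' = chainPoints s := funext h2
  rw [h3, B.boxSum_eq_sum (p := chainPoints s) (fun w => hW _ (chain_zero_mem s) id w),
    B.boxSum_eq_sum (p := chainPoints s) (fun w => hW _ (chain_zero_mem s') id w)]
  refine Finset.sum_congr rfl fun w hw => ?_
  simp only [h1 w hw]

/-- The cochain of a box. -/
def cochain (hT : Function.Injective T.fromStrip) (hu : u ∈ nonSingular E)
    (B : BoxData hEF u) {d : ℕ} {θ : E →+ (Fin d → ℝ)} (hθ : IsProper hEF θ) :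
    Cochain (PatternGroupoid T) d :=
  ⟨_, B.continuous_boxSum hT hu hθ⟩

theorem chainPoints_face {q : ℕ} (s : Chain (PatternGroupoid T) (q + 1)) (k : Fin (q + 2))
    (i : Fin (q + 1)) :
    chainPoints (s.face k) i = chainPoints s (k.succAbove i) - chainPoints s (k.succAbove 0) := by
  have h : s.toFunctor.map (homOfLE (Fin.zero_le (k.succAbove i))) =
      s.toFunctor.map (homOfLE (Fin.zero_le (k.succAbove 0))) ≫
        s.toFunctor.map (homOfLE ((Fin.succAboveOrderEmb k).monotone (Fin.zero_le i))) := by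
    rw [← s.toFunctor.map_comp]
    rfl
  rw [eq_sub_iff_add_eq']
  exact (congrArg PatternArrow.vec h).symm

theorem face_point {q : ℕ} (s : Chain (PatternGroupoid T) (q + 1)) (k : Fin (q + 2)) :
    ((s.face k).toFunctor.obj 0).point =
      -chainPoints s (k.succAbove 0) +ᵥ (s.toFunctor.obj 0).point :=
  PatternArrow.source_eq (s.toFunctor.map (homOfLE (Fin.zero_le (k.succAbove 0))))

/-- By translation invariance all faces can be evaluated in the pattern of the first vertex. For
each marked point separately the alternating sum is then the cocycle identity `sum_cupDiff_face`. -/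
theorem coboundary_cochain (hT : Function.Injective T.fromStrip) (hu : u ∈ nonSingular E)
    (B : BoxData hEF u) {d : ℕ} {θ : E →+ (Fin d → ℝ)} (hθ : IsProper hEF θ) :
    coboundary (PatternGroupoid T) d (B.cochain hT hu hθ) = 0 := by
  classical
  ext s
  change (∑ k : Fin (d + 2), (-1 : ℤ) ^ (k : ℕ) •
    (B.cochain hT hu hθ).comp ⟨Chain.face k, Chain.continuous_face k⟩ : C(_, ℤ)) _ = 0
  rw [ContinuousMap.sum_apply]
  have h1 : ∀ k : Fin (d + 2), ((-1 : ℤ) ^ (k : ℕ) •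
      (B.cochain hT hu hθ).comp ⟨Chain.face k, Chain.continuous_face k⟩ : C(_, ℤ)) s =
      (-1 : ℤ) ^ (k : ℕ) * B.boxSum θ (s.toFunctor.obj 0).point
        (fun i => chainPoints s (k.succAbove i)) := by
    intro k
    change (-1 : ℤ) ^ (k : ℕ) * B.boxSum θ ((s.face k).toFunctor.obj 0).point
      (chainPoints (s.face k)) = _
    rw [face_point, funext (chainPoints_face s k)]
    exact congrArg _ (B.boxSum_vadd θ _ (fun i => chainPoints s (k.succAbove i)) _)
  simp only [h1]
  obtain ⟨W, hW⟩ := B.exists_finset_support hT hθ (chainPoints s)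
  have h2 : ∀ k : Fin (d + 2), (-1 : ℤ) ^ (k : ℕ) * B.boxSum θ (s.toFunctor.obj 0).point
      (fun i => chainPoints s (k.succAbove i)) = ∑ w ∈ W,
      if -w +ᵥ (s.toFunctor.obj 0).point ∈ B.clopen T then (-1 : ℤ) ^ (k : ℕ) *
        cupDiff (heaviside θ w) (fun i => chainPoints s (k.succAbove i)) else 0 := by
    intro k
    rw [B.boxSum_eq_sum (fun w => hW _ (chain_zero_mem s) k.succAbove w), Finset.mul_sum]
    refine Finset.sum_congr rfl fun w _ => ?_
    rw [mul_ite, mul_zero]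
  simp only [h2]
  rw [Finset.sum_comm]
  refine Finset.sum_eq_zero fun w _ => ?_
  split_ifs with h
  · exact sum_cupDiff_face _ _
  · exact Finset.sum_const_zero

open Classical in
/-- The value of the cochain of a box on a regular chain. -/
theorem evalCochain_cochain (hT : Function.Injective T.fromStrip) (hu : u ∈ nonSingular E)
    (B : BoxData hEF u) {d : ℕ} {θ : E →+ (Fin d → ℝ)} (hθ : IsProper hEF θ)
    {x : Fin (d + 1) → Space N} (hx : ∀ i, x i ∈ stripPattern E u) :
    evalCochain (T.reg 0) (B.cochain hT hu hθ) (fun i => projE E (x i)) =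
      ∑ᶠ y : Space N, if y ∈ B.set then
        cupDiff (heaviside θ (projE E y)) (fun i => projE E (x i)) else 0 := by
  rw [evalCochain_of_mem fun i => projE_mem_reg hT (hx i)]
  have h1 : (B.cochain hT hu hθ) (chainOf (T.reg 0) (fun i => projE E (x i))
      fun i => projE_mem_reg hT (hx i)) = B.boxSum θ (T.reg 0) (fun i => projE E (x i)) :=
    B.boxSum_vadd θ (T.reg 0) (fun i => projE E (x i)) (projE E (x 0))
  rw [h1]
  unfold boxSum
  -- Two points of one box differ by an element of `Γ`, and `Γ` embeds into `E`. So summing over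
  -- marked vectors of `E` is the same as summing over lattice points of the box.
  have hinj : Set.InjOn (projE E) B.set := by
    intro y hy y' hy' h
    have h2 : y - y' ∈ translationGroup hEF := by
      refine ⟨?_, ?_⟩
      · have := (lattice N).sub_mem hy.1 hy'.1
        rwa [sub_sub_sub_cancel_right] at this
      · have := (contSpace hEF).sub_mem hy.2.1 hy'.2.1
        rwa [← map_sub, sub_sub_sub_cancel_right] at this
    have h3 : E.starProjection (y - y') = 0 := by
      rw [map_sub, sub_eq_zero]
      exact congrArg Subtype.val h
    exact sub_eq_zero.1 (eq_zero_of_mem_translationGroup hEF h2 h3)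
  have h2 : ∀ w : E, -w +ᵥ T.reg 0 ∈ B.clopen T ↔ w ∈ projE E '' B.set := by
    intro w
    rw [vadd_reg, add_zero, B.reg_mem_clopen_iff hT hu]
    simp [neg_inj]
  simp only [h2]
  have h3 := finsum_mem_image' (f := fun w : E => cupDiff (heaviside θ w) fun i => projE E (x i))
    (hinj.mono (Set.inter_subset_left (t := Function.support ((fun w : E =>
      cupDiff (heaviside θ w) fun i => projE E (x i)) ∘ projE E))))
  simpa only [finsum_mem_def, Set.indicator_apply] using h3

end BoxData

end CanonicalProjection

namespace CanonicalProjection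

/-! ### Sums over the Kuhn triangulation of `ℤ^d` -/

section Kuhn

open Equiv

/-- The `j`-th vertex of the Kuhn simplex of the unit cube given by a permutation. -/
def kuhnVertex {d : ℕ} (τ : Perm (Fin d)) (j : ℕ) : Fin d → ℤ :=
  fun a => if ((τ.symm a : Fin d) : ℕ) < j then 1 else 0

/-- The evaluation of a cochain on the Kuhn triangulation of the cube with lower vertex `μ`. -/
def kuhnSum {d : ℕ} (c : (Fin (d + 1) → (Fin d → ℤ)) → ℤ) (μ : Fin d → ℤ) : ℤ :=
  ∑ τ : Perm (Fin d), (Perm.sign τ : ℤ) * c fun j => μ + kuhnVertex τ j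

/-- Permutations that differ by an adjacent transposition give simplices sharing the face opposite
the vertex `k + 1`. -/
theorem kuhnVertex_mul_swap {d : ℕ} (τ : Perm (Fin (d + 1))) (k : Fin d) (j : ℕ)
    (hj : j ≠ k + 1) : kuhnVertex (τ * swap k.castSucc k.succ) j = kuhnVertex τ j := by
  funext a
  unfold kuhnVertex
  have : (τ * swap k.castSucc k.succ).symm a = swap k.castSucc k.succ (τ.symm a) := by
    rw [← Perm.inv_def, mul_inv_rev, swap_inv]
    rfl
  rw [this]
  generalize τ.symm a = x
  congr 1
  rw [swap_apply_def]
  split_ifs with h1 h2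
  · subst h1
    simp only [Fin.val_succ, Fin.val_castSucc, eq_iff_iff]
    omega
  · subst h2
    simp only [Fin.val_succ, Fin.val_castSucc, eq_iff_iff]
    omega
  · rfl

/-- The face opposite vertex `0` of the rotated simplex is the unit translate of the face opposite
the last vertex of the original one: opposite sides of the cube carry the same triangulation. -/
theorem kuhnVertex_mul_finRotate {d : ℕ} (τ : Perm (Fin (d + 1))) (j : ℕ) (hj : j ≤ d) :
    kuhnVertex (τ * (finRotate (d + 1))⁻¹) (j + 1) =
      Pi.single (τ (Fin.last d)) 1 + kuhnVertex τ j := by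
  funext a
  unfold kuhnVertex
  have : (τ * (finRotate (d + 1))⁻¹).symm a = finRotate (d + 1) (τ.symm a) := by
    rw [← Perm.inv_def, mul_inv_rev, inv_inv]
    rfl
  rw [this, Pi.add_apply, Pi.single_apply]
  have h2 : a = τ (Fin.last d) ↔ τ.symm a = Fin.last d := by
    rw [Equiv.symm_apply_eq]
  simp only [h2]
  generalize τ.symm a = x
  by_cases hx : x = Fin.last d
  · subst hx
    rw [finRotate_last]
    simp [show ¬ d < j by omega]
  · have hlt : (x : ℕ) < d := by
      have := Fin.val_lt_last hx
      simpa using this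
    have : ((finRotate (d + 1) x : Fin (d + 1)) : ℕ) = x + 1 := by
      rw [coe_finRotate_of_ne_last hx]
    rw [this, if_neg hx, zero_add]
    simp only [Nat.add_lt_add_iff_right]

/-- Stokes' formula for the Kuhn triangulation of a cube. -/
theorem kuhnSum_coboundary {d : ℕ} (b : (Fin (d + 1) → (Fin (d + 1) → ℤ)) → ℤ)
    (μ : Fin (d + 1) → ℤ) :
    kuhnSum (fun p => ∑ k : Fin (d + 2), (-1 : ℤ) ^ (k : ℕ) * b fun i => p (k.succAbove i)) μ =
      (-1) ^ d * ∑ τ : Perm (Fin (d + 1)), (Perm.sign τ : ℤ) *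
        ((b fun j => (μ + Pi.single (τ (Fin.last d)) 1) + kuhnVertex τ (j : ℕ)) -
          b fun j => μ + kuhnVertex τ (j : ℕ)) := by
  unfold kuhnSum
  simp only [Finset.mul_sum]
  rw [Finset.sum_comm, Fin.sum_univ_succ, Fin.sum_univ_castSucc]
  -- Inner faces are shared by two simplices of opposite sign and cancel in pairs.
  have hmid : ∀ k : Fin d, ∑ τ : Perm (Fin (d + 1)), (Perm.sign τ : ℤ) *
      ((-1) ^ ((k.castSucc.succ : Fin (d + 2)) : ℕ) *
        b fun i => μ + kuhnVertex τ ((k.castSucc.succ.succAbove i : Fin (d + 2)) : ℕ)) = 0 := by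
    intro k
    have hne : k.castSucc ≠ k.succ := Fin.castSucc_lt_succ.ne
    refine Finset.sum_involution (fun τ _ => τ * swap k.castSucc k.succ) ?_ ?_ ?_ ?_
    · intro τ _
      have h1 : (fun i : Fin (d + 1) => μ + kuhnVertex (τ * swap k.castSucc k.succ)
          ((k.castSucc.succ.succAbove i : Fin (d + 2)) : ℕ)) =
          fun i => μ + kuhnVertex τ ((k.castSucc.succ.succAbove i : Fin (d + 2)) : ℕ) := by
        funext i
        rw [kuhnVertex_mul_swap]
        intro h
        refine Fin.succAbove_ne k.castSucc.succ i (Fin.ext ?_)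
        rw [h]
        simp
      rw [h1, Perm.sign_mul, Perm.sign_swap hne]
      push_cast
      ring
    · intro τ _ _ h
      have h2 : swap k.castSucc k.succ = 1 := by simpa using h
      exact hne (swap_eq_one_iff.1 h2)
    · intro τ _
      exact Finset.mem_univ _
    · intro τ _
      rw [mul_assoc, swap_mul_self, mul_one]
  have hmid' := Finset.sum_congr rfl fun k (_ : k ∈ (Finset.univ : Finset (Fin d))) => hmid k
  rw [hmid', Finset.sum_const_zero, zero_add]
  -- Reindexing by the rotation, whose sign is `(-1) ^ d`, matches the faces opposite vertex `0`
  -- with translates of those opposite the last vertex.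
  have h0 : ∑ τ : Perm (Fin (d + 1)), (Perm.sign τ : ℤ) * ((-1) ^ ((0 : Fin (d + 2)) : ℕ) *
      b fun i => μ + kuhnVertex τ (((0 : Fin (d + 2)).succAbove i : Fin (d + 2)) : ℕ)) =
      ∑ τ : Perm (Fin (d + 1)), (-1) ^ d * ((Perm.sign τ : ℤ) *
        b fun j => (μ + Pi.single (τ (Fin.last d)) 1) + kuhnVertex τ (j : ℕ)) := by
    rw [← Equiv.sum_comp (Equiv.mulRight (finRotate (d + 1))⁻¹)]
    refine Finset.sum_congr rfl fun τ _ => ?_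
    rw [Equiv.coe_mulRight, Perm.sign_mul, Perm.sign_inv, sign_finRotate]
    have h1 : (fun i : Fin (d + 1) => μ + kuhnVertex (τ * (finRotate (d + 1))⁻¹)
        (((0 : Fin (d + 2)).succAbove i : Fin (d + 2)) : ℕ)) =
        fun j : Fin (d + 1) =>
          (μ + Pi.single (τ (Fin.last d)) 1) + kuhnVertex τ (j : ℕ) := by
      funext j
      rw [Fin.zero_succAbove, Fin.val_succ, kuhnVertex_mul_finRotate τ _ (by omega), add_assoc]
    rw [h1]
    push_cast
    simp
    ring
  rw [h0, ← Finset.sum_add_distrib]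
  refine Finset.sum_congr rfl fun τ _ => ?_
  have h3 : ∀ i : Fin (d + 1), (((Fin.last d).succ.succAbove i : Fin (d + 2)) : ℕ) = i := by
    intro i
    rw [Fin.succ_last, Fin.succAbove_last]
    simp
  simp only [h3]
  rw [Fin.succ_last, Fin.val_last, pow_succ]
  ring

/-- Factor `i` sees only coordinate `i`, between the vertices `i` and `i + 1`. In the simplex of `τ`
this coordinate changes at step `τ⁻¹ i`, so only the identity permutation contributes. -/
theorem kuhnSum_coordinatewise {d : ℕ} (h : Fin d → ℤ → ℤ) (μ : Fin d → ℤ) :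
    kuhnSum (fun p => ∏ i : Fin d, (h i (p i.succ i) - h i (p i.castSucc i))) μ =
      ∏ i, (h i (μ i + 1) - h i (μ i)) := by
  unfold kuhnSum
  rw [Finset.sum_eq_single 1]
  · simp only [Perm.sign_one, Units.val_one, one_mul]
    refine Finset.prod_congr rfl fun i _ => ?_
    have : ∀ j : ℕ, kuhnVertex (1 : Perm (Fin d)) j i = if (i : ℕ) < j then 1 else 0 := fun _ => rfl
    simp [this]
  · intro τ _ hτ
    obtain ⟨i, hi⟩ : ∃ i, τ.symm i ≠ i := by
      by_contra! hcon
      refine hτ (Equiv.ext fun i => ?_)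
      have := hcon i
      rw [Equiv.symm_apply_eq] at this
      exact this.symm
    refine mul_eq_zero_of_right _ (Finset.prod_eq_zero (Finset.mem_univ i) ?_)
    have : ((τ.symm i : Fin d) : ℕ) ≠ i := fun h => hi (Fin.ext h)
    have h2 : kuhnVertex τ ((i.succ : Fin (d + 1)) : ℕ) i =
        kuhnVertex τ ((i.castSucc : Fin (d + 1)) : ℕ) i := by
      unfold kuhnVertex
      congr 1
      simp only [Fin.val_succ, Fin.val_castSucc, eq_iff_iff]
      omega
    simp only [Pi.add_apply, h2, sub_self]
  · intro h
    exact absurd (Finset.mem_univ _) h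

/-- The triangulated cube counts the point `t` once exactly if it contains it. The strict inequality
in the Heaviside function makes the cubes half-open, in agreement with the floor. -/
theorem kuhnSum_heaviside {d : ℕ} (t : Fin d → ℝ) (μ : Fin d → ℤ) :
    kuhnSum (fun p => ∏ i : Fin d, ((if 0 < ((p i.succ i : ℤ) : ℝ) - t i then (1 : ℤ) else 0) -
      if 0 < ((p i.castSucc i : ℤ) : ℝ) - t i then (1 : ℤ) else 0)) μ =
      if ∀ i, ⌊t i⌋ = μ i then 1 else 0 := by
  rw [kuhnSum_coordinatewise fun i k => if 0 < (k : ℝ) - t i then (1 : ℤ) else 0]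
  have h : ∀ i, ((if 0 < ((μ i + 1 : ℤ) : ℝ) - t i then (1 : ℤ) else 0) -
      if 0 < ((μ i : ℤ) : ℝ) - t i then (1 : ℤ) else 0) = if ⌊t i⌋ = μ i then 1 else 0 := by
    intro i
    simp only [Int.floor_eq_iff]
    push_cast
    split_ifs <;> first | rfl | (exfalso; grind)
  simp only [h]
  by_cases hall : ∀ i, ⌊t i⌋ = μ i
  · simp [hall]
  · rw [if_neg hall]
    push Not at hall
    obtain ⟨i, hi⟩ := hall
    exact Finset.prod_eq_zero (Finset.mem_univ i) (if_neg hi)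

/-- A box of integer vectors. -/
def intBox {d : ℕ} (lo : Fin d → ℤ) (n : Fin d → ℕ) : Finset (Fin d → ℤ) :=
  Fintype.piFinset fun i => Finset.Ico (lo i) (lo i + n i)

theorem mem_intBox {d : ℕ} {lo : Fin d → ℤ} {n : Fin d → ℕ} {μ : Fin d → ℤ} :
    μ ∈ intBox lo n ↔ ∀ i, lo i ≤ μ i ∧ μ i < lo i + n i := by
  simp [intBox]

theorem sum_Ico_int_sub (f : ℤ → ℤ) (lo : ℤ) (n : ℕ) :
    ∑ t ∈ Finset.Ico lo (lo + n), (f (t + 1) - f t) = f (lo + n) - f lo := by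
  induction n with
  | zero => simp
  | succ n ih =>
    have : Finset.Ico lo (lo + (n + 1 : ℕ)) = insert (lo + n : ℤ) (Finset.Ico lo (lo + n)) := by
      ext t
      simp only [Finset.mem_Ico, Finset.mem_insert]
      push_cast
      omega
    rw [this, Finset.sum_insert (by simp), ih]
    push_cast
    rw [add_assoc]
    ring

theorem sum_intBox_fiber {d : ℕ} (lo : Fin d → ℤ) (n : Fin d → ℕ) (a : Fin d) (hn : 0 < n a)
    (f : (Fin d → ℤ) → ℤ) :
    ∑ μ ∈ intBox lo n, f μ = ∑ μ ∈ (intBox lo n).filter (fun μ => μ a = lo a),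
      ∑ t ∈ Finset.Ico (lo a) (lo a + n a), f (Function.update μ a t) := by
  rw [← Finset.sum_product']
  symm
  refine Finset.sum_bij' (fun p _ => Function.update p.1 a p.2)
    (fun μ _ => (Function.update μ a (lo a), μ a)) ?_ ?_ ?_ ?_ ?_
  · rintro ⟨μ, t⟩ hp
    simp only [Finset.mem_product, Finset.mem_filter, mem_intBox, Finset.mem_Ico] at hp ⊢
    intro i
    by_cases hi : i = a
    · subst hi
      simpa using hp.2
    · simpa [hi] using hp.1.1 i
  · intro μ hμ
    simp only [Finset.mem_product, Finset.mem_filter, mem_intBox, Finset.mem_Ico] at hμ ⊢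
    refine ⟨⟨fun i => ?_, by simp⟩, hμ a⟩
    by_cases hi : i = a
    · subst hi
      simp
      omega
    · simpa [hi] using hμ i
  · rintro ⟨μ, t⟩ hp
    simp only [Finset.mem_product, Finset.mem_filter] at hp
    simp [← hp.1.2]
  · intro μ _
    simp
  · intro p _
    rfl

theorem card_intBox_fiber {d : ℕ} (lo : Fin d → ℤ) (n : Fin d → ℕ) (a : Fin d) (hn : 0 < n a) :
    ((n a : ℤ)) * ((intBox lo n).filter (fun μ => μ a = lo a)).card = (intBox lo n).card := by
  have := sum_intBox_fiber lo n a hn fun _ => 1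
  simp only [Finset.sum_const, nsmul_eq_mul, mul_one, Int.card_Ico, add_sub_cancel_left,
    Int.toNat_natCast] at this
  rw [this]
  ring

/-- The sum of a difference over a box is a boundary term. -/
theorem abs_sum_intBox_sub_le {d : ℕ} (lo : Fin d → ℤ) (n : Fin d → ℕ) (a : Fin d) (hn : 0 < n a)
    (B : (Fin d → ℤ) → ℤ) (M : ℤ) (hM : ∀ μ, |B μ| ≤ M) :
    (n a : ℤ) * |∑ μ ∈ intBox lo n, (B (μ + Pi.single a 1) - B μ)| ≤
      2 * M * (intBox lo n).card := by
  rw [sum_intBox_fiber lo n a hn]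
  have h1 : ∀ μ ∈ (intBox lo n).filter (fun μ => μ a = lo a),
      |∑ t ∈ Finset.Ico (lo a) (lo a + n a), (B (Function.update μ a t + Pi.single a 1) -
        B (Function.update μ a t))| ≤ 2 * M := by
    intro μ _
    have h2 : ∀ t, Function.update μ a t + Pi.single a 1 = Function.update μ a (t + 1) := by
      intro t
      ext i
      by_cases hi : i = a
      · subst hi
        simp
      · simp [hi]
    simp only [h2]
    rw [sum_Ico_int_sub fun t => B (Function.update μ a t)]
    refine (abs_sub _ _).trans ?_
    linarith [hM (Function.update μ a (lo a + n a)), hM (Function.update μ a (lo a))]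
  have h3 := (Finset.abs_sum_le_sum_abs _ _).trans (Finset.sum_le_sum h1)
  rw [Finset.sum_const, nsmul_eq_mul] at h3
  calc _ ≤ (n a : ℤ) * (_ * (2 * M)) := mul_le_mul_of_nonneg_left h3 (by positivity)
    _ = 2 * M * ((n a : ℤ) * ((intBox lo n).filter (fun μ => μ a = lo a)).card) := by ring
    _ = _ := by rw [card_intBox_fiber lo n a hn]

theorem sum_intBox_sub_eq_zero {d : ℕ} (lo : Fin d → ℤ) (n : Fin d → ℕ) (a : Fin d) (hn : 0 < n a)
    (B : (Fin d → ℤ) → ℤ) (hB : ∀ μ, (∀ i, lo i ≤ μ i ∧ μ i ≤ lo i + n i) →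
      μ a = lo a ∨ μ a = lo a + n a → B μ = 0) :
    ∑ μ ∈ intBox lo n, (B (μ + Pi.single a 1) - B μ) = 0 := by
  rw [sum_intBox_fiber lo n a hn]
  refine Finset.sum_eq_zero fun μ hμ => ?_
  have hb : ∀ t, lo a ≤ t → t ≤ lo a + n a → ∀ i, lo i ≤ Function.update μ a t i ∧
      Function.update μ a t i ≤ lo i + n i := by
    intro t h1 h2 i
    have h3 := mem_intBox.1 (Finset.mem_filter.1 hμ).1 i
    by_cases hi : i = a
    · subst hi
      simpa using ⟨h1, h2⟩
    · simpa [hi] using ⟨h3.1, h3.2.le⟩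
  have h2 : ∀ t, Function.update μ a t + Pi.single a 1 = Function.update μ a (t + 1) := by
    intro t
    ext i
    by_cases hi : i = a
    · subst hi
      simp
    · simp [hi]
  simp only [h2]
  rw [sum_Ico_int_sub fun t => B (Function.update μ a t),
    hB (Function.update μ a (lo a)) (hb _ le_rfl (by omega)) (by simp),
    hB (Function.update μ a (lo a + n a)) (hb _ (by omega) le_rfl) (by simp), sub_zero]

end Kuhn

end CanonicalProjection

namespace CanonicalProjection

variable {N : ℕ} {E F : Submodule ℝ (Space N)} {u : Space N}

/-! ### Frames of walls -/

/-- `π'(e^J)` is a hyperplane of `F`, so a nonzero functional killing its preimage has kernel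
exactly `E + e^J`. -/
theorem exists_isWall (hEF : IsCompl E F) {J : Finset (Fin N)} (hJ : J ∈ hyperIndex hEF) :
    ∃ ℓ, IsWall E ℓ J := by
  set p := (coordSpace J).map (skewProjection hEF)
  have hpF : p ≤ F := by
    rintro _ ⟨y, -, rfl⟩
    exact skewProjection_mem hEF y
  have hlt : p < F := by
    refine lt_of_le_of_ne hpF fun h => ?_
    have : Module.finrank ℝ p + 1 = Module.finrank ℝ F := hJ
    rw [h] at this
    omega
  obtain ⟨w, hwF, hwp⟩ := SetLike.exists_of_lt hlt
  have hsup : p ⊔ Submodule.span ℝ {w} = F := by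
    refine Submodule.eq_of_le_of_finrank_le
      (sup_le hpF ((Submodule.span_singleton_le_iff_mem _ _).2 hwF)) ?_
    have h1 : p < p ⊔ Submodule.span ℝ {w} := by
      refine lt_of_le_of_ne le_sup_left fun h => hwp ?_
      rw [h]
      exact Submodule.mem_sup_right (Submodule.mem_span_singleton_self w)
    have h2 := Submodule.finrank_lt_finrank_of_lt h1
    have h3 : Module.finrank ℝ p + 1 = Module.finrank ℝ F := hJ
    omega
  have hnot : p.comap (skewProjection hEF) < ⊤ := by
    refine lt_of_le_of_ne le_top fun h => hwp ?_
    have h1 : w ∈ p.comap (skewProjection hEF) := h ▸ Submodule.mem_top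
    rwa [Submodule.mem_comap, skewProjection_of_mem hEF hwF] at h1
  obtain ⟨ℓ, hℓ0, hℓ⟩ := Submodule.exists_le_ker_of_lt_top _ hnot
  have hE : ∀ e ∈ E, ℓ e = 0 := fun e he => hℓ (by
    rw [Submodule.mem_comap, (skewProjection_eq_zero_iff hEF).2 he]
    exact p.zero_mem)
  have hπ : ∀ x, ℓ x = ℓ (skewProjection hEF x) := fun x => by
    have := hE _ (sub_skewProjection_mem hEF x)
    rwa [map_sub, sub_eq_zero] at this
  have hdec : ∀ x, ∃ y ∈ p, ∃ a : ℝ, skewProjection hEF x = y + a • w := by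
    intro x
    have h1 : skewProjection hEF x ∈ p ⊔ Submodule.span ℝ {w} := by
      rw [hsup]
      exact skewProjection_mem hEF x
    obtain ⟨y, hy, z, hz, h⟩ := Submodule.mem_sup.1 h1
    obtain ⟨a, ha⟩ := Submodule.mem_span_singleton.1 hz
    exact ⟨y, hy, a, by rw [← h, ha]⟩
  have hp0 : ∀ y ∈ p, ℓ y = 0 := fun y hy => hℓ (by
    rw [Submodule.mem_comap, skewProjection_of_mem hEF (hpF hy)]
    exact hy)
  have hw0 : ℓ w ≠ 0 := by
    intro h
    refine hℓ0 (LinearMap.ext fun x => ?_)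
    obtain ⟨y, hy, a, hx⟩ := hdec x
    rw [hπ, hx, map_add, map_smul, h, hp0 y hy]
    simp
  refine ⟨ℓ, hE, fun j hj => ?_, fun x hx => ?_, hℓ0⟩
  · rw [hπ]
    exact hp0 _ ⟨_, Submodule.subset_span ⟨j, hj, rfl⟩, rfl⟩
  · obtain ⟨y, hy, a, h⟩ := hdec x
    rw [hπ, h, map_add, map_smul, hp0 y hy, zero_add, smul_eq_mul, mul_eq_zero] at hx
    obtain rfl := hx.resolve_right hw0
    obtain ⟨c, hc, rfl⟩ := hy
    refine ⟨c, hc, ?_⟩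
    rw [← skewProjection_eq_zero_iff hEF, map_sub, h, zero_smul, add_zero, sub_self]

/-- Walls which form a system of coordinates of the space `V`. -/
structure Frame (hEF : IsCompl E F) where
  /-- the dimension of `V` -/
  m : ℕ
  /-- the functionals defining the walls -/
  ℓ : Fin m → Module.Dual ℝ (Space N)
  /-- the directions of the walls -/
  J : Fin m → Finset (Fin N)
  wall : ∀ i, IsWall E (ℓ i) (J i)
  /-- the dual basis -/
  b : Fin m → Space N
  b_mem : ∀ i, b i ∈ contSpace hEF
  dual : ∀ i j, ℓ i (b j) = if i = j then 1 else 0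
  eq_sum : ∀ v ∈ contSpace hEF, v = ∑ i, ℓ i v • b i

theorem exists_dual_basis (hEF : IsCompl E F)
    (ℓ : Fin (Module.finrank ℝ (contSpace hEF)) → Module.Dual ℝ (Space N))
    (hℓ : ∀ w ∈ contSpace hEF, (∀ i, ℓ i w = 0) → w = 0) :
    ∃ b : Fin (Module.finrank ℝ (contSpace hEF)) → Space N, (∀ i, b i ∈ contSpace hEF) ∧
      (∀ i j, ℓ i (b j) = if i = j then 1 else 0) ∧
      ∀ v ∈ contSpace hEF, v = ∑ i, ℓ i v • b i := by
  let f : contSpace hEF →ₗ[ℝ] (Fin (Module.finrank ℝ (contSpace hEF)) → ℝ) :=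
    (LinearMap.pi ℓ).domRestrict _
  have hf : ∀ v i, f v i = ℓ i v := fun _ _ => rfl
  have hinj : Function.Injective f := by
    rw [injective_iff_map_eq_zero]
    intro v hv
    refine Subtype.ext (hℓ v v.2 fun i => ?_)
    rw [← hf, hv]
    rfl
  let e := LinearEquiv.ofInjectiveOfFinrankEq f hinj (by simp)
  have he : ∀ v, e v = f v := fun _ => rfl
  have hd : ∀ i j, ℓ i (e.symm (Pi.single j 1)) = if i = j then 1 else 0 := by
    intro i j
    rw [← hf, ← he, e.apply_symm_apply, Pi.single_apply]
  refine ⟨fun i => e.symm (Pi.single i 1), fun i => Subtype.coe_prop _, hd, fun v hv => ?_⟩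
  have h1 := hℓ (v - ∑ i, ℓ i v • (e.symm (Pi.single i 1) : Space N))
    ((contSpace hEF).sub_mem hv ((contSpace hEF).sum_mem fun i _ =>
      (contSpace hEF).smul_mem _ (Subtype.coe_prop _))) fun i => by
      rw [map_sub, map_sum]
      simp [hd]
  exact sub_eq_zero.1 h1

/-- The integer points as elements of the lattice. -/
def intVec : (Fin N → ℤ) →+ Space N where
  toFun n := WithLp.toLp 2 fun i => (n i : ℝ)
  map_zero' := by
    ext i
    simp
  map_add' a b := by
    ext i
    simp

theorem intVec_mem (n : Fin N → ℤ) : intVec n ∈ lattice N := fun i => ⟨n i, rfl⟩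

theorem exists_intVec {z : Space N} (hz : z ∈ lattice N) : ∃ n, intVec n = z := by
  choose n hn using hz
  exact ⟨n, by ext i; exact (hn i).symm⟩

namespace Frame

variable {hEF : IsCompl E F} (𝔉 : Frame hEF)

/-- The coordinate map `ℓ`. -/
def coord : Space N →ₗ[ℝ] (Fin 𝔉.m → ℝ) := LinearMap.pi 𝔉.ℓ

theorem coord_apply (x : Space N) (i : Fin 𝔉.m) : 𝔉.coord x i = 𝔉.ℓ i x := rfl

theorem coord_of_mem {e : Space N} (he : e ∈ E) : 𝔉.coord e = 0 :=
  funext fun i => (𝔉.wall i).vanish e he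

theorem coord_skewProjection (x : Space N) : 𝔉.coord (skewProjection hEF x) = 𝔉.coord x := by
  have := 𝔉.coord_of_mem (sub_skewProjection_mem hEF x)
  rw [map_sub, sub_eq_zero] at this
  exact this.symm

/-- The image `ℓ(Γ)`. -/
def coordGroup : AddSubgroup (Fin 𝔉.m → ℝ) := (translationGroup hEF).map 𝔉.coord.toAddMonoidHom

theorem mem_coordGroup {y : Fin 𝔉.m → ℝ} :
    y ∈ 𝔉.coordGroup ↔ ∃ γ ∈ translationGroup hEF, 𝔉.coord γ = y := Iff.rfl

/-- The direction `i` is free if the subgroup of `ℓᵢ(L)eᵢ` formed by the elements of `ℓ(Γ)` is not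
of finite index. -/
def IsFree (i : Fin 𝔉.m) : Prop :=
  ∃ g ∈ lattice N, ∀ k : ℕ, 0 < k → (Pi.single i (k * 𝔉.ℓ i g) : Fin 𝔉.m → ℝ) ∉ 𝔉.coordGroup

/-- Without freeness the quotient of `ℤ^N` by the vectors landing in `ℓ(Γ)` is a finitely generated
torsion group, hence finite, and its order is a uniform multiplier. -/
theorem exists_mul_mem {i : Fin 𝔉.m} (hi : ¬ 𝔉.IsFree i) : ∃ K : ℕ, 0 < K ∧ ∀ g ∈ lattice N,
    (Pi.single i (K * 𝔉.ℓ i g) : Fin 𝔉.m → ℝ) ∈ 𝔉.coordGroup := by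
  unfold IsFree at hi
  push Not at hi
  let Φ : (Fin N → ℤ) →+ (Fin 𝔉.m → ℝ) :=
    (AddMonoidHom.single (fun _ => ℝ) i).comp ((𝔉.ℓ i).toAddMonoidHom.comp intVec)
  have hΦ : ∀ n, Φ n = Pi.single i (𝔉.ℓ i (intVec n)) := fun _ => rfl
  let Q := (Fin N → ℤ) ⧸ 𝔉.coordGroup.comap Φ
  have htor : IsAddTorsion Q := by
    intro q
    obtain ⟨n, rfl⟩ := QuotientAddGroup.mk_surjective q
    obtain ⟨k, hk, h⟩ := hi (intVec n) (intVec_mem n)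
    rw [isOfFinAddOrder_iff_nsmul_eq_zero]
    refine ⟨k, hk, ?_⟩
    rw [← QuotientAddGroup.mk_nsmul, QuotientAddGroup.eq_zero_iff, AddSubgroup.mem_comap, hΦ,
      map_nsmul, map_nsmul, nsmul_eq_mul]
    exact h
  have : Finite Q := AddCommGroup.finite_of_fg_isAddTorsion Q htor
  refine ⟨Nat.card Q, Nat.card_pos, fun g hg => ?_⟩
  obtain ⟨n, rfl⟩ := exists_intVec hg
  have h1 : Nat.card Q • (QuotientAddGroup.mk n : Q) = 0 := card_nsmul_eq_zero'
  rw [← QuotientAddGroup.mk_nsmul, QuotientAddGroup.eq_zero_iff, AddSubgroup.mem_comap, hΦ,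
    map_nsmul, map_nsmul, nsmul_eq_mul] at h1
  exact h1

/-- The product of the multipliers of all directions kills the quotient, which is again finitely
generated. This is the finiteness that bounds the number of orbits of singular points. -/
theorem finite_quotient (h : ∀ i, ¬ 𝔉.IsFree i) :
    ∃ Φ : (Fin 𝔉.m → Fin N → ℤ) →+ (Fin 𝔉.m → ℝ), (∀ n i, Φ n i = 𝔉.ℓ i (intVec (n i))) ∧
      Finite ((Fin 𝔉.m → Fin N → ℤ) ⧸ 𝔉.coordGroup.comap Φ) := by
  let Φ : (Fin 𝔉.m → Fin N → ℤ) →+ (Fin 𝔉.m → ℝ) :=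
    AddMonoidHom.mk' (fun n i => 𝔉.ℓ i (intVec (n i))) fun a b => by
      funext i
      simp
  have hΦ : ∀ n i, Φ n i = 𝔉.ℓ i (intVec (n i)) := fun _ _ => rfl
  refine ⟨Φ, hΦ, ?_⟩
  choose K hK hKm using fun i => 𝔉.exists_mul_mem (h i)
  refine AddCommGroup.finite_of_fg_isAddTorsion _ fun q => ?_
  obtain ⟨n, rfl⟩ := QuotientAddGroup.mk_surjective q
  rw [isOfFinAddOrder_iff_nsmul_eq_zero]
  refine ⟨∏ i, K i, Finset.prod_pos fun i _ => hK i, ?_⟩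
  rw [← QuotientAddGroup.mk_nsmul, QuotientAddGroup.eq_zero_iff, AddSubgroup.mem_comap, map_nsmul]
  have h1 : Φ n = ∑ i, Pi.single i (𝔉.ℓ i (intVec (n i))) := by
    rw [Finset.univ_sum_single]
    rfl
  rw [h1, Finset.smul_sum]
  refine AddSubgroup.sum_mem _ fun i _ => ?_
  obtain ⟨c, hc⟩ := Finset.dvd_prod_of_mem K (Finset.mem_univ i)
  rw [hc, mul_comm, mul_smul]
  refine AddSubgroup.nsmul_mem _ ?_ _
  have := hKm i _ (intVec_mem (n i))
  rwa [← nsmul_eq_mul, Pi.single_smul] at this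

end Frame

theorem mem_hyperplane_of_eq_zero {hEF : IsCompl E F} {ℓ : Module.Dual ℝ (Space N)}
    {J : Finset (Fin N)} (hℓ : IsWall E ℓ J) {v w x : Space N}
    (hx : x ∈ {x | x ∈ contSpace hEF ∧ ∃ y ∈ coordSpace J, x = skewProjection hEF (y + v - u)})
    (hw : w ∈ contSpace hEF) (h0 : ℓ w = 0) :
    x + w ∈ {x | x ∈ contSpace hEF ∧ ∃ y ∈ coordSpace J, x = skewProjection hEF (y + v - u)} := by
  obtain ⟨hxV, y, hy, hxy⟩ := hx
  obtain ⟨y', hy', hwy⟩ := hℓ.ker w h0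
  refine ⟨(contSpace hEF).add_mem hxV hw, y + y', (coordSpace J).add_mem hy hy', ?_⟩
  rw [← skewProjection_eq_zero_iff hEF, map_sub,
    skewProjection_of_mem hEF (contSpace_le hEF hw), sub_eq_zero] at hwy
  rw [hxy, hwy, ← map_add]
  congr 1
  abel

theorem apply_of_mem_hyperplane {hEF : IsCompl E F} {ℓ : Module.Dual ℝ (Space N)}
    {J : Finset (Fin N)} (hℓ : IsWall E ℓ J) {v x : Space N}
    (hx : x ∈ {x | x ∈ contSpace hEF ∧ ∃ y ∈ coordSpace J, x = skewProjection hEF (y + v - u)}) :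
    ℓ x = ℓ v - ℓ u := by
  obtain ⟨-, y, hy, rfl⟩ := hx
  have h1 := hℓ.vanish _ (sub_skewProjection_mem hEF (y + v - u))
  rw [map_sub, sub_eq_zero] at h1
  have h2 : ℓ y = 0 := by
    rw [dual_eq_sum]
    refine Finset.sum_eq_zero fun j _ => ?_
    by_cases hj : j ∈ J
    · rw [hℓ.single j hj, mul_zero]
    · rw [coordSpace_apply_eq_zero hy hj, zero_mul]
  rw [← h1, map_sub, map_add, h2, zero_add]

/-- If the singular points do not form finitely many orbits, there is a frame with a free
direction. -/
theorem exists_frame (hEF : IsCompl E F) (hP : ¬ SingularPointsFinitelyGenerated hEF u) :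
    ∃ 𝔉 : Frame hEF, ∃ i, 𝔉.IsFree i := by
  by_contra! hcon
  refine hP ?_
  -- Singular points are sorted by the index sets of the walls that cut them out. There are finitely
  -- many choices, so one choice at a time suffices.
  let P : (Fin (Module.finrank ℝ (contSpace hEF)) → Finset (Fin N)) → Set (Space N) := fun J =>
    {x | ∃ W : Fin (Module.finrank ℝ (contSpace hEF)) → Set (Space N),
      (∀ i, J i ∈ hyperIndexV hEF ∧ ∃ v ∈ lattice N, W i =
        {x | x ∈ contSpace hEF ∧ ∃ y ∈ coordSpace (J i), x = skewProjection hEF (y + v - u)}) ∧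
      (contSpace hEF : Set (Space N)) ∩ ⋂ i, W i = {x}}
  have hPsub : ∀ J, P J ⊆ singularPoints hEF u := by
    rintro J x ⟨W, hW, hx⟩
    exact ⟨W, fun i => ⟨J i, (hW i).1, (hW i).2⟩, hx⟩
  have hfin : ∀ J, ∃ R : Set (Space N), R.Finite ∧ R ⊆ P J ∧
      ∀ x ∈ P J, ∃ y ∈ R, ∃ γ ∈ translationGroup hEF, x = y + skewProjection hEF γ := by
    intro J
    rcases (P J).eq_empty_or_nonempty with hemp | ⟨x₀, hx₀⟩
    · exact ⟨∅, Set.finite_empty, Set.empty_subset _, by simp [hemp]⟩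
    obtain ⟨W₀, hW₀, hWx₀⟩ := hx₀
    choose ℓ hℓ using fun i => exists_isWall hEF (hW₀ i).1.1.1
    -- A vector of `V` killed by all the functionals could be added to the intersection point
    -- without leaving any of the walls.
    have hinj : ∀ w ∈ contSpace hEF, (∀ i, ℓ i w = 0) → w = 0 := by
      intro w hw h0
      have hx₀m : x₀ ∈ (contSpace hEF : Set (Space N)) ∩ ⋂ i, W₀ i := hWx₀ ▸ rfl
      have h1 : x₀ + w ∈ (contSpace hEF : Set (Space N)) ∩ ⋂ i, W₀ i := by
        refine ⟨(contSpace hEF).add_mem hx₀m.1 hw, Set.mem_iInter.2 fun i => ?_⟩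
        obtain ⟨v, -, hv⟩ := (hW₀ i).2
        have h2 := Set.mem_iInter.1 hx₀m.2 i
        rw [hv] at h2 ⊢
        exact mem_hyperplane_of_eq_zero (hℓ i) h2 hw (h0 i)
      rw [hWx₀] at h1
      simpa using h1
    obtain ⟨b, hb, hdual, hsum⟩ := exists_dual_basis hEF ℓ hinj
    let 𝔉 : Frame hEF := ⟨_, ℓ, J, hℓ, b, hb, hdual, hsum⟩
    obtain ⟨Φ, hΦ, hfinite⟩ := 𝔉.finite_quotient (hcon 𝔉)
    -- The `i`-th coordinate of such a point lies in `ℓ i (ℤ^N) - ℓ i u`. Two points whose integer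
    -- data agree in the finite quotient differ by `Γ`.
    have hn : ∀ x : P J, ∃ n : Fin 𝔉.m → Fin N → ℤ, 𝔉.coord x = Φ n - 𝔉.coord u := by
      rintro ⟨x, W, hW, hx⟩
      have hxm : x ∈ (contSpace hEF : Set (Space N)) ∩ ⋂ i, W i := hx ▸ rfl
      choose v hv hWv using fun i => (hW i).2
      choose n hn using fun i => exists_intVec (hv i)
      refine ⟨n, funext fun i => ?_⟩
      rw [Pi.sub_apply, hΦ, hn]
      refine apply_of_mem_hyperplane (hEF := hEF) (hℓ i) ?_
      rw [← hWv]
      exact Set.mem_iInter.1 hxm.2 i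
    choose n hn using hn
    let f : P J → (Fin 𝔉.m → Fin N → ℤ) ⧸ 𝔉.coordGroup.comap Φ := fun x => (n x : _)
    refine ⟨Set.range fun c : Set.range f => ((c.2.choose : P J) : Space N), Set.finite_range _, ?_,
      ?_⟩
    · rintro _ ⟨c, rfl⟩
      exact Subtype.coe_prop _
    · intro x hx
      let c : Set.range f := ⟨f ⟨x, hx⟩, ⟨_, rfl⟩⟩
      have hc : f c.2.choose = f ⟨x, hx⟩ := c.2.choose_spec
      refine ⟨_, ⟨c, rfl⟩, ?_⟩
      have h1 := QuotientAddGroup.eq.1 hc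
      obtain ⟨γ, hγ, hγe⟩ := 𝔉.mem_coordGroup.1 h1
      refine ⟨γ, hγ, ?_⟩
      have hV : ∀ x ∈ P J, x ∈ contSpace hEF := by
        rintro x ⟨W, hW, hx⟩
        have hxm : x ∈ (contSpace hEF : Set (Space N)) ∩ ⋂ i, W i := hx ▸ rfl
        exact hxm.1
      have h2 := hinj (x - (c.2.choose + skewProjection hEF γ)) ((contSpace hEF).sub_mem (hV x hx)
        ((contSpace hEF).add_mem (hV _ (Subtype.coe_prop _)) ((mem_translationGroup hEF).1 hγ).2))
        fun i => by
          have h3 : 𝔉.coord (x - (c.2.choose + skewProjection hEF γ)) = 0 := by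
            rw [map_sub, map_add, 𝔉.coord_skewProjection, hγe, hn, hn ⟨x, hx⟩, map_add, map_neg]
            abel
          exact congrFun h3 i
      exact sub_eq_zero.1 h2
  choose R hR hRP hRx using hfin
  refine ⟨⋃ J, R J, Set.finite_iUnion hR, Set.iUnion_subset fun J => (hRP J).trans (hPsub J), ?_⟩
  rintro x ⟨W, hW, hx⟩
  choose J hJ v hv hWv using hW
  obtain ⟨y, hy, h⟩ := hRx J x ⟨W, fun i => ⟨hJ i, v i, hv i, hWv i⟩, hx⟩
  exact ⟨y, Set.mem_iUnion.2 ⟨J, hy⟩, h⟩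

end CanonicalProjection

namespace CanonicalProjection

variable {N : ℕ} {E F : Submodule ℝ (Space N)} {u : Space N}

/-! ### Proper coordinates on the lattice -/

/-- Lattice vectors with bounded image under `π'` have images in finitely many balls of the
isolating radius. Subtracting one lattice vector per ball leaves elements of `Γ`. -/
theorem BoxData.isProper_of_translationGroup {hEF : IsCompl E F} {d : ℕ} {θ : E →+ (Fin d → ℝ)}
    (h : ∀ C : ℝ, {γ | γ ∈ translationGroup hEF ∧ ‖skewProjection hEF γ‖ ≤ C ∧
      ∀ i, |θ (projE E γ) i| ≤ C}.Finite) : BoxData.IsProper hEF θ := by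
  intro C
  obtain ⟨r, hr, hrad⟩ := exists_contSpace_radius hEF
  let D : Set (Space N) := {z | z ∈ lattice N ∧ ‖skewProjection hEF z‖ ≤ C}
  have hD : TotallyBounded (skewProjection hEF '' D) := by
    refine (ProperSpace.isCompact_closedBall (0 : Space N) C).totallyBounded.subset ?_
    rintro _ ⟨z, hz, rfl⟩
    rw [mem_closedBall_zero_iff]
    exact hz.2
  obtain ⟨s, hsD, hsfin, ht⟩ := Set.exists_subset_image_finite_and.1
    (hD.exists_subset (Metric.dist_mem_uniformity hr))
  refine Set.Finite.subset (hsfin.biUnion fun z₀ _ => (h (2 * C + ∑ i, |θ (projE E z₀) i|)).image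
    fun γ => z₀ + γ) ?_
  rintro z ⟨hz, hzC, hzθ⟩
  have h1 := ht ⟨z, ⟨hz, hzC⟩, rfl⟩
  simp only [Set.mem_iUnion] at h1
  obtain ⟨_, ⟨z₀, hz₀, rfl⟩, h2⟩ := h1
  have h2' : ‖skewProjection hEF z - skewProjection hEF z₀‖ < r := by
    rw [← dist_eq_norm]
    exact h2
  refine Set.mem_biUnion hz₀ ⟨z - z₀, ⟨⟨(lattice N).sub_mem hz (hsD hz₀).1, ?_⟩, ?_, fun i => ?_⟩,
    by simp⟩
  · refine hrad _ ((lattice N).sub_mem hz (hsD hz₀).1) 0 (contSpace hEF).zero_mem ?_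
    rwa [sub_zero, map_sub]
  · have h3 : 0 ≤ ∑ i, |θ (projE E z₀) i| := Finset.sum_nonneg fun i _ => abs_nonneg _
    rw [map_sub]
    refine (norm_sub_le _ _).trans ?_
    linarith [(hsD hz₀).2]
  · have h3 : |θ (projE E z₀) i| ≤ ∑ i, |θ (projE E z₀) i| :=
      Finset.single_le_sum (f := fun i => |θ (projE E z₀) i|) (fun i _ => abs_nonneg _)
        (Finset.mem_univ i)
    have h4 : 0 ≤ C := (norm_nonneg _).trans hzC
    rw [map_sub, map_sub, Pi.sub_apply]
    refine (abs_sub _ _).trans ?_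
    linarith [hzθ i]

namespace Frame

variable {hEF : IsCompl E F} (𝔉 : Frame hEF)

theorem exists_coord_near (y : Fin 𝔉.m → ℝ) {ε : ℝ} (hε : 0 < ε) :
    ∃ γ ∈ translationGroup hEF, ∀ i, |𝔉.coord γ i - y i| < ε := by
  have hc : Continuous 𝔉.coord := LinearMap.continuous_of_finiteDimensional _
  set v := ∑ i, y i • 𝔉.b i with hv
  have hvV : v ∈ contSpace hEF :=
    (contSpace hEF).sum_mem fun i _ => (contSpace hEF).smul_mem _ (𝔉.b_mem i)
  have hvc : 𝔉.coord v = y := by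
    funext i
    simp [hv, coord_apply, 𝔉.dual]
  obtain ⟨δ, hδ, h⟩ := Metric.continuousAt_iff.1 hc.continuousAt ε hε
  obtain ⟨γ, hγ, hγv⟩ := exists_translationGroup_near hEF hvV hδ
  refine ⟨γ, hγ, fun i => ?_⟩
  have h1 := h (by rwa [dist_eq_norm] : dist (skewProjection hEF γ) v < δ)
  rw [hvc, 𝔉.coord_skewProjection] at h1
  exact (dist_pi_lt_iff hε).1 h1 i

open Classical in
/-- The free directions. -/
def free : Finset (Fin 𝔉.m) := Finset.univ.filter 𝔉.IsFree

theorem mem_free {i : Fin 𝔉.m} : i ∈ 𝔉.free ↔ 𝔉.IsFree i := by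
  simp [free]

/-- The elements of `Γ` whose coordinates in `A` vanish. -/
def vanishing (A : Finset (Fin 𝔉.m)) : AddSubgroup (Space N) where
  carrier := {γ | γ ∈ translationGroup hEF ∧ ∀ i ∈ A, 𝔉.coord γ i = 0}
  zero_mem' := ⟨zero_mem _, by simp⟩
  add_mem' ha hb := ⟨add_mem ha.1 hb.1, fun i hi => by simp [ha.2 i hi, hb.2 i hi]⟩
  neg_mem' ha := ⟨neg_mem ha.1, fun i hi => by simp [ha.2 i hi]⟩

/-- Multiples of the non-free components of `ℓ(γ)` lie in `ℓ(Γ)` one by one, so a multiple of `γ`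
splits. Up to bounded multiples, `ℓ(Γ)` is the direct sum of its free and its non-free part. -/
theorem exists_split : ∃ K : ℕ, 0 < K ∧ ∀ γ ∈ translationGroup hEF,
    ∃ α ∈ 𝔉.vanishing 𝔉.free, ∃ β ∈ 𝔉.vanishing 𝔉.freeᶜ, K • γ = α + β := by
  choose! K hK hKm using fun i (hi : ¬ 𝔉.IsFree i) => 𝔉.exists_mul_mem hi
  refine ⟨∏ i ∈ 𝔉.freeᶜ, K i, Finset.prod_pos fun i hi => hK i ?_, fun γ hγ => ?_⟩
  · rwa [Finset.mem_compl, mem_free] at hi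
  set P := ∏ i ∈ 𝔉.freeᶜ, K i with hP
  have h1 : ∑ i ∈ 𝔉.freeᶜ, (Pi.single i (P * 𝔉.ℓ i γ) : Fin 𝔉.m → ℝ) ∈ 𝔉.coordGroup := by
    refine AddSubgroup.sum_mem _ fun i hi => ?_
    obtain ⟨c, hc⟩ := Finset.dvd_prod_of_mem K hi
    have h2 : (Pi.single i (P * 𝔉.ℓ i γ) : Fin 𝔉.m → ℝ) = c • Pi.single i (K i * 𝔉.ℓ i γ) := by
      rw [← Pi.single_smul, nsmul_eq_mul, hP, hc]
      push_cast
      ring_nf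
    rw [h2]
    refine AddSubgroup.nsmul_mem _ (hKm i ?_ γ hγ.1) c
    rwa [Finset.mem_compl, mem_free] at hi
  obtain ⟨α, hα, hαe⟩ := 𝔉.mem_coordGroup.1 h1
  have h3 : ∀ j, 𝔉.coord α j = if j ∈ 𝔉.free then 0 else P * 𝔉.ℓ j γ := by
    intro j
    rw [hαe, Finset.sum_apply]
    simp only [Pi.single_apply, Finset.sum_ite_eq, Finset.mem_compl, ite_not]
  refine ⟨α, ⟨hα, fun i hi => ?_⟩, P • γ - α, ⟨sub_mem (nsmul_mem hγ _) hα, fun i hi => ?_⟩, by simp⟩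
  · rw [h3, if_pos hi]
  · rw [map_sub, Pi.sub_apply, h3, if_neg (Finset.mem_compl.1 hi), map_nsmul, Pi.smul_apply,
      nsmul_eq_mul, coord_apply, sub_self]

/-- The elements of `Γ` with vanishing coordinates in the free directions, or in the other ones, are
dense in the corresponding coordinate subspaces. -/
theorem exists_vanishing_near {A : Finset (Fin 𝔉.m)} (hA : A = 𝔉.free ∨ A = 𝔉.freeᶜ)
    (y : Fin 𝔉.m → ℝ) (hy : ∀ i ∈ A, y i = 0) {ε : ℝ} (hε : 0 < ε) :
    ∃ γ ∈ 𝔉.vanishing A, ∀ i, |𝔉.coord γ i - y i| < ε := by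
  obtain ⟨K, hK, hsplit⟩ := 𝔉.exists_split
  have hK' : (0 : ℝ) < K := by exact_mod_cast hK
  -- Approximating `y / K` compensates for the multiplication by `K` in the splitting.
  obtain ⟨γ, hγ, hγy⟩ := 𝔉.exists_coord_near (fun i => y i / K) (div_pos hε hK')
  obtain ⟨α, hα, β, hβ, h⟩ := hsplit γ hγ
  have h1 : ∀ i, 𝔉.coord α i + 𝔉.coord β i = K * 𝔉.coord γ i := by
    intro i
    have := congrArg (fun x => 𝔉.coord x i) h
    simp only [map_add, Pi.add_apply, map_nsmul, Pi.smul_apply, nsmul_eq_mul] at this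
    exact this.symm
  have h2 : ∀ i, |K * 𝔉.coord γ i - y i| < ε := by
    intro i
    have h3 : K * 𝔉.coord γ i - y i = K * (𝔉.coord γ i - y i / K) := by
      field_simp
    rw [h3, abs_mul, abs_of_pos hK']
    have := hγy i
    rw [lt_div_iff₀ hK'] at this
    linarith
  rcases hA with rfl | rfl
  · refine ⟨α, hα, fun i => ?_⟩
    by_cases hi : i ∈ 𝔉.free
    · rw [hα.2 i hi, hy i hi]
      simpa using hε
    · have := h1 i
      rw [hβ.2 i (Finset.mem_compl.2 hi), add_zero] at this
      rw [this]
      exact h2 i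
  · refine ⟨β, hβ, fun i => ?_⟩
    by_cases hi : i ∈ 𝔉.free
    · have := h1 i
      rw [hα.2 i hi, zero_add] at this
      rw [this]
      exact h2 i
    · rw [hβ.2 i (Finset.mem_compl.2 hi), hy i (Finset.mem_compl.2 hi)]
      simpa using hε

theorem sub_sum_mem {x : Space N} (hx : skewProjection hEF x ∈ contSpace hEF) :
    x - ∑ i, 𝔉.coord x i • 𝔉.b i ∈ E := by
  have h1 := 𝔉.eq_sum _ hx
  have h2 : ∑ i, 𝔉.ℓ i (skewProjection hEF x) • 𝔉.b i = ∑ i, 𝔉.coord x i • 𝔉.b i :=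
    Finset.sum_congr rfl fun i _ => by
      rw [← coord_apply, coord_skewProjection]
  rw [← h2, ← h1]
  exact sub_skewProjection_mem hEF x

theorem mem_of_coord_eq_zero {x : Space N} (hx : skewProjection hEF x ∈ contSpace hEF)
    (h : 𝔉.coord x = 0) : x ∈ E := by
  have := 𝔉.sub_sum_mem hx
  simpa [h] using this

end Frame

end CanonicalProjection

/-! ### Integral coordinates adapted to the free directions -/

namespace CanonicalProjection

variable {N : ℕ} {E F : Submodule ℝ (Space N)} {u : Space N}

namespace Frame

variable {hEF : IsCompl E F} (𝔉 : Frame hEF)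

/-- A system of small elements of `Γ`, adapted to the free directions, whose coordinate vectors
are linearly independent. -/
theorem exists_small_basis {δ : ℝ} (hδ : 0 < δ) :
    ∃ (f : Fin 𝔉.m → Space N) (φ : Space N →ₗ[ℝ] (Fin 𝔉.m → ℝ)),
      (∀ j ∈ 𝔉.free, f j ∈ 𝔉.vanishing 𝔉.freeᶜ) ∧ (∀ j ∉ 𝔉.free, f j ∈ 𝔉.vanishing 𝔉.free) ∧
      (∀ w i, ∑ j, φ w j * 𝔉.coord (f j) i = 𝔉.coord w i) ∧
      (∀ c : Fin 𝔉.m → ℝ, (∀ i, ∑ j, c j * 𝔉.coord (f j) i = 0) → c = 0) ∧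
      ∀ i, ∑ j, |𝔉.coord (f j) i| < δ := by
  classical
  set δ' := δ / 2 with hδ'
  -- The vectors approximate `δ'` times the standard basis. This `ε` makes the coordinate matrix
  -- strictly diagonally dominant, hence invertible, and keeps its absolute row sums below `2 * δ' =
  -- δ`.
  set ε := δ' / (2 * (𝔉.m + 1)) with hε
  have hδ'0 : 0 < δ' := by positivity
  have hε0 : 0 < ε := by positivity
  have hmε : 𝔉.m * ε < δ' - ε := by
    have : 2 * (𝔉.m + 1) * ε = δ' := by
      rw [hε]
      field_simp
    nlinarith
  have hf : ∀ j, ∃ f : Space N, (j ∈ 𝔉.free → f ∈ 𝔉.vanishing 𝔉.freeᶜ) ∧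
      (j ∉ 𝔉.free → f ∈ 𝔉.vanishing 𝔉.free) ∧
      ∀ i, |𝔉.coord f i - (Pi.single j δ' : Fin 𝔉.m → ℝ) i| < ε := by
    intro j
    by_cases hj : j ∈ 𝔉.free
    · obtain ⟨f, hf, h⟩ := 𝔉.exists_vanishing_near (Or.inr rfl) (Pi.single j δ') (fun i hi =>
        Pi.single_eq_of_ne (by rintro rfl; exact Finset.mem_compl.1 hi hj) _) hε0
      exact ⟨f, fun _ => hf, fun h => absurd hj h, h⟩
    · obtain ⟨f, hf, h⟩ := 𝔉.exists_vanishing_near (Or.inl rfl) (Pi.single j δ') (fun i hi =>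
        Pi.single_eq_of_ne (by rintro rfl; exact hj hi) _) hε0
      exact ⟨f, fun h => absurd h hj, fun _ => hf, h⟩
  choose f hfa hfb hfn using hf
  let M : Matrix (Fin 𝔉.m) (Fin 𝔉.m) ℝ := Matrix.of fun i j => 𝔉.coord (f j) i
  have hoff : ∀ i j, i ≠ j → |𝔉.coord (f j) i| < ε := by
    intro i j hij
    have := hfn j i
    rwa [Pi.single_eq_of_ne hij, sub_zero] at this
  have hdiag : ∀ j, |𝔉.coord (f j) j - δ'| < ε := by
    intro j
    have := hfn j j
    rwa [Pi.single_eq_same] at this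
  have hrow : ∀ i, ∑ j ∈ Finset.univ.erase i, |𝔉.coord (f j) i| ≤ 𝔉.m * ε := by
    intro i
    refine (Finset.sum_le_card_nsmul _ _ ε fun j hj =>
      (hoff i j (Finset.ne_of_mem_erase hj).symm).le).trans ?_
    rw [nsmul_eq_mul]
    refine mul_le_mul_of_nonneg_right ?_ hε0.le
    have := Finset.card_erase_le (s := (Finset.univ : Finset (Fin 𝔉.m))) (a := i)
    rw [Finset.card_univ, Fintype.card_fin] at this
    exact_mod_cast this
  have hdet : M.det ≠ 0 := by
    refine det_ne_zero_of_sum_row_lt_diag fun i => ?_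
    have h1 : ∑ j ∈ Finset.univ.erase i, ‖M i j‖ ≤ 𝔉.m * ε := hrow i
    have h2 : δ' - ε < ‖M i i‖ := by
      change δ' - ε < |𝔉.coord (f i) i|
      have := abs_lt.1 (hdiag i)
      exact lt_of_lt_of_le (by linarith) (le_abs_self _)
    linarith
  have hunit : IsUnit M.det := isUnit_iff_ne_zero.2 hdet
  have hM : ∀ (c : Fin 𝔉.m → ℝ) i, ∑ j, c j * 𝔉.coord (f j) i = (M.mulVec c) i := by
    intro c i
    rw [Matrix.mulVec, dotProduct]
    exact Finset.sum_congr rfl fun j _ => mul_comm _ _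
  refine ⟨f, (Matrix.toLin' M⁻¹).comp 𝔉.coord, fun j => hfa j, fun j => hfb j, fun w i => ?_,
    fun c hc => ?_, fun i => ?_⟩
  · rw [hM, LinearMap.comp_apply, Matrix.toLin'_apply, Matrix.mulVec_mulVec,
      Matrix.mul_nonsing_inv _ hunit, Matrix.one_mulVec]
  · have h0 : M.mulVec c = 0 := funext fun i => by
      rw [← hM, hc i]
      rfl
    have := congrArg (M⁻¹.mulVec) h0
    rwa [Matrix.mulVec_mulVec, Matrix.nonsing_inv_mul _ hunit, Matrix.one_mulVec,
      Matrix.mulVec_zero] at this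
  · rw [← Finset.add_sum_erase _ _ (Finset.mem_univ i)]
    have h1 := hrow i
    have h2 : |𝔉.coord (f i) i| < δ' + ε := by
      have := abs_lt.1 (hdiag i)
      rw [abs_lt]
      constructor <;> linarith
    linarith

/-- Coordinates on `Γ` with integral values, split according to the free directions, together
with a system of small representatives. -/
structure Splitting (d : ℕ) (δ : ℝ) where
  /-- the coordinates belonging to the elements of `Γ` without free components -/
  I : Finset (Fin d)
  /-- the coordinates -/
  θ : E →+ (Fin d → ℝ)
  /-- the representatives -/
  z : (Fin d → ℤ) → Space N
  isProper : BoxData.IsProper hEF θ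
  z_mem : ∀ μ, z μ ∈ translationGroup hEF
  θ_z : ∀ μ i, θ (projE E (z μ)) i = μ i
  z_small : ∀ μ i, |𝔉.coord (z μ) i| < δ
  z_free : ∀ μ, (∀ i ∉ I, μ i = 0) → ∀ i ∈ 𝔉.free, 𝔉.coord (z μ) i = 0
  eq_of_coord_eq : ∀ μ ν, (∀ i ∈ 𝔉.free, 𝔉.coord (z μ) i = 𝔉.coord (z ν) i) →
    ∀ i ∉ I, μ i = ν i

/-- A maximal independent family from the image of the elements of `Γ` without free components is
extended by images of elements of `Γ`. The latter span `E` because `Γ` spans the preimage of `V`.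
The set `I` indexes the first family. -/
theorem exists_basis (κ : Space N →ₗ[ℝ] E) (hκ : ∀ e : E, κ e = e) :
    ∃ (I : Finset (Fin (Module.finrank ℝ E))) (B : Module.Basis (Fin (Module.finrank ℝ E)) ℝ E)
      (g : Fin (Module.finrank ℝ E) → Space N), (∀ i, κ (g i) = B i) ∧
      (∀ i, g i ∈ translationGroup hEF) ∧ (∀ i ∈ I, g i ∈ 𝔉.vanishing 𝔉.free) ∧
      ∀ γ ∈ 𝔉.vanishing 𝔉.free, ∀ i ∉ I, B.repr (κ γ) i = 0 := by
  classical
  let s : Set E := κ '' (𝔉.vanishing 𝔉.free : Set (Space N))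
  let t : Set E := κ '' (translationGroup hEF : Set (Space N))
  have hst : s ⊆ t := Set.image_mono fun γ hγ => hγ.1
  have h0 : LinearIndepOn ℝ id (∅ : Set E) := linearIndepOn_empty ℝ id
  let A := h0.extend (Set.empty_subset s)
  have hA : LinearIndepOn ℝ id A := h0.linearIndepOn_extend _
  have hAs : A ⊆ s := h0.extend_subset _
  have hsA : s ⊆ Submodule.span ℝ A := h0.subset_span_extend _
  let B := hA.extend (hAs.trans hst)
  have hB : LinearIndepOn ℝ id B := hA.linearIndepOn_extend _
  have hBt : B ⊆ t := hA.extend_subset _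
  have htB : t ⊆ Submodule.span ℝ B := hA.subset_span_extend _
  have hAB : A ⊆ B := hA.subset_extend _
  have hspan : ⊤ ≤ Submodule.span ℝ (Set.range fun x : B => (x : E)) := by
    rw [Subtype.range_coe]
    intro e _
    have h1 : (e : Space N) ∈ Submodule.span ℝ (translationGroup hEF : Set (Space N)) := by
      rw [span_translationGroup hEF, Submodule.mem_comap,
        (skewProjection_eq_zero_iff hEF).2 e.2]
      exact zero_mem _
    have h2 := Submodule.mem_map_of_mem (f := κ) h1
    rw [Submodule.map_span, hκ] at h2
    exact Submodule.span_le.2 htB h2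
  let b₀ : Module.Basis B ℝ E := Module.Basis.mk hB hspan
  have hb₀ : ∀ x, b₀ x = x := fun x => Module.Basis.mk_apply _ _ _
  have : Finite B := Module.Finite.finite_basis b₀
  have : Fintype B := Fintype.ofFinite B
  let e : B ≃ Fin (Module.finrank ℝ E) :=
    Fintype.equivFinOfCardEq (Module.finrank_eq_card_basis b₀).symm
  have hg : ∀ x : B, ∃ g : Space N, κ g = x ∧ g ∈ translationGroup hEF ∧
      ((x : E) ∈ A → g ∈ 𝔉.vanishing 𝔉.free) := by
    intro x
    by_cases hx : (x : E) ∈ A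
    · obtain ⟨g, hg, h⟩ := hAs hx
      exact ⟨g, h, hg.1, fun _ => hg⟩
    · obtain ⟨g, hg, h⟩ := hBt x.2
      exact ⟨g, h, hg, fun h => absurd h hx⟩
  choose g hg1 hg2 hg3 using hg
  refine ⟨Finset.univ.filter fun i => ((e.symm i : B) : E) ∈ A, b₀.reindex e, fun i => g (e.symm i),
    fun i => ?_, fun i => hg2 _, fun i hi => hg3 _ (Finset.mem_filter.1 hi).2, fun γ hγ i hi => ?_⟩
  · rw [hg1, Module.Basis.reindex_apply, hb₀]
  · rw [Module.Basis.repr_reindex_apply]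
    have h1 : κ γ ∈ Submodule.span ℝ (b₀ '' {x : B | (x : E) ∈ A}) := by
      have h2 : b₀ '' {x : B | (x : E) ∈ A} = A := by
        ext x
        constructor
        · rintro ⟨y, hy, rfl⟩
          rw [hb₀]
          exact hy
        · intro hx
          exact ⟨⟨x, hAB hx⟩, hx, hb₀ _⟩
      rw [h2]
      exact hsA ⟨γ, hγ, rfl⟩
    by_contra hne
    refine hi (Finset.mem_filter.2 ⟨Finset.mem_univ _, ?_⟩)
    exact b₀.repr_support_subset_of_mem_span _ h1 (Finsupp.mem_support_iff.2 hne)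

/-- `Γ` embeds into `E` and `ℝ^d` is divisible, hence injective as an abelian group. The extension
is merely additive, which is enough for Heaviside functions on displacement vectors. -/
theorem exists_extension {d : ℕ} (ψ : Space N →ₗ[ℝ] (Fin d → ℝ)) :
    ∃ θ : E →+ (Fin d → ℝ), ∀ γ ∈ translationGroup hEF, θ (projE E γ) = ψ γ := by
  let f : translationGroup hEF →+ E := (projE E).toAddMonoidHom.comp (translationGroup hEF).subtype
  have hf : Function.Injective f := by
    rw [injective_iff_map_eq_zero]
    intro γ hγ
    refine Subtype.ext (eq_zero_of_mem_translationGroup hEF γ.2 ?_)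
    rw [← coe_projE]
    exact congrArg Subtype.val hγ
  let g : translationGroup hEF →+ (Fin d → ℝ) :=
    ψ.toAddMonoidHom.comp (translationGroup hEF).subtype
  obtain ⟨θ, hθ⟩ := (Module.Baer.of_divisible (Fin d → ℝ)).extension_property_addMonoidHom f hf g
  exact ⟨θ, fun γ hγ => DFunLike.congr_fun hθ ⟨γ, hγ⟩⟩

/-- `κ` projects the preimage of `V` onto `E` along the small vectors `f j`, and on `Γ` the
coordinates `θ` are those of `κ` in the basis `B`. -/
theorem exists_splitting {d : ℕ} (hd : Module.finrank ℝ E = d) {δ : ℝ} (hδ : 0 < δ) :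
    Nonempty (𝔉.Splitting d δ) := by
  subst hd
  obtain ⟨f, φ, hfa, hfb, hφ, hinj, hsmall⟩ := 𝔉.exists_small_basis hδ
  have hfΓ : ∀ j, f j ∈ translationGroup hEF := by
    intro j
    by_cases hj : j ∈ 𝔉.free
    · exact (hfa j hj).1
    · exact (hfb j hj).1
  let W : Submodule ℝ (Space N) := (contSpace hEF).comap (skewProjection hEF)
  let κ₀ : Space N →ₗ[ℝ] Space N :=
    LinearMap.id - ∑ j, (LinearMap.toSpanSingleton ℝ _ (f j)).comp ((LinearMap.proj j).comp φ)
  have hκ₀ : ∀ w, κ₀ w = w - ∑ j, φ w j • f j := by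
    intro w
    simp [κ₀]
  have hcoordκ : ∀ w, 𝔉.coord (κ₀ w) = 0 := by
    intro w
    funext i
    rw [hκ₀, map_sub, map_sum, Pi.sub_apply, Finset.sum_apply, Pi.zero_apply, sub_eq_zero, ← hφ]
    simp
  have hκE : ∀ w ∈ W, κ₀ w ∈ E := by
    intro w hw
    refine 𝔉.mem_of_coord_eq_zero ?_ (hcoordκ w)
    rw [hκ₀, map_sub, map_sum]
    refine sub_mem hw (sum_mem fun j _ => ?_)
    rw [map_smul]
    exact (contSpace hEF).smul_mem _ (hfΓ j).2
  have hφ0 : ∀ w, 𝔉.coord w = 0 → φ w = 0 := by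
    intro w hw
    refine hinj _ fun i => ?_
    rw [hφ, hw]
    rfl
  have hκid : ∀ e ∈ E, κ₀ e = e := by
    intro e he
    rw [hκ₀, hφ0 e (𝔉.coord_of_mem he)]
    simp
  let κ : Space N →ₗ[ℝ] E := (projE E).comp κ₀
  have hκ : ∀ e : E, κ e = e := by
    intro e
    change projE E (κ₀ e) = e
    rw [hκid e e.2, projE_coe]
  have hκc : ∀ w ∈ W, (κ w : Space N) = κ₀ w := by
    intro w hw
    change (projE E (κ₀ w) : Space N) = κ₀ w
    rw [coe_projE]
    exact Submodule.starProjection_eq_self_iff.2 (hκE w hw)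
  obtain ⟨I, B, g, hgB, hgΓ, hgI, hI⟩ := 𝔉.exists_basis κ hκ
  let ψ : Space N →ₗ[ℝ] (Fin (Module.finrank ℝ E) → ℝ) := B.equivFun.toLinearMap.comp κ
  have hψ : ∀ w i, ψ w i = B.repr (κ w) i := fun _ _ => rfl
  obtain ⟨θ, hθ⟩ := exists_extension (hEF := hEF) ψ
  have hφf : ∀ j, φ (f j) = Pi.single j 1 := by
    intro j
    rw [← sub_eq_zero]
    refine hinj _ fun i => ?_
    simp only [Pi.sub_apply, sub_mul, Finset.sum_sub_distrib, hφ]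
    simp [Pi.single_apply]
  have hκf : ∀ j, κ₀ (f j) = 0 := by
    intro j
    rw [hκ₀, hφf]
    simp [Pi.single_apply]
  let y : (Fin (Module.finrank ℝ E) → ℤ) → Space N := fun μ => ∑ i, μ i • g i
  -- Subtracting integer multiples of the `f j`, which `κ` kills, does not affect `θ`. What remains
  -- in `V` is a combination of the `f j` with fractional parts as coefficients, hence small.
  let z : (Fin (Module.finrank ℝ E) → ℤ) → Space N := fun μ => y μ - ∑ j, ⌊φ (y μ) j⌋ • f j
  have hyΓ : ∀ μ, y μ ∈ translationGroup hEF := fun μ =>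
    sum_mem fun i _ => zsmul_mem (hgΓ i) _
  have hzΓ : ∀ μ, z μ ∈ translationGroup hEF := fun μ =>
    sub_mem (hyΓ μ) (sum_mem fun j _ => zsmul_mem (hfΓ j) _)
  have hψz : ∀ μ i, ψ (z μ) i = μ i := by
    intro μ i
    have h1 : κ (z μ) = ∑ i, (μ i : ℝ) • B i := by
      change projE E (κ₀ (z μ)) = _
      have h2 : κ₀ (z μ) = κ₀ (y μ) := by
        simp only [z, map_sub, map_sum, map_zsmul, hκf, smul_zero, Finset.sum_const_zero, sub_zero]
      rw [h2]
      change κ (y μ) = _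
      simp only [y, map_sum, map_zsmul, hgB, Int.cast_smul_eq_zsmul]
    rw [hψ, h1, ← Module.Basis.equivFun_apply, ← B.equivFun_symm_apply, LinearEquiv.apply_symm_apply]
  have hcz : ∀ μ i, 𝔉.coord (z μ) i = ∑ j, Int.fract (φ (y μ) j) * 𝔉.coord (f j) i := by
    intro μ i
    simp only [z, map_sub, map_sum, map_zsmul, Pi.sub_apply, Finset.sum_apply, Pi.smul_apply]
    rw [← hφ, ← Finset.sum_sub_distrib]
    refine Finset.sum_congr rfl fun j _ => ?_
    rw [zsmul_eq_mul, ← sub_mul]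
    rfl
  -- The `f j` respect the division into free and non-free coordinates, so vanishing free
  -- coordinates force vanishing coefficients at the free `f j`.
  have hφfree : ∀ w, (∀ i ∈ 𝔉.free, 𝔉.coord w i = 0) → ∀ j ∈ 𝔉.free, φ w j = 0 := by
    intro w hw j hj
    have h1 := hinj (fun j => if j ∈ 𝔉.free then φ w j else 0) fun i => by
      by_cases hi : i ∈ 𝔉.free
      · rw [← hw i hi, ← hφ]
        refine Finset.sum_congr rfl fun j _ => ?_
        by_cases hj : j ∈ 𝔉.free
        · rw [if_pos hj]
        · rw [(hfb j hj).2 i hi, mul_zero, mul_zero]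
      · refine Finset.sum_eq_zero fun j _ => ?_
        by_cases hj : j ∈ 𝔉.free
        · rw [(hfa j hj).2 i (Finset.mem_compl.2 hi), mul_zero]
        · rw [if_neg hj, zero_mul]
    have := congrFun h1 j
    simpa [hj] using this
  refine ⟨⟨I, θ, z, ?_, hzΓ, fun μ i => by rw [hθ _ (hzΓ μ), hψz], fun μ i => ?_, fun μ hμ i hi => ?_,
    fun μ ν hμν i hi => ?_⟩⟩
  · refine BoxData.isProper_of_translationGroup fun C => ?_
    let Ψ : W →ₗ[ℝ] (Fin (Module.finrank ℝ E) → ℝ) × (Fin 𝔉.m → ℝ) :=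
      (ψ.prod 𝔉.coord).domRestrict W
    -- `θ` on `E` together with the coordinates on `V` determine a vector over `V`. A linear
    -- injection has bounded preimages of bounded sets, and bounded sets contain finitely many
    -- lattice points.
    have hΨ : Function.Injective Ψ := by
      rw [injective_iff_map_eq_zero]
      intro w hw
      have h1 : ψ w = 0 := congrArg Prod.fst hw
      have h2 : 𝔉.coord w = 0 := congrArg Prod.snd hw
      have h3 : κ w = 0 := B.equivFun.map_eq_zero_iff.1 h1
      have h4 := hκc w w.2
      rw [h3, hκ₀, hφ0 _ h2] at h4
      refine Subtype.ext ?_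
      simpa using h4.symm
    obtain ⟨K, -, hK⟩ := Ψ.exists_antilipschitzWith (LinearMap.ker_eq_bot.2 hΨ)
    have hc : Continuous 𝔉.coord := LinearMap.continuous_of_finiteDimensional _
    obtain ⟨D, hD⟩ := ((ProperSpace.isCompact_closedBall (0 : Space N) C).image hc).isBounded.exists_norm_le
    have hbd := hK.isBounded_preimage (Metric.isBounded_closedBall
      (x := (0 : (Fin (Module.finrank ℝ E) → ℝ) × (Fin 𝔉.m → ℝ))) (r := max C D))
    have hbd' : Bornology.IsBounded (Subtype.val '' (Ψ ⁻¹' Metric.closedBall 0 (max C D))) :=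
      LipschitzWith.isBounded_image (K := 1) (LipschitzWith.subtype_val _) hbd
    refine (finite_lattice_of_isBounded hbd').subset ?_
    rintro γ ⟨hγ, hγC, hγθ⟩
    refine ⟨⟨⟨γ, hγ.2⟩, ?_, rfl⟩, hγ.1⟩
    rw [Set.mem_preimage, mem_closedBall_zero_iff]
    refine max_le_max ?_ ?_
    · refine (pi_norm_le_iff_of_nonneg ((norm_nonneg _).trans hγC)).2 fun i => ?_
      have := hγθ i
      rw [hθ γ hγ] at this
      exact this
    · have := hD _ ⟨skewProjection hEF γ, mem_closedBall_zero_iff.2 hγC, rfl⟩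
      rw [𝔉.coord_skewProjection] at this
      exact this
  · rw [hcz]
    refine lt_of_le_of_lt ((Finset.abs_sum_le_sum_abs _ _).trans (Finset.sum_le_sum fun j _ => ?_))
      (hsmall i)
    rw [abs_mul, Int.abs_fract]
    exact mul_le_of_le_one_left (abs_nonneg _) (Int.fract_lt_one _).le
  · rw [hcz]
    have h1 : ∀ i ∈ 𝔉.free, 𝔉.coord (y μ) i = 0 := by
      intro i hi
      have : y μ ∈ 𝔉.vanishing 𝔉.free := by
        refine sum_mem fun j _ => ?_
        by_cases hj : j ∈ I
        · exact zsmul_mem (hgI j hj) _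
        · rw [hμ j hj, zero_smul]
          exact zero_mem _
      exact this.2 i hi
    refine Finset.sum_eq_zero fun j _ => ?_
    by_cases hj : j ∈ 𝔉.free
    · rw [hφfree _ h1 j hj, Int.fract_zero, zero_mul]
    · rw [(hfb j hj).2 i hi, mul_zero]
  · have h1 : z μ - z ν ∈ 𝔉.vanishing 𝔉.free := by
      refine ⟨sub_mem (hzΓ μ) (hzΓ ν), fun i hi => ?_⟩
      rw [map_sub, Pi.sub_apply, hμν i hi, sub_self]
    have h2 := hI _ h1 i hi
    rw [← hψ, map_sub, Pi.sub_apply, hψz, hψz, sub_eq_zero] at h2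
    exact_mod_cast h2

end Frame

end CanonicalProjection

namespace CanonicalProjection

variable {N : ℕ} {E F : Submodule ℝ (Space N)} {u : Space N}

namespace Frame

variable {hEF : IsCompl E F} (𝔉 : Frame hEF)

/-! ### Boxes in general position -/

/-- The vectors which agree in the free directions with an element of `ℓ(Γ)`. -/
def freeGroup : AddSubgroup (Fin 𝔉.m → ℝ) where
  carrier := {y | ∃ γ ∈ translationGroup hEF, ∀ i ∈ 𝔉.free, 𝔉.coord γ i = y i}
  zero_mem' := ⟨0, zero_mem _, by simp⟩
  add_mem' := by
    rintro a b ⟨γ, hγ, h⟩ ⟨γ', hγ', h'⟩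
    exact ⟨γ + γ', add_mem hγ hγ', fun i hi => by simp [h i hi, h' i hi]⟩
  neg_mem' := by
    rintro a ⟨γ, hγ, h⟩
    exact ⟨-γ, neg_mem hγ, fun i hi => by simp [h i hi]⟩

/-- An element of `Γ` that has the right free coordinates only can be multiplied by the splitting
constant and stripped of its non-free part, so freeness survives when non-free coordinates are
ignored. -/
theorem exists_notMem_freeGroup {i : Fin 𝔉.m} (hi : i ∈ 𝔉.free) : ∃ g ∈ lattice N,
    ∀ k : ℕ, 0 < k → (Pi.single i (k * 𝔉.ℓ i g) : Fin 𝔉.m → ℝ) ∉ 𝔉.freeGroup := by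
  obtain ⟨g, hg, h⟩ := 𝔉.mem_free.1 hi
  refine ⟨g, hg, fun k hk hmem => ?_⟩
  obtain ⟨γ, hγ, hγe⟩ := hmem
  obtain ⟨K, hK, hsplit⟩ := 𝔉.exists_split
  obtain ⟨α, hα, β, hβ, hαβ⟩ := hsplit γ hγ
  refine h (K * k) (Nat.mul_pos hK hk) ⟨β, hβ.1, funext fun j => ?_⟩
  change 𝔉.coord β j = _
  by_cases hj : j ∈ 𝔉.free
  · have h1 := congrArg (fun x => 𝔉.coord x j) hαβ
    simp only [map_add, Pi.add_apply, map_nsmul, Pi.smul_apply, nsmul_eq_mul] at h1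
    rw [hα.2 j hj, zero_add, hγe j hj] at h1
    rw [← h1]
    by_cases hji : j = i
    · subst hji
      rw [Pi.single_eq_same, Pi.single_eq_same]
      push_cast
      ring
    · rw [Pi.single_eq_of_ne hji, Pi.single_eq_of_ne hji, mul_zero]
  · rw [hβ.2 j (Finset.mem_compl.2 hj), Pi.single_eq_of_ne]
    rintro rfl
    exact hj hi

/-- A short `γ` serves unless one of its multiples falls into the group. In that case the remainder
of `g` modulo `γ` is short, and its multiples avoid the group because those of `g` do. -/
theorem exists_small_notMem_freeGroup {i : Fin 𝔉.m} (hi : i ∈ 𝔉.free) {ε : ℝ} (hε : 0 < ε) :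
    ∃ s ∈ lattice N, 0 < 𝔉.ℓ i s ∧ 𝔉.ℓ i s < ε ∧
      ∀ k : ℕ, 0 < k → (Pi.single i (k * 𝔉.ℓ i s) : Fin 𝔉.m → ℝ) ∉ 𝔉.freeGroup := by
  obtain ⟨γ, hγ, hγe⟩ := 𝔉.exists_coord_near (fun _ => ε / 2) (half_pos hε)
  have h1 := abs_lt.1 (hγe i)
  rw [coord_apply] at h1
  have h0 : 0 < 𝔉.ℓ i γ := by linarith
  by_cases hq : ∀ k : ℕ, 0 < k → (Pi.single i (k * 𝔉.ℓ i γ) : Fin 𝔉.m → ℝ) ∉ 𝔉.freeGroup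
  · exact ⟨γ, hγ.1, h0, by linarith, hq⟩
  push Not at hq
  obtain ⟨q, hq0, hq⟩ := hq
  obtain ⟨g, hg, hgk⟩ := 𝔉.exists_notMem_freeGroup hi
  set n := ⌊𝔉.ℓ i g / 𝔉.ℓ i γ⌋
  have hs : 𝔉.ℓ i (g - n • γ) = 𝔉.ℓ i g - n * 𝔉.ℓ i γ := by
    rw [map_sub, map_zsmul, zsmul_eq_mul]
  have h2 : n * 𝔉.ℓ i γ ≤ 𝔉.ℓ i g := by
    rw [← le_div_iff₀ h0]
    exact Int.floor_le _
  have h3 : 𝔉.ℓ i g < (n + 1) * 𝔉.ℓ i γ := by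
    rw [← div_lt_iff₀ h0]
    exact Int.lt_floor_add_one _
  have hinf : ∀ k : ℕ, 0 < k →
      (Pi.single i (k * 𝔉.ℓ i (g - n • γ)) : Fin 𝔉.m → ℝ) ∉ 𝔉.freeGroup := by
    intro k hk hmem
    refine hgk (q * k) (Nat.mul_pos hq0 hk) ?_
    have h4 : (Pi.single i (((q * k : ℕ) : ℝ) * 𝔉.ℓ i g) : Fin 𝔉.m → ℝ) =
        q • Pi.single i (k * 𝔉.ℓ i (g - n • γ)) + (k * n) • Pi.single i (q * 𝔉.ℓ i γ) := by
      rw [← Pi.single_smul, ← Pi.single_smul, ← Pi.single_add, hs]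
      congr 1
      simp only [nsmul_eq_mul, zsmul_eq_mul]
      push_cast
      ring
    rw [h4]
    exact add_mem (nsmul_mem hmem _) (zsmul_mem hq _)
  refine ⟨g - n • γ, (lattice N).sub_mem hg ((lattice N).zsmul_mem hγ.1 _), ?_, by linarith, hinf⟩
  refine lt_of_le_of_ne (by linarith) fun h => hinf 1 one_pos ?_
  rw [← h, mul_zero, Pi.single_zero]
  exact zero_mem _

/-- Pigeonhole on the first `X.card + 1` multiples of a short vector: if two of them were congruent
to the same `x`, their difference would be a positive multiple lying in the group. -/
theorem exists_avoiding {i : Fin 𝔉.m} (hi : i ∈ 𝔉.free) {ε : ℝ} (hε : 0 < ε)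
    (X : Finset (Fin 𝔉.m → ℝ)) : ∃ c ∈ lattice N, 0 < 𝔉.ℓ i c ∧ 𝔉.ℓ i c < ε ∧
      ∀ x ∈ X, (Pi.single i (𝔉.ℓ i c) - x : Fin 𝔉.m → ℝ) ∉ 𝔉.freeGroup := by
  obtain ⟨s, hs, hs0, hsε, hsk⟩ := 𝔉.exists_small_notMem_freeGroup hi
    (ε := ε / (X.card + 1)) (by positivity)
  rw [lt_div_iff₀ (by positivity)] at hsε
  by_contra! hcon
  have h1 : ∀ k ∈ Finset.Icc 1 (X.card + 1), ∃ x ∈ X,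
      (Pi.single i (k * 𝔉.ℓ i s) - x : Fin 𝔉.m → ℝ) ∈ 𝔉.freeGroup := by
    intro k hk
    rw [Finset.mem_Icc] at hk
    have h2 : 𝔉.ℓ i (k • s) = k * 𝔉.ℓ i s := by
      rw [map_nsmul, nsmul_eq_mul]
    have hk1 : (1 : ℝ) ≤ k := by exact_mod_cast hk.1
    have hk2 : (k : ℝ) ≤ X.card + 1 := by exact_mod_cast hk.2
    have h3 := hcon (k • s) (nsmul_mem hs k) (by rw [h2]; positivity) (by rw [h2]; nlinarith)
    rwa [h2] at h3
  choose! x hx hxm using h1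
  obtain ⟨k, hk, k', hk', hne, hxx⟩ := Finset.exists_ne_map_eq_of_card_lt_of_maps_to
    (s := Finset.Icc 1 (X.card + 1)) (t := X) (by simp) hx
  wlog hlt : k < k' generalizing k k'
  · exact this k' hk' k hk hne.symm hxx.symm (by omega)
  refine hsk (k' - k) (by omega) ?_
  have h4 := sub_mem (hxm k' hk') (hxm k hk)
  rw [hxx, sub_sub_sub_cancel_right, ← Pi.single_sub, ← sub_mul] at h4
  rwa [Nat.cast_sub hlt.le]

/-- Side lengths of a box in the free directions, such that no difference between the lower corner
and another vertex is realised by `Γ` in the free coordinates. -/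
theorem exists_heights {r : ℝ} (hr : 0 < r) : ∃ h : Fin 𝔉.m → Space N,
    (∀ i ∈ 𝔉.free, h i ∈ lattice N ∧ 0 < 𝔉.ℓ i (h i) ∧ 𝔉.ℓ i (h i) < r) ∧
    ∀ A ⊆ 𝔉.free, A.Nonempty →
      ∑ i ∈ A, (Pi.single i (𝔉.ℓ i (h i)) : Fin 𝔉.m → ℝ) ∉ 𝔉.freeGroup := by
  classical
  have key : ∀ A' : Finset (Fin 𝔉.m), A' ⊆ 𝔉.free → ∃ h : Fin 𝔉.m → Space N,
      (∀ i ∈ A', h i ∈ lattice N ∧ 0 < 𝔉.ℓ i (h i) ∧ 𝔉.ℓ i (h i) < r) ∧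
      ∀ A ⊆ A', A.Nonempty →
        ∑ i ∈ A, (Pi.single i (𝔉.ℓ i (h i)) : Fin 𝔉.m → ℝ) ∉ 𝔉.freeGroup := by
    intro A'
    induction A' using Finset.induction_on with
    | empty =>
      intro _
      refine ⟨fun _ => 0, by simp, fun A hA hne => ?_⟩
      exact absurd (Finset.subset_empty.1 hA) hne.ne_empty
    | insert a A' ha ih =>
      intro hsub
      obtain ⟨h, hh, hA⟩ := ih ((Finset.subset_insert _ _).trans hsub)
      obtain ⟨c, hc, hc0, hcr, hcX⟩ := 𝔉.exists_avoiding (hsub (Finset.mem_insert_self _ _)) hr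
        (A'.powerset.image fun A => -∑ i ∈ A, (Pi.single i (𝔉.ℓ i (h i)) : Fin 𝔉.m → ℝ))
      have hne : ∀ i ∈ A', i ≠ a := fun i hi h => ha (h ▸ hi)
      have hsum : ∀ A ⊆ A', ∑ i ∈ A, (Pi.single i (𝔉.ℓ i (Function.update h a c i)) :
          Fin 𝔉.m → ℝ) = ∑ i ∈ A, (Pi.single i (𝔉.ℓ i (h i)) : Fin 𝔉.m → ℝ) := by
        intro A hAA
        refine Finset.sum_congr rfl fun i hi => ?_
        rw [Function.update_of_ne (hne i (hAA hi))]
      refine ⟨Function.update h a c, fun i hi => ?_, fun A hAs hAne => ?_⟩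
      · rcases Finset.mem_insert.1 hi with rfl | hi
        · rw [Function.update_self]
          exact ⟨hc, hc0, hcr⟩
        · rw [Function.update_of_ne (hne i hi)]
          exact hh i hi
      · by_cases haA : a ∈ A
        · have hAe : A.erase a ⊆ A' := by
            rw [← Finset.erase_insert ha]
            exact Finset.erase_subset_erase _ hAs
          rw [← Finset.add_sum_erase _ _ haA, hsum _ hAe, Function.update_self]
          have := hcX _ (Finset.mem_image_of_mem _ (Finset.mem_powerset.2 hAe))
          rwa [sub_neg_eq_add] at this
        · have hAe : A ⊆ A' := (Finset.subset_insert_iff_of_notMem haA).1 hAs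
          rw [hsum _ hAe]
          exact hA A hAe hAne
  exact key _ subset_rfl

/-- Shifts along one free direction, chosen one after the other, that keep the lower corner of each
box inequivalent to all vertices of the earlier boxes. -/
theorem exists_corners {r : ℝ} (hr : 0 < r) {i₀ : Fin 𝔉.m} (hi₀ : i₀ ∈ 𝔉.free)
    (h : Fin 𝔉.m → Space N) : ∃ c : ℕ → Space N,
      (∀ n, c n ∈ lattice N ∧ 0 < 𝔉.ℓ i₀ (c n) ∧ 𝔉.ℓ i₀ (c n) < r) ∧
      ∀ j n, j < n → ∀ A ⊆ 𝔉.free, (Pi.single i₀ (𝔉.ℓ i₀ (c n)) - (Pi.single i₀ (𝔉.ℓ i₀ (c j)) +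
        ∑ i ∈ A, Pi.single i (𝔉.ℓ i (h i))) : Fin 𝔉.m → ℝ) ∉ 𝔉.freeGroup := by
  classical
  obtain ⟨c, hc, hcr⟩ := exists_seq_of_forall_finset_exists
    (fun c : Space N => c ∈ lattice N ∧ 0 < 𝔉.ℓ i₀ c ∧ 𝔉.ℓ i₀ c < r)
    (fun c c' => ∀ A ⊆ 𝔉.free, (Pi.single i₀ (𝔉.ℓ i₀ c') - (Pi.single i₀ (𝔉.ℓ i₀ c) +
        ∑ i ∈ A, Pi.single i (𝔉.ℓ i (h i))) : Fin 𝔉.m → ℝ) ∉ 𝔉.freeGroup) fun s _ => by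
      let f : Space N × Finset (Fin 𝔉.m) → (Fin 𝔉.m → ℝ) := fun q =>
        Pi.single i₀ (𝔉.ℓ i₀ q.1) + ∑ i ∈ q.2, Pi.single i (𝔉.ℓ i (h i))
      obtain ⟨c, hc, hc0, hcr, hX⟩ := 𝔉.exists_avoiding hi₀ hr ((s ×ˢ 𝔉.free.powerset).image f)
      refine ⟨c, ⟨hc, hc0, hcr⟩, fun x hx A hA => ?_⟩
      have h1 : (x, A) ∈ s ×ˢ 𝔉.free.powerset :=
        Finset.mem_product.2 ⟨hx, Finset.mem_powerset.2 hA⟩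
      exact hX (f (x, A)) (Finset.mem_image_of_mem f h1)
  exact ⟨c, hc, hcr⟩

/-- Reducing `u` modulo the lattice gives a point of the strip, which is interior since `u` is
non-singular. The factor `5` leaves room both for the boxes and for the test points around their
corners. -/
theorem exists_base (hu : u ∈ nonSingular E) : ∃ o : Space N, o - u ∈ lattice N ∧ ∃ r : ℝ, 0 < r ∧
    ∀ x, skewProjection hEF (x - o) ∈ contSpace hEF → (∀ i, |𝔉.coord (x - o) i| < 5 * r) →
      x ∈ strip E := by
  set o := u - latticeFloor u with ho
  have hou : o - u ∈ lattice N := by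
    have : o - u = -latticeFloor u := by
      rw [ho]
      abel
    rw [this]
    exact neg_mem (latticeFloor_mem u)
  have hos : o ∈ strip E := mem_strip_iff.2 ⟨o, sub_latticeFloor_mem u, by simp⟩
  have hoi : o ∈ interior (strip E) := by
    by_contra hcon
    refine hu _ hou ?_
    rw [sub_add_cancel]
    exact ⟨subset_closure hos, hcon⟩
  obtain ⟨ρ, hρ, hball⟩ := Metric.isOpen_iff.1 isOpen_interior o hoi
  set D := 1 + ∑ i, ‖𝔉.b i‖
  have hD0 : 0 < D := by positivity
  refine ⟨o, hou, ρ / (5 * D), by positivity, fun x hx hc => ?_⟩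
  have h1 := 𝔉.sub_sum_mem hx
  set w := ∑ i, 𝔉.coord (x - o) i • 𝔉.b i
  have h2 : ‖w‖ < ρ := by
    have h3 : ‖w‖ ≤ ∑ i, ρ / D * ‖𝔉.b i‖ := by
      refine (norm_sum_le _ _).trans (Finset.sum_le_sum fun i _ => ?_)
      rw [norm_smul]
      refine mul_le_mul_of_nonneg_right ?_ (norm_nonneg _)
      have := (hc i).le
      have h4 : 5 * (ρ / (5 * D)) = ρ / D := by field_simp
      rwa [h4] at this
    rw [← Finset.mul_sum] at h3
    have h5 : ∑ i, ‖𝔉.b i‖ < D := by linarith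
    calc ‖w‖ ≤ _ := h3
      _ < ρ / D * D := mul_lt_mul_of_pos_left h5 (by positivity)
      _ = ρ := by field_simp
  have h3 : o + w ∈ strip E := interior_subset (hball (by simpa using h2))
  have h4 : x = (o + w) + (x - o - w) := by abel
  rw [h4, add_mem_strip_iff h1]
  exact h3

/-- A sequence of boxes over the same base point, with vertices in general position. -/
structure BoxSequence (u : Space N) where
  /-- the base point -/
  o : Space N
  o_mem : o - u ∈ lattice N
  /-- the size -/
  r : ℝ
  r_pos : 0 < r
  mem_strip : ∀ x, skewProjection hEF (x - o) ∈ contSpace hEF →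
    (∀ i, |𝔉.coord (x - o) i| < 5 * r) → x ∈ strip E
  /-- the boxes -/
  B : ℕ → BoxData hEF u
  /-- the lower walls -/
  lo : ℕ → Fin 𝔉.m → ℝ
  /-- the upper walls -/
  hi : ℕ → Fin 𝔉.m → ℝ
  mem_set : ∀ n x, x ∈ (B n).set ↔ x - u ∈ lattice N ∧ skewProjection hEF (x - o) ∈ contSpace hEF ∧
    ∀ i, lo n i < 𝔉.coord (x - o) i ∧ 𝔉.coord (x - o) i < hi n i
  abs_lo : ∀ n, ∀ i ∈ 𝔉.free, |lo n i| < 2 * r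
  lo_lt_hi : ∀ n, ∀ i ∈ 𝔉.free, lo n i < hi n i
  lo_lt : ∀ n, ∀ i ∉ 𝔉.free, lo n i < -r
  lt_hi : ∀ n, ∀ i ∉ 𝔉.free, r < hi n i
  own : ∀ n, ∀ γ ∈ translationGroup hEF, (∀ i ∈ 𝔉.free, lo n i + 𝔉.coord γ i = lo n i ∨
    lo n i + 𝔉.coord γ i = hi n i) → ∀ i ∈ 𝔉.free, 𝔉.coord γ i = 0
  earlier : ∀ j n, j < n → ∀ γ ∈ translationGroup hEF, ¬ ∀ i ∈ 𝔉.free,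
    lo n i + 𝔉.coord γ i = lo j i ∨ lo n i + 𝔉.coord γ i = hi j i

end Frame

end CanonicalProjection

namespace CanonicalProjection

variable {N : ℕ} {E F : Submodule ℝ (Space N)} {u : Space N}

namespace Frame

variable {hEF : IsCompl E F} (𝔉 : Frame hEF)

theorem exists_boxSequence (hu : u ∈ nonSingular E) (hfree : ∃ i, 𝔉.IsFree i) :
    Nonempty (𝔉.BoxSequence u) := by
  classical
  obtain ⟨i₀, hi₀⟩ := hfree
  rw [← mem_free] at hi₀
  obtain ⟨o, hou, r, hr, hstrip⟩ := 𝔉.exists_base hu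
  obtain ⟨h, hh, hhA⟩ := 𝔉.exists_heights hr
  obtain ⟨c, hc, hcA⟩ := 𝔉.exists_corners hr hi₀ h
  obtain ⟨γ₀, hγ₀, hγ₀o⟩ := 𝔉.exists_coord_near (𝔉.coord o) hr
  -- In the non-free directions all boxes share the same walls, at about `-3r/2` and `3r/2` from
  -- `o`, with `|·| < r` in between.
  obtain ⟨γ₁, hγ₁, hγ₁o⟩ := 𝔉.exists_coord_near (fun i => 𝔉.coord o i - 3 * r / 2) (half_pos hr)
  obtain ⟨γ₂, hγ₂, hγ₂o⟩ := 𝔉.exists_coord_near (fun i => 𝔉.coord o i + 3 * r / 2) (half_pos hr)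
  let a : ℕ → Fin 𝔉.m → Space N := fun n i =>
    if i ∈ 𝔉.free then γ₀ + (if i = i₀ then c n else 0) else γ₁
  let b : ℕ → Fin 𝔉.m → Space N := fun n i => if i ∈ 𝔉.free then a n i + h i else γ₂
  have haL : ∀ n i, a n i ∈ lattice N := by
    intro n i
    simp only [a]
    split_ifs
    · exact add_mem hγ₀.1 (hc n).1
    · simpa using hγ₀.1
    · exact hγ₁.1
  have hbL : ∀ n i, b n i ∈ lattice N := by
    intro n i
    simp only [b]
    split_ifs with hi
    · exact add_mem (haL n i) (hh i hi).1
    · exact hγ₂.1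
  let lo : ℕ → Fin 𝔉.m → ℝ := fun n i => 𝔉.ℓ i (a n i) - 𝔉.coord o i
  let hi : ℕ → Fin 𝔉.m → ℝ := fun n i => 𝔉.ℓ i (b n i) - 𝔉.coord o i
  have hlo : ∀ n, ∀ i ∈ 𝔉.free, lo n i =
      (𝔉.coord γ₀ i - 𝔉.coord o i) + (Pi.single i₀ (𝔉.ℓ i₀ (c n)) : Fin 𝔉.m → ℝ) i := by
    intro n i hi
    simp only [lo, a, if_pos hi, map_add]
    by_cases hii : i = i₀
    · subst hii
      rw [if_pos rfl, Pi.single_eq_same, coord_apply, coord_apply]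
      ring
    · rw [if_neg hii, Pi.single_eq_of_ne hii, map_zero, coord_apply, coord_apply]
      ring
  have hhi : ∀ n, ∀ i ∈ 𝔉.free, hi n i = lo n i + 𝔉.ℓ i (h i) := by
    intro n i hif
    simp only [hi, b, lo, if_pos hif, map_add]
    ring
  have hlo1 : ∀ n, ∀ i ∈ 𝔉.free, -r < lo n i ∧ lo n i < 2 * r := by
    intro n i hif
    have h1 := abs_lt.1 (hγ₀o i)
    rw [hlo n i hif]
    by_cases hii : i = i₀
    · subst hii
      rw [Pi.single_eq_same]
      have h2 := (hc n).2
      constructor <;> linarith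
    · rw [Pi.single_eq_of_ne hii]
      constructor <;> linarith
  have hlo2 : ∀ n, ∀ i ∉ 𝔉.free, -(2 * r) < lo n i ∧ lo n i < -r := by
    intro n i hif
    have h1 := abs_lt.1 (hγ₁o i)
    simp only [lo, a, if_neg hif]
    rw [← coord_apply]
    constructor <;> linarith
  have hhi2 : ∀ n, ∀ i ∉ 𝔉.free, r < hi n i ∧ hi n i < 2 * r := by
    intro n i hif
    have h1 := abs_lt.1 (hγ₂o i)
    simp only [hi, b, if_neg hif]
    rw [← coord_apply]
    constructor <;> linarith
  have hmem : ∀ n x, x ∈ latticeBox hEF u o 𝔉.ℓ (a n) (b n) ↔ x - u ∈ lattice N ∧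
      skewProjection hEF (x - o) ∈ contSpace hEF ∧
      ∀ i, lo n i < 𝔉.coord (x - o) i ∧ 𝔉.coord (x - o) i < hi n i := by
    intro n x
    refine and_congr Iff.rfl (and_congr Iff.rfl (forall_congr' fun i => ?_))
    rw [map_sub, Pi.sub_apply, coord_apply]
    simp only [lo, hi]
    rw [sub_lt_sub_iff_right, sub_lt_sub_iff_right]
  have hsub : ∀ n, ∀ x ∈ latticeBox hEF u o 𝔉.ℓ (a n) (b n), x ∈ strip E := by
    intro n x hx
    obtain ⟨-, h2, h3⟩ := (hmem n x).1 hx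
    refine hstrip x h2 fun i => abs_lt.2 ?_
    obtain ⟨h4, h5⟩ := h3 i
    by_cases hif : i ∈ 𝔉.free
    · have h6 := hlo1 n i hif
      have h7 := hhi n i hif
      have h8 := (hh i hif).2
      constructor <;> linarith
    · have h6 := hlo2 n i hif
      have h7 := hhi2 n i hif
      constructor <;> linarith
  refine ⟨⟨o, hou, r, hr, hstrip, fun n => ⟨o, hou, Fin 𝔉.m, 𝔉.ℓ, 𝔉.J, 𝔉.wall, a n, haL n, b n,
    hbL n, hsub n⟩, lo, hi, hmem, fun n i hif => abs_lt.2 ?_, fun n i hif => ?_,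
    fun n i hif => (hlo2 n i hif).2, fun n i hif => (hhi2 n i hif).1, fun n γ hγ hv => ?_,
    fun j n hjn γ hγ hv => ?_⟩⟩
  · have := hlo1 n i hif
    constructor <;> linarith
  · rw [hhi n i hif]
    linarith [(hh i hif).2]
  -- In each direction of `A` the vector `γ` must equal the height of the box, so the sum of these
  -- heights lies in `freeGroup` unless `A` is empty.
  · let A := 𝔉.free.filter fun i => 𝔉.coord γ i ≠ 0
    by_cases hA : A.Nonempty
    · refine absurd ?_ (hhA A (Finset.filter_subset _ _) hA)
      refine ⟨γ, hγ, fun i hif => ?_⟩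
      rw [Finset.sum_apply]
      simp only [Pi.single_apply, Finset.sum_ite_eq]
      rcases hv i hif with h1 | h1
      · have h2 : 𝔉.coord γ i = 0 := by linarith
        rw [if_neg (by simp [A, h2]), h2]
      · rw [hhi n i hif] at h1
        have h2 : 𝔉.coord γ i = 𝔉.ℓ i (h i) := by linarith
        rw [if_pos, h2]
        refine Finset.mem_filter.2 ⟨hif, ?_⟩
        rw [h2]
        exact (hh i hif).2.1.ne'
    · intro i hif
      by_contra hne
      exact hA ⟨i, Finset.mem_filter.2 ⟨hif, hne⟩⟩
  · let A := 𝔉.free.filter fun i => lo n i + 𝔉.coord γ i ≠ lo j i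
    refine hcA j n hjn A (Finset.filter_subset _ _) ⟨-γ, neg_mem hγ, fun i hif => ?_⟩
    rw [map_neg, Pi.neg_apply, Pi.sub_apply, Pi.add_apply, Finset.sum_apply]
    have h3 := hlo n i hif
    have h4 := hlo j i hif
    have h5 : (∑ k ∈ A, (Pi.single k (𝔉.ℓ k (h k)) : Fin 𝔉.m → ℝ) i) =
        if i ∈ A then 𝔉.ℓ i (h i) else 0 := by
      simp only [Pi.single_apply, Finset.sum_ite_eq]
    rw [h5]
    by_cases h1 : lo n i + 𝔉.coord γ i = lo j i
    · rw [if_neg (by simp [A, h1])]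
      linarith
    · rw [if_pos (Finset.mem_filter.2 ⟨hif, h1⟩)]
      have h2 := (hv i hif).resolve_left h1
      rw [hhi j i hif] at h2
      linarith

/-! ### Germs of lattice points at a vertex -/

/-- The order in which the directions are perturbed: the free directions come last. -/
def rank (i : Fin 𝔉.m) : ℕ := if i ∈ 𝔉.free then 𝔉.m + i else i

theorem rank_injective : Function.Injective 𝔉.rank := by
  intro i j h
  unfold rank at h
  have := i.2
  have := j.2
  split_ifs at h <;> exact Fin.ext (by omega)

theorem rank_lt (i : Fin 𝔉.m) : 𝔉.rank i < 2 * 𝔉.m := by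
  unfold rank
  have := i.2
  split_ifs <;> omega

theorem rank_lt_rank {i k : Fin 𝔉.m} (hi : i ∉ 𝔉.free) (hk : k ∈ 𝔉.free) :
    𝔉.rank i < 𝔉.rank k := by
  have := i.2
  simp only [rank, if_neg hi, if_pos hk]
  omega

/-- The leading index of a linear form. -/
def IsPivot (ν : Fin 𝔉.m → ℝ) (k : Fin 𝔉.m) : Prop :=
  ν k ≠ 0 ∧ ∀ i, 𝔉.rank i < 𝔉.rank k → ν i = 0

theorem exists_isPivot {ν : Fin 𝔉.m → ℝ} (h : ν ≠ 0) : ∃ k, 𝔉.IsPivot ν k := by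
  obtain ⟨i, hi⟩ := Function.ne_iff.1 h
  obtain ⟨k, hk, hmin⟩ := Finset.exists_min_image (Finset.univ.filter fun i => ν i ≠ 0) 𝔉.rank
    ⟨i, by simpa using hi⟩
  refine ⟨k, by simpa using hk, fun j hj => ?_⟩
  by_contra hne
  exact absurd (hmin j (by simpa using hne)) (not_le.2 hj)

/-- A family of sequences of elements of `Γ` with coordinates tending to `p`, such that the sign of
a linear form along a sequence is determined by its leading coefficient. -/
structure Germ (p : Fin 𝔉.m → ℝ) where
  /-- the sequences; the finite set is the set of the negative directions -/
  γ : ℕ → Finset (Fin 𝔉.m) → Space N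
  mem : ∀ n A, γ n A ∈ translationGroup hEF
  tendsto : ∀ A i, Tendsto (fun n => 𝔉.coord (γ n A) i) atTop (𝓝 (p i))
  pos : ∀ A ν k, 𝔉.IsPivot ν k → ∀ᶠ n in atTop,
    0 < (ν k * if k ∈ A then -1 else 1) * ∑ i, ν i * (𝔉.coord (γ n A) i - p i)

/-- Direction `i` is displaced by `± ε ^ (rank i + 1)`, so a linear form is dominated by its nonzero
coefficient of lowest rank. The error allowed when approximating by `Γ`, `ε ^ (2m + 1)`, is smaller
than every displacement since ranks are below `2m`. -/
theorem nonempty_germ (p : Fin 𝔉.m → ℝ) : Nonempty (𝔉.Germ p) := by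
  classical
  let ε : ℕ → ℝ := fun n => 1 / ((n : ℝ) + 1)
  have hε0 : ∀ n, 0 < ε n := fun n => by positivity
  have hε1 : ∀ n, ε n ≤ 1 := fun n => by
    simp only [ε]
    rw [div_le_one (by positivity)]
    linarith [(n.cast_nonneg : (0 : ℝ) ≤ n)]
  have hεt : Tendsto ε atTop (𝓝 0) := tendsto_one_div_add_atTop_nhds_zero_nat
  let σ : Finset (Fin 𝔉.m) → Fin 𝔉.m → ℝ := fun A i => if i ∈ A then -1 else 1
  have hσ : ∀ A i, |σ A i| = 1 := fun A i => by
    simp only [σ]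
    split_ifs <;> simp
  have hσ2 : ∀ A i, σ A i * σ A i = 1 := fun A i => by
    simp only [σ]
    split_ifs <;> simp
  choose γ hγ hγn using fun n A => 𝔉.exists_coord_near
    (fun i => p i + σ A i * ε n ^ (𝔉.rank i + 1)) (pow_pos (hε0 n) (2 * 𝔉.m + 1))
  have hsmall : ∀ n A i, ∀ j ≤ 2 * 𝔉.m + 1,
      |𝔉.coord (γ n A) i - p i - σ A i * ε n ^ (𝔉.rank i + 1)| ≤ ε n ^ j := by
    intro n A i j hj
    rw [sub_sub]
    exact (hγn n A i).le.trans (pow_le_pow_of_le_one (hε0 n).le (hε1 n) hj)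
  refine ⟨⟨γ, hγ, fun A i => ?_, fun A ν k hk => ?_⟩⟩
  · have h1 : ∀ n, |𝔉.coord (γ n A) i - p i| ≤ 2 * ε n := by
      intro n
      have h2 := hsmall n A i 1 (by omega)
      have h3 : |σ A i * ε n ^ (𝔉.rank i + 1)| ≤ ε n := by
        rw [abs_mul, hσ, one_mul, abs_of_pos (pow_pos (hε0 n) _)]
        exact pow_le_of_le_one (hε0 n).le (hε1 n) (by omega)
      rw [pow_one] at h2
      have := abs_add_le (𝔉.coord (γ n A) i - p i - σ A i * ε n ^ (𝔉.rank i + 1))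
        (σ A i * ε n ^ (𝔉.rank i + 1))
      rw [sub_add_cancel] at this
      linarith
    rw [tendsto_iff_dist_tendsto_zero]
    refine squeeze_zero (fun _ => dist_nonneg) h1 ?_
    simpa using hεt.const_mul 2
  · set D := ∑ i, |ν i| with hD
    have hk0 : 0 < |ν k| := abs_pos.2 hk.1
    have hev : ∀ᶠ n in atTop, 2 * D * ε n < |ν k| := by
      have : Tendsto (fun n => 2 * D * ε n) atTop (𝓝 0) := by simpa using hεt.const_mul (2 * D)
      exact this.eventually_lt_const hk0
    filter_upwards [hev] with n hn
    change 0 < (ν k * σ A k) * ∑ i, ν i * (𝔉.coord (γ n A) i - p i)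
    set w : Fin 𝔉.m → ℝ := fun i => 𝔉.coord (γ n A) i - p i
    set t := ε n ^ (𝔉.rank k + 1) with ht
    have ht0 : 0 < t := pow_pos (hε0 n) _
    have hrk := 𝔉.rank_lt k
    have h1 : ∀ i, |ν i * (w i - if i = k then σ A k * t else 0)| ≤ |ν i| * (2 * (ε n * t)) := by
      intro i
      rw [abs_mul]
      by_cases hik : i = k
      · subst hik
        rw [if_pos rfl]
        refine mul_le_mul_of_nonneg_left ?_ (abs_nonneg _)
        have h2 := hsmall n A i (𝔉.rank i + 2) (by omega)
        have h3 : ε n ^ (𝔉.rank i + 2) = ε n * t := by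
          rw [ht]
          ring
        rw [h3] at h2
        have h4 : 0 < ε n * t := mul_pos (hε0 n) ht0
        exact h2.trans (by linarith)
      · rcases lt_trichotomy (𝔉.rank i) (𝔉.rank k) with hlt | heq | hgt
        · rw [hk.2 i hlt]
          simp
        · exact absurd (𝔉.rank_injective heq) hik
        · rw [if_neg hik, sub_zero]
          refine mul_le_mul_of_nonneg_left ?_ (abs_nonneg _)
          have h3 : ε n ^ (𝔉.rank k + 2) = ε n * t := by
            rw [ht]
            ring
          have h2 := hsmall n A i (𝔉.rank k + 2) (by omega)
          have h4 : |σ A i * ε n ^ (𝔉.rank i + 1)| ≤ ε n ^ (𝔉.rank k + 2) := by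
            rw [abs_mul, hσ, one_mul, abs_of_pos (pow_pos (hε0 n) _)]
            exact pow_le_pow_of_le_one (hε0 n).le (hε1 n) (by omega)
          have := abs_add_le (𝔉.coord (γ n A) i - p i - σ A i * ε n ^ (𝔉.rank i + 1))
            (σ A i * ε n ^ (𝔉.rank i + 1))
          rw [sub_add_cancel] at this
          rw [h3] at h2 h4
          change |𝔉.coord (γ n A) i - p i| ≤ _
          linarith
    have h5 : |∑ i, ν i * w i - ν k * (σ A k * t)| ≤ D * (2 * (ε n * t)) := by
      have h6 : ∑ i, ν i * w i - ν k * (σ A k * t) =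
          ∑ i, ν i * (w i - if i = k then σ A k * t else 0) := by
        simp only [mul_sub, Finset.sum_sub_distrib, mul_ite, mul_zero, Finset.sum_ite_eq',
          Finset.mem_univ, if_true]
      rw [h6, hD, Finset.sum_mul]
      exact (Finset.abs_sum_le_sum_abs _ _).trans (Finset.sum_le_sum fun i _ => h1 i)
    have h7 : |(ν k * σ A k) * (∑ i, ν i * w i - ν k * (σ A k * t))| ≤
        |ν k| * (D * (2 * (ε n * t))) := by
      rw [abs_mul, abs_mul, hσ, mul_one]
      exact mul_le_mul_of_nonneg_left h5 (abs_nonneg _)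
    have h8 : (ν k * σ A k) * (ν k * (σ A k * t)) = |ν k| * |ν k| * t := by
      rw [abs_mul_abs_self]
      linear_combination (ν k * ν k * t) * hσ2 A k
    have h9 : |ν k| * (D * (2 * (ε n * t))) < |ν k| * |ν k| * t := by
      have : |ν k| * (D * (2 * (ε n * t))) = (|ν k| * t) * (2 * D * ε n) := by ring
      rw [this, show |ν k| * |ν k| * t = (|ν k| * t) * |ν k| by ring]
      exact mul_lt_mul_of_pos_left hn (mul_pos hk0 ht0)
    have h10 := (abs_le.1 h7).1
    rw [mul_sub, h8] at h10
    linarith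

/-- The side of a wall on which the points of a germ lie does not depend on the sign of the
direction `k` unless the wall passes through the base point and has leading index `k`. -/
theorem Germ.eventually_symmDiff {p : Fin 𝔉.m → ℝ} (G : 𝔉.Germ p) {k : Fin 𝔉.m}
    {ν : Fin 𝔉.m → ℝ} {c : ℝ} (h : ¬ (𝔉.IsPivot ν k ∧ ∑ i, ν i * p i = c)) :
    ∀ᶠ n in atTop, ∀ A, (∑ i, ν i * 𝔉.coord (G.γ n A) i ≤ c ↔
      ∑ i, ν i * 𝔉.coord (G.γ n (symmDiff A {k})) i ≤ c) := by
  rw [eventually_all]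
  intro A
  have hlim : ∀ A, Tendsto (fun n => ∑ i, ν i * 𝔉.coord (G.γ n A) i) atTop (𝓝 (∑ i, ν i * p i)) :=
    fun A => tendsto_finsetSum _ fun i _ => (G.tendsto A i).const_mul _
  rcases lt_trichotomy (∑ i, ν i * p i) c with hlt | heq | hgt
  · filter_upwards [(hlim A).eventually_lt_const hlt,
      (hlim (symmDiff A {k})).eventually_lt_const hlt] with n h1 h2
    exact iff_of_true h1.le h2.le
  · by_cases hν : ν = 0
    · subst hν
      simp
    obtain ⟨k', hk'⟩ := 𝔉.exists_isPivot hν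
    have hne : k' ≠ k := by
      rintro rfl
      exact h ⟨hk', heq⟩
    filter_upwards [G.pos A ν k' hk', G.pos (symmDiff A {k}) ν k' hk'] with n h1 h2
    have hmem : k' ∈ symmDiff A {k} ↔ k' ∈ A := by
      simp [Finset.mem_symmDiff, hne]
    have hsub : ∀ A, ∑ i, ν i * (𝔉.coord (G.γ n A) i - p i) =
        ∑ i, ν i * 𝔉.coord (G.γ n A) i - c := by
      intro A
      rw [← heq, ← Finset.sum_sub_distrib]
      exact Finset.sum_congr rfl fun i _ => mul_sub _ _ _
    simp only [hmem] at h2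
    rw [hsub] at h1 h2
    rw [mul_pos_iff] at h1 h2
    constructor
    · intro h3
      rcases h1 with h1 | h1
      · linarith
      · rcases h2 with h2 | h2 <;> linarith
    · intro h3
      rcases h2 with h2 | h2
      · linarith
      · rcases h1 with h1 | h1 <;> linarith
  · filter_upwards [(hlim A).eventually_const_lt hgt,
      (hlim (symmDiff A {k})).eventually_const_lt hgt] with n h1 h2
    exact iff_of_false (not_le.2 h1) (not_le.2 h2)

end Frame

end CanonicalProjection

/-! ### The alternating pairing near a corner -/

namespace CanonicalProjection

open ContinuousGroupoidCohomology

variable {N : ℕ} {E F : Submodule ℝ (Space N)} {u : Space N}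

namespace ProjectionPattern

variable {T : ProjectionPattern E u}

/-- The evaluation of cochains as a homomorphism. -/
def evalHom (h : T.Hull) {q : ℕ} (w : Fin (q + 1) → E) : Cochain (PatternGroupoid T) q →+ ℤ where
  toFun b := evalCochain h b w
  map_zero' := by
    unfold evalCochain
    split_ifs <;> rfl
  map_add' a b := by
    unfold evalCochain
    split_ifs <;> simp

end ProjectionPattern

open ProjectionPattern

theorem sum_powerset_neg_one_pow_eq_zero {ι : Type*} [DecidableEq ι] {S : Finset ι} {k : ι}
    (hk : k ∈ S) {f : Finset ι → ℤ} (hf : ∀ A, f A = f (symmDiff A {k})) :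
    ∑ A ∈ S.powerset, (-1) ^ A.card * f A = 0 := by
  have hcard : ∀ A : Finset ι, (-1 : ℤ) ^ (symmDiff A {k}).card = -(-1) ^ A.card := by
    intro A
    by_cases hA : k ∈ A
    · have h1 : symmDiff A {k} = A.erase k := by
        ext i
        by_cases hi : i = k <;> simp [Finset.mem_symmDiff, hi, hA]
      have h2 := Finset.card_erase_add_one hA
      rw [h1, ← h2, pow_succ]
      ring
    · have h1 : symmDiff A {k} = insert k A := by
        ext i
        by_cases hi : i = k <;> simp [Finset.mem_symmDiff, hi, hA]
      rw [h1, Finset.card_insert_of_notMem hA, pow_succ]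
      ring
  refine Finset.sum_involution (fun A _ => symmDiff A {k}) ?_ ?_ ?_ ?_
  · intro A _
    rw [hcard, ← hf]
    ring
  · intro A _ _ h
    have : ({k} : Finset ι) = ⊥ := symmDiff_eq_left.1 h
    simp at this
  · intro A hA
    rw [Finset.mem_powerset] at hA ⊢
    exact Finset.union_subset (Finset.sdiff_subset.trans hA)
      (Finset.sdiff_subset.trans (Finset.singleton_subset_iff.2 hk))
  · intro A _
    exact symmDiff_symmDiff_cancel_right _ _

namespace Frame

variable {hEF : IsCompl E F} (𝔉 : Frame hEF) {T : ProjectionPattern E u}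

/-- The lower corner of a box of the sequence, in the free directions. -/
def BoxSequence.corner {𝔉 : Frame hEF} (S : 𝔉.BoxSequence u) (M : ℕ) : Fin 𝔉.m → ℝ :=
  fun i => if i ∈ 𝔉.free then S.lo M i else 0

variable {𝔉}

theorem BoxSequence.eventually_mem (S : 𝔉.BoxSequence u) {M : ℕ} (G : 𝔉.Germ (S.corner M)) :
    ∀ᶠ n in atTop, ∀ A, ∀ w ∈ translationGroup hEF, (∀ i, |𝔉.coord w i| < S.r) →
      S.o + G.γ n A + w ∈ stripPattern E u := by
  have h1 : ∀ᶠ n in atTop, ∀ A i, |𝔉.coord (G.γ n A) i - S.corner M i| < S.r := by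
    rw [eventually_all]
    intro A
    rw [eventually_all]
    intro i
    have := (G.tendsto A i).sub_const (S.corner M i)
    rw [sub_self] at this
    have h2 := this.abs
    rw [abs_zero] at h2
    exact h2.eventually_lt_const S.r_pos
  filter_upwards [h1] with n hn A w hw hwr
  have hsub : S.o + G.γ n A + w - S.o = G.γ n A + w := by abel
  refine ⟨S.mem_strip _ ?_ fun i => ?_, ?_⟩
  · rw [hsub, map_add]
    exact add_mem (G.mem n A).2 hw.2
  · rw [hsub, map_add, Pi.add_apply]
    have h2 := abs_lt.1 (hn A i)
    have h3 := abs_lt.1 (hwr i)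
    have h4 : |S.corner M i| < 2 * S.r := by
      unfold BoxSequence.corner
      split_ifs with hi
      · exact S.abs_lo M i hi
      · rw [abs_zero]
        linarith [S.r_pos]
    have h5 := abs_lt.1 h4
    have := S.r_pos
    rw [abs_lt]
    constructor <;> linarith
  · have h2 : S.o + G.γ n A + w - u = (S.o - u) + G.γ n A + w := by abel
    rw [h2]
    exact add_mem (add_mem S.o_mem (G.mem n A).1) hw.1

/-- The alternating sum over the germs at the corner of the evaluations of cochains on the Kuhn
triangulation. -/
def Splitting.pairing (T : ProjectionPattern E u) {d : ℕ} {δ : ℝ} (Z : 𝔉.Splitting d δ) {p : Fin 𝔉.m → ℝ} (G : 𝔉.Germ p)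
    (o : Space N) (Q : Finset (Fin d → ℤ)) (n : ℕ) : Cochain (PatternGroupoid T) d →+ ℤ :=
  ∑ A ∈ 𝔉.free.powerset, ((-1 : ℤ) ^ A.card) • ∑ μ ∈ Q, ∑ τ : Equiv.Perm (Fin d),
    (Equiv.Perm.sign τ : ℤ) • evalHom (T.reg 0) fun i : Fin (d + 1) =>
      projE E (o + G.γ n A + Z.z (μ + kuhnVertex τ i))

theorem Splitting.pairing_apply {d : ℕ} {δ : ℝ} (Z : 𝔉.Splitting d δ) {p : Fin 𝔉.m → ℝ}
    (G : 𝔉.Germ p) (o : Space N) (Q : Finset (Fin d → ℤ)) (n : ℕ)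
    (c : Cochain (PatternGroupoid T) d) :
    Z.pairing T G o Q n c = ∑ A ∈ 𝔉.free.powerset, (-1 : ℤ) ^ A.card * ∑ μ ∈ Q,
      kuhnSum (fun q => evalCochain (T.reg 0) c fun i => projE E (o + G.γ n A + Z.z (q i))) μ := by
  simp only [pairing, AddMonoidHom.finsetSum_apply, AddMonoidHom.coe_smul, Pi.smul_apply,
    smul_eq_mul]
  rfl

-- After the Kuhn sum every point `x₀ + w` of the box is counted by exactly one unit cube, that of
-- the integer parts of `θ`. The `+ 1` in `hμ` allows for the vertices of the cube other than `μ`.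
open Classical in
theorem Splitting.kuhnSum_evalCochain_cochain (hT : Function.Injective T.fromStrip)
    (hu : u ∈ nonSingular E) {d : ℕ} {δ : ℝ} (Z : 𝔉.Splitting d δ) (B : BoxData hEF u)
    {x₀ : Space N} (hx₀ : x₀ ∈ stripPattern E u) (hpt : ∀ μ, x₀ + Z.z μ ∈ stripPattern E u)
    {C D : ℝ} (hC : ∀ x ∈ strip E, ‖skewProjection hEF x‖ ≤ C) {Y : Finset (Space N)}
    (hY : ∀ w ∈ lattice N, ‖skewProjection hEF w‖ ≤ 2 * C → (∀ i, |Z.θ (projE E w) i| ≤ D) → w ∈ Y)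
    {μ : Fin d → ℤ} (hμ : ∀ i, |(μ i : ℝ)| + 1 ≤ D) :
    kuhnSum (fun q => evalCochain (T.reg 0) (B.cochain hT hu Z.isProper)
      fun i => projE E (x₀ + Z.z (q i))) μ =
      ∑ w ∈ Y, if x₀ + w ∈ B.set ∧ ∀ i, ⌊Z.θ (projE E w) i⌋ = μ i then 1 else 0 := by
  have h1 : ∀ τ : Equiv.Perm (Fin d), evalCochain (T.reg 0) (B.cochain hT hu Z.isProper)
      (fun i : Fin (d + 1) => projE E (x₀ + Z.z (μ + kuhnVertex τ i))) =
      ∑ w ∈ Y, if x₀ + w ∈ B.set then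
        ∏ i : Fin d, ((if 0 < (((μ + kuhnVertex τ ((i.succ : Fin (d + 1)) : ℕ)) i : ℤ) : ℝ) -
          Z.θ (projE E w) i then (1 : ℤ) else 0) -
          if 0 < (((μ + kuhnVertex τ ((i.castSucc : Fin (d + 1)) : ℕ)) i : ℤ) : ℝ) -
          Z.θ (projE E w) i then (1 : ℤ) else 0) else 0 := by
    intro τ
    rw [BoxData.evalCochain_cochain hT hu B Z.isProper fun i => hpt _,
      ← finsum_comp_equiv (Equiv.addLeft x₀)]
    have h2 : ∀ w, cupDiff (heaviside Z.θ (projE E (x₀ + w)))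
        (fun i : Fin (d + 1) => projE E (x₀ + Z.z (μ + kuhnVertex τ i))) =
        cupDiff (heaviside Z.θ (projE E w)) fun i : Fin (d + 1) =>
          projE E (Z.z (μ + kuhnVertex τ i)) := by
      intro w
      unfold cupDiff
      refine Finset.prod_congr rfl fun i _ => ?_
      simp only [heaviside, map_add, add_sub_add_left_eq_sub]
    simp only [Equiv.coe_addLeft, h2]
    rw [finsum_eq_sum_of_support_subset (s := Y)]
    · refine Finset.sum_congr rfl fun w _ => ?_
      congr 1
      unfold cupDiff heaviside
      simp only [map_sub, Pi.sub_apply, Z.θ_z]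
    · intro w hw
      rw [Function.mem_support] at hw
      split_ifs at hw with hB
      · have hstrip := B.sub _ hB
        refine hY w ?_ ?_ fun i => ?_
        · have h3 : w = (x₀ + w - u) - (x₀ - u) := by abel
          rw [h3]
          exact sub_mem hB.1 hx₀.2
        · have h3 : w = (x₀ + w) - x₀ := by abel
          rw [h3, map_sub]
          refine (norm_sub_le _ _).trans ?_
          linarith [hC _ hstrip, hC _ hx₀.1]
        · refine abs_le_of_cupDiff_ne_zero (fun j i => ?_) hw i
          rw [Z.θ_z]
          refine le_trans ?_ (hμ i)
          rw [Pi.add_apply, Int.cast_add]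
          refine (abs_add_le _ _).trans (add_le_add le_rfl ?_)
          unfold kuhnVertex
          split_ifs <;> simp
      · exact absurd rfl hw
  unfold kuhnSum
  simp only [h1, Finset.mul_sum]
  rw [Finset.sum_comm]
  refine Finset.sum_congr rfl fun w _ => ?_
  by_cases hw : x₀ + w ∈ B.set
  · simp only [hw, if_true, true_and]
    exact kuhnSum_heaviside (Z.θ (projE E w)) μ
  · simp [hw]

-- The finite set `Y` depends on `Q` only, not on the box or the base point. Statements that hold
-- eventually along a germ can therefore be imposed on all of `Y` at once.
open Classical in
theorem Splitting.sum_kuhnSum_cochain (hT : Function.Injective T.fromStrip)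
    (hu : u ∈ nonSingular E) {d : ℕ} {δ : ℝ} (Z : 𝔉.Splitting d δ) (Q : Finset (Fin d → ℤ)) :
    ∃ Y : Finset (Space N), (∀ μ ∈ Q, Z.z μ ∈ Y) ∧ (∀ w ∈ Y, w ∈ lattice N) ∧
      ∀ (B : BoxData hEF u) (x₀ : Space N), x₀ ∈ stripPattern E u →
        (∀ μ, x₀ + Z.z μ ∈ stripPattern E u) →
        ∑ μ ∈ Q, kuhnSum (fun q => evalCochain (T.reg 0) (B.cochain hT hu Z.isProper)
          fun i => projE E (x₀ + Z.z (q i))) μ =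
          ∑ w ∈ Y.filter (fun w => (fun i => ⌊Z.θ (projE E w) i⌋) ∈ Q),
            if x₀ + w ∈ B.set then 1 else 0 := by
  obtain ⟨C, hC⟩ := BoxData.exists_norm_skew_le (E := E) hEF
  set D : ℝ := 1 + ∑ μ ∈ Q, ∑ i, |(μ i : ℝ)|
  have hμD : ∀ μ ∈ Q, ∀ i, |(μ i : ℝ)| + 1 ≤ D := by
    intro μ hμ i
    have h1 : |(μ i : ℝ)| ≤ ∑ i, |(μ i : ℝ)| :=
      Finset.single_le_sum (f := fun i => |(μ i : ℝ)|) (fun i _ => abs_nonneg _) (Finset.mem_univ i)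
    have h2 : ∑ i, |(μ i : ℝ)| ≤ ∑ μ ∈ Q, ∑ i, |(μ i : ℝ)| :=
      Finset.single_le_sum (f := fun μ : Fin d → ℤ => ∑ i, |(μ i : ℝ)|)
        (fun μ _ => Finset.sum_nonneg fun i _ => abs_nonneg _) hμ
    linarith
  have hfin := Z.isProper (max (2 * C) D)
  let Y : Finset (Space N) := hfin.toFinset ∪ Q.image Z.z
  refine ⟨Y, fun μ hμ => Finset.mem_union_right _ (Finset.mem_image_of_mem _ hμ), fun w hw => ?_,
    fun B x₀ hx₀ hpt => ?_⟩
  · rcases Finset.mem_union.1 hw with hw | hw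
    · exact ((Set.Finite.mem_toFinset _).1 hw).1
    · obtain ⟨μ, -, rfl⟩ := Finset.mem_image.1 hw
      exact (Z.z_mem μ).1
  · have hY : ∀ w ∈ lattice N, ‖skewProjection hEF w‖ ≤ 2 * C →
        (∀ i, |Z.θ (projE E w) i| ≤ D) → w ∈ Y := fun w hw h1 h2 =>
      Finset.mem_union_left _ ((Set.Finite.mem_toFinset _).2
        ⟨hw, h1.trans (le_max_left _ _), fun i => (h2 i).trans (le_max_right _ _)⟩)
    rw [Finset.sum_congr rfl fun μ hμ =>
      Z.kuhnSum_evalCochain_cochain hT hu B hx₀ hpt hC hY (hμD μ hμ), Finset.sum_comm,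
      Finset.sum_filter]
    refine Finset.sum_congr rfl fun w _ => ?_
    by_cases hw : x₀ + w ∈ B.set
    · simp only [hw, true_and, if_true]
      have h3 : ∀ μ : Fin d → ℤ, (∀ i, ⌊Z.θ (projE E w) i⌋ = μ i) ↔
          (fun i => ⌊Z.θ (projE E w) i⌋) = μ := fun μ => funext_iff.symm
      simp only [h3, Finset.sum_ite_eq]
    · simp [hw]

end Frame

end CanonicalProjection

/-! ### The pairing with the cocycles of the boxes -/

namespace CanonicalProjection

open ContinuousGroupoidCohomology

variable {N : ℕ} {E F : Submodule ℝ (Space N)} {u : Space N}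

open ProjectionPattern

namespace Frame

variable {hEF : IsCompl E F} {𝔉 : Frame hEF} {T : ProjectionPattern E u}

theorem BoxSequence.add_mem_set_iff (S : 𝔉.BoxSequence u) {p : Fin 𝔉.m → ℝ} (G : 𝔉.Germ p)
    {j n : ℕ} {A : Finset (Fin 𝔉.m)} {w : Space N} : S.o + G.γ n A + w ∈ (S.B j).set ↔
      w ∈ translationGroup hEF ∧ ∀ i, S.lo j i < 𝔉.coord (G.γ n A) i + 𝔉.coord w i ∧
        𝔉.coord (G.γ n A) i + 𝔉.coord w i < S.hi j i := by
  have h1 : S.o + G.γ n A + w - S.o = G.γ n A + w := by abel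
  have h2 : S.o + G.γ n A + w - u = (S.o - u + G.γ n A) + w := by abel
  have hγ := G.mem n A
  have hγV : skewProjection hEF (G.γ n A) ∈ contSpace hEF := hγ.2
  rw [S.mem_set, h1, h2, (lattice N).add_mem_cancel_left ((lattice N).add_mem S.o_mem hγ.1),
    (skewProjection hEF).map_add, (contSpace hEF).add_mem_iff_right hγV, mem_translationGroup, and_assoc]
  simp only [map_add, Pi.add_apply]

/-- A sign change in direction `k` can be noticed only by a face orthogonal to `k` that passes
through the translated corner, and the two hypotheses exclude this. -/
theorem BoxSequence.eventually_flip (S : 𝔉.BoxSequence u) {M : ℕ} (G : 𝔉.Germ (S.corner M))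
    {j : ℕ} {w : Space N} {k : Fin 𝔉.m} (hk : k ∈ 𝔉.free)
    (hlo : S.lo M k + 𝔉.coord w k ≠ S.lo j k) (hhi : S.lo M k + 𝔉.coord w k ≠ S.hi j k) :
    ∀ᶠ n in atTop, ∀ A, (S.o + G.γ n A + w ∈ (S.B j).set ↔
      S.o + G.γ n (symmDiff A {k}) + w ∈ (S.B j).set) := by
  have hck : S.corner M k = S.lo M k := if_pos hk
  have h1 : ∀ i, ∀ᶠ n in atTop, ∀ A, (𝔉.coord (G.γ n A) i ≤ S.lo j i - 𝔉.coord w i ↔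
      𝔉.coord (G.γ n (symmDiff A {k})) i ≤ S.lo j i - 𝔉.coord w i) := by
    intro i
    have := Germ.eventually_symmDiff 𝔉 G (k := k) (ν := Pi.single i 1) (c := S.lo j i - 𝔉.coord w i) (by
      rintro ⟨⟨hp, -⟩, hc⟩
      obtain rfl : k = i := by
        by_contra hne
        exact hp (Pi.single_eq_of_ne hne _)
      simp only [Pi.single_apply, ite_mul, one_mul, zero_mul, Finset.sum_ite_eq', Finset.mem_univ,
        if_true] at hc
      exact hlo (by rw [← hck, hc]; ring))
    simpa [Pi.single_apply] using this
  have h2 : ∀ i, ∀ᶠ n in atTop, ∀ A, (S.hi j i - 𝔉.coord w i ≤ 𝔉.coord (G.γ n A) i ↔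
      S.hi j i - 𝔉.coord w i ≤ 𝔉.coord (G.γ n (symmDiff A {k})) i) := by
    intro i
    have := Germ.eventually_symmDiff 𝔉 G (k := k) (ν := Pi.single i (-1))
      (c := -(S.hi j i - 𝔉.coord w i)) (by
      rintro ⟨⟨hp, -⟩, hc⟩
      obtain rfl : k = i := by
        by_contra hne
        exact hp (Pi.single_eq_of_ne hne _)
      simp only [Pi.single_apply, ite_mul, neg_mul, one_mul, zero_mul, Finset.sum_ite_eq',
        Finset.mem_univ, if_true, neg_inj] at hc
      exact hhi (by rw [← hck, hc]; ring))
    simpa only [Pi.single_apply, ite_mul, neg_mul, one_mul, zero_mul, Finset.sum_ite_eq',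
      Finset.mem_univ, if_true, neg_le_neg_iff] using this
  filter_upwards [eventually_all.2 h1, eventually_all.2 h2] with n h3 h4 A
  rw [S.add_mem_set_iff, S.add_mem_set_iff]
  refine and_congr Iff.rfl (forall_congr' fun i => and_congr ?_ ?_)
  · have := not_congr (h3 i A)
    rw [not_le, not_le, sub_lt_iff_lt_add, sub_lt_iff_lt_add] at this
    exact this
  · have := not_congr (h4 i A)
    rw [not_le, not_le, lt_sub_iff_add_lt, lt_sub_iff_add_lt] at this
    exact this

open Classical in
/-- The alternating sum of the indicator functions of a box at the points of a germ. -/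
def BoxSequence.alternating (S : 𝔉.BoxSequence u) {p : Fin 𝔉.m → ℝ} (G : 𝔉.Germ p)
    (j n : ℕ) (w : Space N) : ℤ :=
  ∑ A ∈ 𝔉.free.powerset, (-1) ^ A.card * if S.o + G.γ n A + w ∈ (S.B j).set then 1 else 0

/-- The alternation detects only translates that carry the corner to a vertex of the box in all free
coordinates. -/
theorem BoxSequence.eventually_alternating_eq_zero (S : 𝔉.BoxSequence u) {M : ℕ}
    (G : 𝔉.Germ (S.corner M)) {j : ℕ} {w : Space N}
    (h : w ∈ translationGroup hEF → ∃ k ∈ 𝔉.free, S.lo M k + 𝔉.coord w k ≠ S.lo j k ∧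
      S.lo M k + 𝔉.coord w k ≠ S.hi j k) :
    ∀ᶠ n in atTop, S.alternating G j n w = 0 := by
  classical
  by_cases hw : w ∈ translationGroup hEF
  · obtain ⟨k, hk, h1, h2⟩ := h hw
    filter_upwards [S.eventually_flip G hk h1 h2] with n hn
    refine sum_powerset_neg_one_pow_eq_zero hk fun A => ?_
    exact if_congr (hn A) rfl rfl
  · refine Eventually.of_forall fun n => Finset.sum_eq_zero fun A _ => ?_
    rw [if_neg fun hm => hw (S.add_mem_set_iff G |>.1 hm).1, mul_zero]

-- For a nonempty `A` some free coordinate is pushed below the lower wall, so only the term of the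
-- empty set survives and the alternating sum is `0` or `1`.
open Classical in
theorem BoxSequence.eventually_alternating_own (S : 𝔉.BoxSequence u) {M : ℕ}
    (G : 𝔉.Germ (S.corner M)) {w : Space N} (hw : ∀ i ∈ 𝔉.free, 𝔉.coord w i = 0) :
    ∀ᶠ n in atTop, S.alternating G M n w = if S.o + G.γ n ∅ + w ∈ (S.B M).set then 1 else 0 := by
  have h1 : ∀ A, ∀ i, ∀ᶠ n in atTop, i ∈ A → 𝔉.coord (G.γ n A) i < S.corner M i := by
    intro A i
    by_cases hi : i ∈ A
    · by_cases hif : 𝔉.IsPivot (Pi.single i 1) i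
      · filter_upwards [G.pos A (Pi.single i 1) i hif] with n hn _
        simp [Pi.single_apply, hi] at hn
        exact hn
      · refine absurd ⟨by simp, fun k hk => Pi.single_eq_of_ne ?_ _⟩ hif
        rintro rfl
        exact lt_irrefl _ hk
    · exact Eventually.of_forall fun n h => absurd h hi
  filter_upwards [eventually_all.2 fun A => eventually_all.2 (h1 A)] with n hn
  unfold alternating
  rw [Finset.sum_eq_single ∅]
  · simp
  · intro A hA hne
    obtain ⟨i, hi⟩ := Finset.nonempty_iff_ne_empty.2 hne
    have hif := Finset.mem_powerset.1 hA hi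
    rw [if_neg, mul_zero]
    intro hm
    have h2 := (((S.add_mem_set_iff G).1 hm).2 i).1
    have h3 := hn A i hi
    rw [hw i hif] at h2
    unfold corner at h3
    rw [if_pos hif] at h3
    linarith
  · intro h
    exact absurd (Finset.empty_mem_powerset _) h

theorem Splitting.exists_pairing_eq (hT : Function.Injective T.fromStrip)
    (hu : u ∈ nonSingular E) {d : ℕ} (S : 𝔉.BoxSequence u) (Z : 𝔉.Splitting d S.r)
    {M : ℕ} (G : 𝔉.Germ (S.corner M)) (Q : Finset (Fin d → ℤ)) :
    ∃ Y : Finset (Space N), (∀ μ ∈ Q, Z.z μ ∈ Y) ∧ ∀ᶠ n in atTop, ∀ j,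
      Z.pairing T G S.o Q n ((S.B j).cochain hT hu Z.isProper) =
        ∑ w ∈ Y, S.alternating G j n w := by
  classical
  obtain ⟨Y, hYz, hYL, hY⟩ := Z.sum_kuhnSum_cochain hT hu Q
  refine ⟨Y.filter (fun w => (fun i => ⌊Z.θ (projE E w) i⌋) ∈ Q), fun μ hμ => ?_, ?_⟩
  · refine Finset.mem_filter.2 ⟨hYz μ hμ, ?_⟩
    simpa only [Z.θ_z, Int.floor_intCast] using hμ
  · filter_upwards [S.eventually_mem G] with n hn j
    rw [Z.pairing_apply]
    unfold BoxSequence.alternating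
    rw [Finset.sum_comm]
    refine Finset.sum_congr rfl fun A _ => ?_
    rw [hY (S.B j) (S.o + G.γ n A) (by
      have := hn A 0 (zero_mem _) fun i => by
        rw [map_zero, Pi.zero_apply, abs_zero]
        exact S.r_pos
      rwa [add_zero] at this) fun μ => hn A _ (Z.z_mem μ) (Z.z_small μ), Finset.mul_sum]

theorem Splitting.eventually_pairing_earlier (hT : Function.Injective T.fromStrip)
    (hu : u ∈ nonSingular E) {d : ℕ} (S : 𝔉.BoxSequence u) (Z : 𝔉.Splitting d S.r)
    {M : ℕ} (G : 𝔉.Germ (S.corner M)) (Q : Finset (Fin d → ℤ)) {j : ℕ} (hj : j < M) :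
    ∀ᶠ n in atTop, Z.pairing T G S.o Q n ((S.B j).cochain hT hu Z.isProper) = 0 := by
  obtain ⟨Y, -, hY⟩ := Z.exists_pairing_eq hT hu S G Q
  have h1 : ∀ᶠ n in atTop, ∀ w ∈ Y, S.alternating G j n w = 0 := by
    rw [Finset.eventually_all]
    intro w _
    refine S.eventually_alternating_eq_zero G fun hw => ?_
    have := S.earlier j M hj w hw
    push Not at this
    exact this
  filter_upwards [hY, h1] with n h2 h3
  rw [h2 j, Finset.sum_eq_zero h3]

-- No cancellation occurs: by `own` every contribution is `0` or `1`. For `μ` supported in `I` the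
-- vector `z μ` has no free components and its other ones are small, so it stays inside the box and
-- contributes `1`.
open Classical in
theorem Splitting.eventually_pairing_own (hT : Function.Injective T.fromStrip)
    (hu : u ∈ nonSingular E) {d : ℕ} (S : 𝔉.BoxSequence u) (Z : 𝔉.Splitting d S.r)
    {M : ℕ} (G : 𝔉.Germ (S.corner M)) (Q : Finset (Fin d → ℤ)) :
    ∀ᶠ n in atTop, ((Q.filter fun μ => ∀ i ∉ Z.I, μ i = 0).card : ℤ) ≤
      Z.pairing T G S.o Q n ((S.B M).cochain hT hu Z.isProper) := by
  obtain ⟨Y, hYz, hY⟩ := Z.exists_pairing_eq hT hu S G Q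
  have h1 : ∀ᶠ n in atTop, ∀ w ∈ Y, 0 ≤ S.alternating G M n w := by
    rw [Finset.eventually_all]
    intro w _
    by_cases hw : w ∈ translationGroup hEF → ∃ k ∈ 𝔉.free, S.lo M k + 𝔉.coord w k ≠ S.lo M k ∧
        S.lo M k + 𝔉.coord w k ≠ S.hi M k
    · filter_upwards [S.eventually_alternating_eq_zero G hw] with n hn
      exact hn.ge
    · push Not at hw
      obtain ⟨hwΓ, hw⟩ := hw
      have h2 := S.own M w hwΓ fun i hi => or_iff_not_imp_left.2 (hw i hi)
      filter_upwards [S.eventually_alternating_own G h2] with n hn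
      rw [hn]
      split_ifs <;> simp
  set Q' := Q.filter fun μ => ∀ i ∉ Z.I, μ i = 0
  have hcorner : ∀ i ∈ 𝔉.free, S.corner M i = S.lo M i := fun i hi => if_pos hi
  have hcorner' : ∀ i ∉ 𝔉.free, S.corner M i = 0 := fun i hi => if_neg hi
  have h3 : ∀ᶠ n in atTop, ∀ μ ∈ Q', S.alternating G M n (Z.z μ) = 1 := by
    rw [Finset.eventually_all]
    intro μ hμ
    have hμf := Z.z_free μ (Finset.mem_filter.1 hμ).2
    have h4 : ∀ i, ∀ᶠ n in atTop, S.lo M i < 𝔉.coord (G.γ n ∅) i + 𝔉.coord (Z.z μ) i ∧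
        𝔉.coord (G.γ n ∅) i + 𝔉.coord (Z.z μ) i < S.hi M i := by
      intro i
      have hlim := (G.tendsto ∅ i).add_const (𝔉.coord (Z.z μ) i)
      by_cases hi : i ∈ 𝔉.free
      · rw [hcorner i hi, hμf i hi, add_zero] at hlim
        have hpiv : 𝔉.IsPivot (Pi.single i 1) i := by
          refine ⟨by simp, fun k hk => Pi.single_eq_of_ne ?_ _⟩
          rintro rfl
          exact lt_irrefl _ hk
        filter_upwards [G.pos ∅ (Pi.single i 1) i hpiv,
          hlim.eventually_lt_const (S.lo_lt_hi M i hi)] with n h5 h6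
        simp only [Pi.single_eq_same, Finset.notMem_empty, if_false, mul_one, one_mul,
          Pi.single_apply, ite_mul, zero_mul, Finset.sum_ite_eq', Finset.mem_univ, if_true,
          sub_pos] at h5
        rw [hcorner i hi] at h5
        rw [hμf i hi]
        exact ⟨by linarith, by linarith⟩
      · rw [hcorner' i hi, zero_add] at hlim
        have h5 := abs_lt.1 (Z.z_small μ i)
        exact (hlim.eventually_const_lt ((S.lo_lt M i hi).trans h5.1)).and
          (hlim.eventually_lt_const (h5.2.trans (S.lt_hi M i hi)))
    filter_upwards [S.eventually_alternating_own G hμf, eventually_all.2 h4] with n h5 h6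
    rw [h5, if_pos ((S.add_mem_set_iff G).2 ⟨Z.z_mem μ, h6⟩)]
  have hinj : Function.Injective Z.z := by
    intro μ ν h
    funext i
    have h5 := Z.θ_z μ i
    rw [h, Z.θ_z] at h5
    exact_mod_cast h5.symm
  filter_upwards [hY, h1, h3] with n h5 h6 h7
  rw [h5 M]
  calc ((Q'.card : ℕ) : ℤ) = ∑ w ∈ Q'.image Z.z, S.alternating G M n w := by
        rw [Finset.sum_image fun _ _ _ _ h => hinj h, Finset.sum_congr rfl h7]
        simp
    _ ≤ ∑ w ∈ Y, S.alternating G M n w := by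
        refine Finset.sum_le_sum_of_subset_of_nonneg ?_ fun w hw _ => h6 w hw
        intro w hw
        obtain ⟨μ, hμ, rfl⟩ := Finset.mem_image.1 hw
        exact hYz μ (Finset.mem_filter.1 hμ).1

end Frame

end CanonicalProjection

/-! ### The pairing with coboundaries -/

namespace CanonicalProjection

open ContinuousGroupoidCohomology

variable {N : ℕ} {E F : Submodule ℝ (Space N)} {u : Space N}

open ProjectionPattern

namespace Frame

variable {hEF : IsCompl E F} {𝔉 : Frame hEF} {T : ProjectionPattern E u}

theorem skewProjection_eq_sum (𝔉 : Frame hEF) {γ : Space N} (hγ : γ ∈ translationGroup hEF) :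
    skewProjection hEF γ = ∑ i, 𝔉.coord γ i • 𝔉.b i := by
  have h1 := 𝔉.eq_sum _ hγ.2
  refine h1.trans (Finset.sum_congr rfl fun i _ => ?_)
  rw [← 𝔉.coord_skewProjection]
  rfl

theorem apply_eq_sum (𝔉 : Frame hEF) {γ : Space N} (hγ : γ ∈ translationGroup hEF)
    {f : Module.Dual ℝ (Space N)} (hf : ∀ e ∈ E, f e = 0) :
    f γ = ∑ i, f (𝔉.b i) * 𝔉.coord γ i := by
  have h1 := hf _ (𝔉.sub_sum_mem hγ.2)
  rw [map_sub, map_sum, sub_eq_zero] at h1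
  rw [h1]
  refine Finset.sum_congr rfl fun i _ => ?_
  rw [map_smul, smul_eq_mul, mul_comm]

/-- Triangular systems of equations taken from a finite set have finitely many solutions. -/
theorem finite_triangular (𝔉 : Frame hEF) (𝒲 : Finset ((Fin 𝔉.m → ℝ) × ℝ)) :
    {y : Fin 𝔉.m → ℝ | (∀ i ∉ 𝔉.free, y i = 0) ∧ ∀ k ∈ 𝔉.free, ∃ w ∈ 𝒲, 𝔉.IsPivot w.1 k ∧
      ∑ i, w.1 i * y i = w.2}.Finite := by
  classical
  have hch : ∀ y : Fin 𝔉.m → ℝ, ∀ k, ∃ w : (Fin 𝔉.m → ℝ) × ℝ,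
      w ∈ insert 0 𝒲 ∧ ((∃ w ∈ 𝒲, 𝔉.IsPivot w.1 k ∧ ∑ i, w.1 i * y i = w.2) →
        𝔉.IsPivot w.1 k ∧ ∑ i, w.1 i * y i = w.2) := by
    intro y k
    by_cases h : ∃ w ∈ 𝒲, 𝔉.IsPivot w.1 k ∧ ∑ i, w.1 i * y i = w.2
    · obtain ⟨w, hw, h1⟩ := h
      exact ⟨w, Finset.mem_insert_of_mem hw, fun _ => h1⟩
    · exact ⟨0, Finset.mem_insert_self _ _, fun h' => absurd h' h⟩
  choose w hw hwk using hch
  refine Set.Finite.of_injOn (f := w) (t := {f | ∀ k, f k ∈ (insert 0 𝒲 : Finset _)})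
    (fun y _ k => hw y k) ?_ (Set.Finite.pi' fun _ => Finset.finite_toSet _)
  rintro y ⟨hy0, hy⟩ y' ⟨hy0', hy'⟩ heq
  by_contra hne
  obtain ⟨i, hi⟩ := Function.ne_iff.1 hne
  -- At the highest rank where two solutions of the same equations differ, the equation with pivot
  -- `k` involves only coordinates of rank at least that of `k`, and above `k` they agree.
  obtain ⟨k, hk, hmax⟩ := Finset.exists_max_image (Finset.univ.filter fun i => y i ≠ y' i) 𝔉.rank
    ⟨i, by simpa using hi⟩
  have hk' : y k ≠ y' k := (Finset.mem_filter.1 hk).2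
  have hkf : k ∈ 𝔉.free := by
    by_contra hkf
    exact hk' ((hy0 k hkf).trans (hy0' k hkf).symm)
  obtain ⟨hp, h1⟩ := hwk y k (hy k hkf)
  obtain ⟨-, h2⟩ := hwk y' k (hy' k hkf)
  rw [← heq, ← h1, ← sub_eq_zero, ← Finset.sum_sub_distrib, Finset.sum_eq_single k] at h2
  · rw [← mul_sub, mul_eq_zero, sub_eq_zero] at h2
    exact h2.elim hp.1 fun h => hk' h.symm
  · intro i _ hik
    rcases lt_trichotomy (𝔉.rank i) (𝔉.rank k) with hlt | he | hgt
    · rw [hp.2 i hlt]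
      ring
    · exact absurd (𝔉.rank_injective he) hik
    · have : y i = y' i := by
        by_contra hyi
        exact absurd (hmax i (by simpa using hyi)) (not_le.2 hgt)
      rw [this, sub_self]
  · intro h
    exact absurd (Finset.mem_univ _) h

/-- The alternating sum over the germs of the values of a cochain on a face of the Kuhn
triangulation. -/
def Splitting.faceSum {d : ℕ} {δ : ℝ} (Z : 𝔉.Splitting (d + 1) δ) {p : Fin 𝔉.m → ℝ}
    (G : 𝔉.Germ p) (o : Space N) (b : Cochain (PatternGroupoid T) d) (n : ℕ)
    (τ : Equiv.Perm (Fin (d + 1))) (μ : Fin (d + 1) → ℤ) : ℤ :=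
  ∑ A ∈ 𝔉.free.powerset, (-1 : ℤ) ^ A.card * evalCochain (T.reg 0) b fun j : Fin (d + 1) =>
    projE E (o + G.γ n A + Z.z (μ + kuhnVertex τ j))

theorem Splitting.pairing_coboundary (hT : Function.Injective T.fromStrip) {d : ℕ} {δ : ℝ}
    (Z : 𝔉.Splitting (d + 1) δ) {p : Fin 𝔉.m → ℝ} (G : 𝔉.Germ p) (o : Space N)
    (Q : Finset (Fin (d + 1) → ℤ)) (b : Cochain (PatternGroupoid T) d) {n : ℕ}
    (hn : ∀ A μ, o + G.γ n A + Z.z μ ∈ stripPattern E u) :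
    Z.pairing T G o Q n (coboundary _ d b) = (-1) ^ d * ∑ τ : Equiv.Perm (Fin (d + 1)),
      (Equiv.Perm.sign τ : ℤ) * ∑ μ ∈ Q, (Z.faceSum G o b n τ (μ + Pi.single (τ (Fin.last d)) 1) -
        Z.faceSum G o b n τ μ) := by
  rw [Z.pairing_apply]
  have h1 : ∀ A μ, kuhnSum (fun q => evalCochain (T.reg 0) (coboundary _ d b) fun i =>
      projE E (o + G.γ n A + Z.z (q i))) μ =
      (-1) ^ d * ∑ τ : Equiv.Perm (Fin (d + 1)), (Equiv.Perm.sign τ : ℤ) *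
        ((evalCochain (T.reg 0) b fun j : Fin (d + 1) => projE E (o + G.γ n A +
          Z.z ((μ + Pi.single (τ (Fin.last d)) 1) + kuhnVertex τ (j : ℕ)))) -
          evalCochain (T.reg 0) b fun j : Fin (d + 1) => projE E (o + G.γ n A +
            Z.z (μ + kuhnVertex τ (j : ℕ)))) := by
    intro A μ
    rw [← kuhnSum_coboundary fun q => evalCochain (T.reg 0) b fun i =>
      projE E (o + G.γ n A + Z.z (q i))]
    refine Finset.sum_congr rfl fun τ _ => ?_
    exact congrArg _ (evalCochain_coboundary b fun i => projE_mem_reg hT (hn A _))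
  simp only [h1, faceSum, ← Finset.sum_sub_distrib, ← mul_sub, Finset.mul_sum]
  rw [Finset.sum_comm]
  conv_rhs => rw [Finset.sum_comm]
  refine Finset.sum_congr rfl fun μ _ => ?_
  rw [Finset.sum_comm]
  refine Finset.sum_congr rfl fun τ _ => Finset.sum_congr rfl fun A _ => ?_
  ring

/-- Neighbouring points `z` differ by elements of `Γ` with small image in `V` and with
`θ`-coordinates `0` or `1`. By properness there are finitely many shapes of simplices, so bounds for
single shapes become uniform. -/
theorem Splitting.finite_differences {d : ℕ} {δ : ℝ} (Z : 𝔉.Splitting d δ) (q : ℕ) :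
    {a : Fin q → Space N | ∃ μ τ, a = fun j : Fin q => Z.z (μ + kuhnVertex τ j) - Z.z μ}.Finite := by
  set C := ∑ i, 2 * δ * ‖𝔉.b i‖
  refine (Set.Finite.pi' (ι := Fin q) fun _ => Z.isProper (max C 1)).subset ?_
  rintro _ ⟨μ, τ, rfl⟩ j
  have hΓ := sub_mem (Z.z_mem (μ + kuhnVertex τ j)) (Z.z_mem μ)
  refine ⟨hΓ.1, le_trans ?_ (le_max_left _ _), fun i => le_trans ?_ (le_max_right _ _)⟩
  · rw [𝔉.skewProjection_eq_sum hΓ]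
    refine (norm_sum_le _ _).trans (Finset.sum_le_sum fun i _ => ?_)
    rw [norm_smul]
    refine mul_le_mul_of_nonneg_right ?_ (norm_nonneg _)
    rw [map_sub, Pi.sub_apply, Real.norm_eq_abs]
    refine (abs_sub _ _).trans ?_
    linarith [Z.z_small (μ + kuhnVertex τ j) i, Z.z_small μ i]
  · rw [map_sub, map_sub, Pi.sub_apply, Z.θ_z, Z.θ_z, Pi.add_apply]
    push_cast
    rw [add_sub_cancel_left]
    unfold kuhnVertex
    split_ifs <;> simp

theorem Splitting.exists_bound_faceSum (hT : Function.Injective T.fromStrip) {d : ℕ} {δ : ℝ}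
    (Z : 𝔉.Splitting (d + 1) δ) {p : Fin 𝔉.m → ℝ} (G : 𝔉.Germ p) (o : Space N)
    (b : Cochain (PatternGroupoid T) d) : ∃ K : ℕ, ∀ n,
      (∀ A μ, o + G.γ n A + Z.z μ ∈ stripPattern E u) → ∀ τ μ,
        |Z.faceSum G o b n τ μ| ≤ K := by
  classical
  have h0 := Z.finite_differences (d + 1)
  have hL : ∀ a ∈ h0.toFinset, ∀ i, a i ∈ lattice N := by
    intro a ha i
    obtain ⟨μ, τ, rfl⟩ := (Set.Finite.mem_toFinset _).1 ha
    exact sub_mem (Z.z_mem _).1 (Z.z_mem _).1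
  choose! K hK using fun a (ha : a ∈ h0.toFinset) => exists_bound_evalCochain hT b a (hL a ha)
  refine ⟨𝔉.free.powerset.card * ∑ a ∈ h0.toFinset, K a, fun n hn τ μ => ?_⟩
  unfold faceSum
  refine (Finset.abs_sum_le_sum_abs _ _).trans ?_
  push_cast
  rw [← nsmul_eq_mul]
  refine Finset.sum_le_card_nsmul _ _ _ fun A _ => ?_
  rw [abs_mul, abs_pow, abs_neg, abs_one, one_pow, one_mul]
  set a : Fin (d + 1) → Space N := fun j => Z.z (μ + kuhnVertex τ j) - Z.z μ
  have hmem : a ∈ h0.toFinset := (Set.Finite.mem_toFinset _).2 ⟨μ, τ, rfl⟩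
  have h1 : ∀ j : Fin (d + 1), o + G.γ n A + Z.z (μ + kuhnVertex τ j) =
      (o + G.γ n A + Z.z μ) + a j := by
    intro j
    exact (add_add_sub_cancel _ _ _).symm
  have h2 := hK a hmem _ (hn A μ).2 fun j => by
    rw [← h1]
    exact (hn A _).1
  simp only [h1]
  have h3 : K a ≤ ∑ a ∈ h0.toFinset, K a :=
    Finset.single_le_sum (f := K) (fun _ _ => Nat.zero_le _) hmem
  rw [Int.abs_eq_natAbs]
  exact_mod_cast h2.trans h3

theorem Germ.eventually_norm_sub_lt {p : Fin 𝔉.m → ℝ} (G : 𝔉.Germ p) {ε : ℝ} (hε : 0 < ε) :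
    ∀ᶠ n in atTop, ∀ A A', ‖skewProjection hEF (G.γ n A) - skewProjection hEF (G.γ n A')‖ < ε := by
  rw [eventually_all]
  intro A
  rw [eventually_all]
  intro A'
  have h1 : ∀ A, Tendsto (fun n => skewProjection hEF (G.γ n A)) atTop
      (𝓝 (∑ i, p i • 𝔉.b i)) := by
    intro A
    simp only [𝔉.skewProjection_eq_sum (G.mem _ A)]
    exact tendsto_finsetSum _ fun i _ => (G.tendsto A i).smul_const _
  have h2 := ((h1 A).sub (h1 A')).norm
  rw [sub_self, norm_zero] at h2
  exact h2.eventually_lt_const hε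

/-- On simplices of a given shape the cochain is determined by finitely many half-space conditions.
If the alternating sum survives, then for every free `k` one of these hyperplanes has pivot `k` and
passes through the corner translated by `z μ`. Its free coordinates then solve a triangular system
from a finite list, and they determine the entries of `μ` outside `I`. -/
theorem Splitting.exists_vanishing_faceSum (hT : Function.Injective T.fromStrip) {d : ℕ}
    (S : 𝔉.BoxSequence u) (Z : 𝔉.Splitting (d + 1) S.r) {M : ℕ} (G : 𝔉.Germ (S.corner M))
    (b : Cochain (PatternGroupoid T) d) : ∃ K : ℕ, ∀ μ, (∃ i ∉ Z.I, (K : ℤ) ≤ |μ i|) →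
      ∀ τ, ∀ᶠ n in atTop, Z.faceSum G S.o b n τ μ = 0 := by
  classical
  have h0 := Z.finite_differences (d + 1)
  have hL : ∀ a ∈ h0.toFinset, ∀ i, a i ∈ lattice N := by
    intro a ha i
    obtain ⟨μ, τ, rfl⟩ := (Set.Finite.mem_toFinset _).1 ha
    exact sub_mem (Z.z_mem _).1 (Z.z_mem _).1
  choose! ε hε Y hY using fun a (ha : a ∈ h0.toFinset) =>
    exists_local_determination hT hEF b a (hL a ha)
  obtain ⟨Q, hQE, hQ⟩ := exists_strip_halfspaces E
  let 𝒲 : Finset ((Fin 𝔉.m → ℝ) × ℝ) := (h0.toFinset.biUnion fun a => Q ×ˢ Y a).image fun qz =>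
    (fun i => qz.1.1 (𝔉.b i), qz.1.2 - qz.1.1 (S.o + qz.2))
  let y : (Fin (d + 1) → ℤ) → Fin 𝔉.m → ℝ := fun μ i =>
    if i ∈ 𝔉.free then S.lo M i + 𝔉.coord (Z.z μ) i else 0
  have hfin := 𝔉.finite_triangular 𝒲
  set 𝒴 := {y : Fin 𝔉.m → ℝ | (∀ i ∉ 𝔉.free, y i = 0) ∧ ∀ k ∈ 𝔉.free, ∃ w ∈ 𝒲, 𝔉.IsPivot w.1 k ∧
      ∑ i, w.1 i * y i = w.2} with h𝒴
  let g : (Fin 𝔉.m → ℝ) → Fin (d + 1) → ℤ := fun y' =>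
    if h : ∃ μ, y μ = y' then h.choose else 0
  have hg : ∀ μ, ∀ i ∉ Z.I, g (y μ) i = μ i := by
    intro μ i hi
    have hex : ∃ ν, y ν = y μ := ⟨μ, rfl⟩
    have h1 : y (g (y μ)) = y μ := by
      simp only [g, dif_pos hex]
      exact hex.choose_spec
    refine Z.eq_of_coord_eq _ _ (fun k hk => ?_) i hi
    have h2 := congrFun h1 k
    simp only [y, if_pos hk] at h2
    linarith
  obtain ⟨K, hK⟩ := (hfin.image fun y' => ∑ i, (g y' i).natAbs).bddAbove
  refine ⟨K + 1, fun μ hμ τ => ?_⟩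
  have hnot : y μ ∉ 𝒴 := by
    intro hmem
    obtain ⟨i, hi, hKi⟩ := hμ
    have h1 := hK ⟨_, hmem, rfl⟩
    have h2 : (g (y μ) i).natAbs ≤ ∑ i, (g (y μ) i).natAbs :=
      Finset.single_le_sum (f := fun i => (g (y μ) i).natAbs) (fun _ _ => Nat.zero_le _)
        (Finset.mem_univ i)
    rw [hg μ i hi] at h2
    rw [Int.abs_eq_natAbs] at hKi
    have h3 : K + 1 ≤ (μ i).natAbs := by exact_mod_cast hKi
    simp only at h1
    omega
  have hex : ∃ k ∈ 𝔉.free, ∀ w ∈ 𝒲, 𝔉.IsPivot w.1 k → ∑ i, w.1 i * y μ i ≠ w.2 := by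
    by_contra! hcon
    refine hnot ⟨fun i hi => if_neg hi, fun k hk => ?_⟩
    obtain ⟨w, hw, hp, h1⟩ := hcon k hk
    exact ⟨w, hw, hp, h1⟩
  obtain ⟨k, hk, hkw⟩ := hex
  set a : Fin (d + 1) → Space N := fun j => Z.z (μ + kuhnVertex τ j) - Z.z μ
  have hmem : a ∈ h0.toFinset := (Set.Finite.mem_toFinset _).2 ⟨μ, τ, rfl⟩
  have hflip : ∀ q ∈ Q, ∀ z ∈ Y a, ∀ᶠ n in atTop, ∀ A,
      (∑ i, q.1 (𝔉.b i) * 𝔉.coord (G.γ n A) i ≤ q.2 - q.1 (S.o + Z.z μ + z) ↔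
      ∑ i, q.1 (𝔉.b i) * 𝔉.coord (G.γ n (symmDiff A {k})) i ≤ q.2 - q.1 (S.o + Z.z μ + z)) := by
    intro q hq z hz
    refine Germ.eventually_symmDiff 𝔉 G ?_
    rintro ⟨hp, hc⟩
    have hw : ((fun i => q.1 (𝔉.b i), q.2 - q.1 (S.o + z)) : (Fin 𝔉.m → ℝ) × ℝ) ∈ 𝒲 :=
      Finset.mem_image.2 ⟨(q, z), Finset.mem_biUnion.2 ⟨a, hmem, Finset.mem_product.2 ⟨hq, hz⟩⟩, rfl⟩
    refine hkw _ hw hp ?_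
    change ∑ i, q.1 (𝔉.b i) * y μ i = q.2 - q.1 (S.o + z)
    have h1 : ∀ i, q.1 (𝔉.b i) * y μ i =
        q.1 (𝔉.b i) * S.corner M i + q.1 (𝔉.b i) * 𝔉.coord (Z.z μ) i := by
      intro i
      by_cases hi : i ∈ 𝔉.free
      · simp only [y, BoxSequence.corner, if_pos hi]
        ring
      -- Free directions have the highest ranks, so a form with a free pivot has no non-free
      -- coefficients. This is why `y μ` may be set to zero there.
      · have h2 : q.1 (𝔉.b i) = 0 := hp.2 i (𝔉.rank_lt_rank hi hk)
        rw [h2]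
        ring
    rw [Finset.sum_congr rfl fun i _ => h1 i, Finset.sum_add_distrib, hc,
      ← 𝔉.apply_eq_sum (Z.z_mem μ) (hQE q hq)]
    simp only [map_add]
    ring
  have hflip' : ∀ᶠ n in atTop, ∀ q ∈ Q, ∀ z ∈ Y a, ∀ A,
      (∑ i, q.1 (𝔉.b i) * 𝔉.coord (G.γ n A) i ≤ q.2 - q.1 (S.o + Z.z μ + z) ↔
      ∑ i, q.1 (𝔉.b i) * 𝔉.coord (G.γ n (symmDiff A {k})) i ≤ q.2 - q.1 (S.o + Z.z μ + z)) := by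
    rw [Finset.eventually_all]
    intro q hq
    rw [Finset.eventually_all]
    exact hflip q hq
  filter_upwards [S.eventually_mem G, G.eventually_norm_sub_lt (hε a hmem), hflip'] with n h1 h2 h3
  refine sum_powerset_neg_one_pow_eq_zero hk fun A => ?_
  have h4 : ∀ A, ∀ j : Fin (d + 1), S.o + G.γ n A + Z.z (μ + kuhnVertex τ j) =
      (S.o + G.γ n A + Z.z μ) + a j := by
    intro A j
    exact (add_add_sub_cancel _ _ _).symm
  have hstrip : ∀ A z, S.o + G.γ n A + Z.z μ + z ∈ strip E ↔
      ∀ q ∈ Q, ∑ i, q.1 (𝔉.b i) * 𝔉.coord (G.γ n A) i ≤ q.2 - q.1 (S.o + Z.z μ + z) := by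
    intro A z
    rw [hQ]
    refine forall_congr' fun q => forall_congr' fun hq => ?_
    rw [← 𝔉.apply_eq_sum (G.mem n A) (hQE q hq), le_sub_iff_add_le, ← map_add]
    have : S.o + G.γ n A + Z.z μ + z = G.γ n A + (S.o + Z.z μ + z) := by abel
    rw [this]
  simp only [h4]
  refine hY a hmem _ _ (h1 A _ (Z.z_mem μ) (Z.z_small μ)).2 (h1 _ _ (Z.z_mem μ) (Z.z_small μ)).2
    (fun j => ?_) (fun j => ?_) ?_ fun z hz => ?_
  · rw [← h4]
    exact (h1 A _ (Z.z_mem _) (Z.z_small _)).1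
  · rw [← h4]
    exact (h1 _ _ (Z.z_mem _) (Z.z_small _)).1
  · have h5 : ∀ A, skewProjection hEF (S.o + G.γ n A + Z.z μ) =
        skewProjection hEF (G.γ n A) + skewProjection hEF (S.o + Z.z μ) := by
      intro A
      rw [← map_add]
      congr 1
      abel
    rw [h5, h5, add_sub_add_right_eq_sub]
    exact h2 _ _
  · rw [hstrip, hstrip]
    exact forall_congr' fun q => forall_congr' fun hq => h3 q hq z hz A

end Frame

end CanonicalProjection

namespace CanonicalProjection

open ContinuousGroupoidCohomology

variable {N : ℕ} {E F : Submodule ℝ (Space N)} {u : Space N}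

open ProjectionPattern

theorem card_intBox {d : ℕ} (lo : Fin d → ℤ) (n : Fin d → ℕ) : (intBox lo n).card = ∏ i, n i := by
  simp [intBox, Fintype.card_piFinset]

/-! ### Linear independence of the classes of boxes -/

namespace Frame

variable {hEF : IsCompl E F} {𝔉 : Frame hEF} {T : ProjectionPattern E u}

/-- The box used for averaging: long in the directions `I`, and of fixed length in the others. -/
def averagingBox {d : ℕ} (I : Finset (Fin d)) (K R : ℕ) : Finset (Fin d → ℤ) :=
  intBox (fun i => if i ∈ I then 0 else -(K : ℤ)) fun i => if i ∈ I then R else 2 * K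

theorem card_averagingBox_le {d : ℕ} (I : Finset (Fin d)) {K : ℕ} (hK : 0 < K) (R : ℕ) :
    (averagingBox I K R).card ≤ (2 * K) ^ d * R ^ I.card := by
  classical
  have h1 : R ^ I.card = ∏ i : Fin d, if i ∈ I then R else 1 := by
    rw [Finset.prod_ite, Finset.prod_const, Finset.prod_const_one, mul_one,
      Finset.filter_univ_mem]
  have h2 : (2 * K) ^ d = ∏ _i : Fin d, 2 * K := by simp
  rw [averagingBox, card_intBox, h1, h2, ← Finset.prod_mul_distrib]
  refine Finset.prod_le_prod' fun i _ => ?_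
  split_ifs
  · exact Nat.le_mul_of_pos_left _ (by omega)
  · omega

theorem le_card_filter_averagingBox {d : ℕ} (I : Finset (Fin d)) {K : ℕ} (hK : 0 < K) (R : ℕ) :
    R ^ I.card ≤ ((averagingBox I K R).filter fun μ => ∀ i ∉ I, μ i = 0).card := by
  classical
  have h1 : R ^ I.card = (intBox (0 : Fin d → ℤ) fun i => if i ∈ I then R else 1).card := by
    rw [card_intBox, Finset.prod_ite, Finset.prod_const, Finset.prod_const_one, mul_one,
      Finset.filter_univ_mem]
  rw [h1]
  refine Finset.card_le_card fun μ hμ => ?_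
  rw [mem_intBox] at hμ
  refine Finset.mem_filter.2 ⟨mem_intBox.2 fun i => ?_, fun i hi => ?_⟩
  · have h2 := hμ i
    simp only [Pi.zero_apply] at h2
    split_ifs at h2 ⊢
    · exact h2
    · push_cast at h2 ⊢
      omega
  · have h2 := hμ i
    simp only [Pi.zero_apply, if_neg hi] at h2
    push_cast at h2
    omega

/-- Stokes' formula leaves differences along one direction. In a direction of `I`, telescoping gains
the factor `R`; in any other one both end terms lie where the alternating face sums vanish. The
constants depend on `b` but not on `R`. -/
theorem Splitting.exists_bound_pairing_coboundary (hT : Function.Injective T.fromStrip) {d : ℕ}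
    (S : 𝔉.BoxSequence u) (Z : 𝔉.Splitting (d + 1) S.r) {M : ℕ} (G : 𝔉.Germ (S.corner M))
    (b : Cochain (PatternGroupoid T) d) : ∃ K C : ℕ, 0 < K ∧ ∀ R : ℕ, 0 < R → ∀ᶠ n in atTop,
      (R : ℤ) * |Z.pairing T G S.o (averagingBox Z.I K R) n (coboundary _ d b)| ≤
        C * (R : ℤ) ^ Z.I.card := by
  classical
  obtain ⟨K₀, hK₀⟩ := Z.exists_vanishing_faceSum hT S G b
  obtain ⟨B, hB⟩ := Z.exists_bound_faceSum hT G S.o b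
  set K := K₀ + 1 with hK
  refine ⟨K, Fintype.card (Equiv.Perm (Fin (d + 1))) * (2 * B * (2 * K) ^ (d + 1)), by omega,
    fun R hR => ?_⟩
  set lo : Fin (d + 1) → ℤ := fun i => if i ∈ Z.I then 0 else -(K : ℤ)
  set len : Fin (d + 1) → ℕ := fun i => if i ∈ Z.I then R else 2 * K with hlen
  have hlen0 : ∀ i, 0 < len i := by
    intro i
    simp only [hlen]
    split_ifs <;> omega
  -- The box is enlarged by one because telescoping evaluates the face sums at the upper end as
  -- well.
  have hvan : ∀ᶠ n in atTop, ∀ μ ∈ intBox lo (fun i => len i + 1), ∀ τ,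
      (∃ i ∉ Z.I, (K₀ : ℤ) ≤ |μ i|) → Z.faceSum G S.o b n τ μ = 0 := by
    rw [Finset.eventually_all]
    intro μ _
    rw [eventually_all]
    intro τ
    by_cases hμ : ∃ i ∉ Z.I, (K₀ : ℤ) ≤ |μ i|
    · filter_upwards [hK₀ μ hμ τ] with n hn _
      exact hn
    · exact Eventually.of_forall fun n h => absurd h hμ
  filter_upwards [S.eventually_mem G, hvan] with n hn hv
  have hpt : ∀ A μ, S.o + G.γ n A + Z.z μ ∈ stripPattern E u := fun A μ =>
    hn A _ (Z.z_mem μ) (Z.z_small μ)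
  have hcard : ((averagingBox Z.I K R).card : ℤ) ≤ (2 * K) ^ (d + 1) * R ^ Z.I.card := by
    exact_mod_cast card_averagingBox_le Z.I (by omega) R
  have hτ : ∀ τ : Equiv.Perm (Fin (d + 1)), (R : ℤ) * |∑ μ ∈ averagingBox Z.I K R,
      (Z.faceSum G S.o b n τ (μ + Pi.single (τ (Fin.last d)) 1) - Z.faceSum G S.o b n τ μ)| ≤
      2 * B * (2 * K) ^ (d + 1) * R ^ Z.I.card := by
    intro τ
    set a := τ (Fin.last d)
    by_cases haI : a ∈ Z.I
    · have h1 := abs_sum_intBox_sub_le lo len a (hlen0 a) (Z.faceSum G S.o b n τ) B (hB n hpt τ)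
      have h2 : len a = R := if_pos haI
      rw [h2] at h1
      refine h1.trans ?_
      rw [mul_assoc (2 * (B : ℤ))]
      exact mul_le_mul_of_nonneg_left hcard (by positivity)
    · have h1 : ∑ μ ∈ averagingBox Z.I K R, (Z.faceSum G S.o b n τ (μ + Pi.single a 1) -
          Z.faceSum G S.o b n τ μ) = 0 := by
        refine sum_intBox_sub_eq_zero lo len a (hlen0 a) _ fun μ hμ hμa => hv μ ?_ τ ⟨a, haI, ?_⟩
        · rw [mem_intBox]
          intro i
          have := hμ i
          push_cast
          omega
        · have h2 : lo a = -(K : ℤ) := if_neg haI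
          have h3 : len a = 2 * K := if_neg haI
          rw [h2, h3] at hμa
          rcases hμa with h | h
          · rw [h, abs_neg, Nat.abs_cast]
            push_cast [hK]
            omega
          · have h4 : μ a = K := by
              rw [h]
              push_cast
              ring
            rw [h4, Nat.abs_cast]
            push_cast [hK]
            omega
      rw [h1, abs_zero, mul_zero]
      positivity
  rw [Z.pairing_coboundary hT G S.o _ b hpt, abs_mul, abs_pow, abs_neg, abs_one, one_pow, one_mul]
  calc (R : ℤ) * |∑ τ : Equiv.Perm (Fin (d + 1)), (Equiv.Perm.sign τ : ℤ) *
        ∑ μ ∈ averagingBox Z.I K R, (Z.faceSum G S.o b n τ (μ + Pi.single (τ (Fin.last d)) 1) -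
          Z.faceSum G S.o b n τ μ)|
      ≤ (R : ℤ) * ∑ τ : Equiv.Perm (Fin (d + 1)), |∑ μ ∈ averagingBox Z.I K R,
          (Z.faceSum G S.o b n τ (μ + Pi.single (τ (Fin.last d)) 1) -
            Z.faceSum G S.o b n τ μ)| := by
        refine mul_le_mul_of_nonneg_left ?_ (by positivity)
        refine (Finset.abs_sum_le_sum_abs _ _).trans (Finset.sum_le_sum fun τ _ => ?_)
        rw [abs_mul]
        have : |((Equiv.Perm.sign τ : ℤˣ) : ℤ)| = 1 := Int.isUnit_iff_abs_eq.1 (Units.isUnit _)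
        rw [this, one_mul]
    _ ≤ ∑ _τ : Equiv.Perm (Fin (d + 1)), 2 * B * (2 * K) ^ (d + 1) * (R : ℤ) ^ Z.I.card := by
        rw [Finset.mul_sum]
        exact Finset.sum_le_sum fun τ _ => hτ τ
    _ = _ := by
        rw [Finset.sum_const, Finset.card_univ, nsmul_eq_mul]
        push_cast
        ring

/-- A combination of the cocycles of the boxes which is a coboundary is trivial. -/
theorem Splitting.eq_zero_of_sum_eq_coboundary (hT : Function.Injective T.fromStrip)
    (hu : u ∈ nonSingular E) {d : ℕ} (S : 𝔉.BoxSequence u) (Z : 𝔉.Splitting (d + 1) S.r)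
    (l : ℕ →₀ ℤ) (b : Cochain (PatternGroupoid T) d)
    (h : ∑ j ∈ l.support, l j • (S.B j).cochain hT hu Z.isProper = coboundary _ d b) : l = 0 := by
  classical
  by_contra hl
  -- The last box is tested: its corner is inequivalent to the vertices of all earlier boxes, so
  -- these drop out of the pairing.
  obtain ⟨M, hM, hmax⟩ := l.support.exists_max_image id (Finsupp.support_nonempty_iff.2 hl)
  obtain ⟨G⟩ := 𝔉.nonempty_germ (S.corner M)
  obtain ⟨K, C, hK, hC⟩ := Z.exists_bound_pairing_coboundary hT S G b
  -- The own contribution gives `R * R ^ |I| ≤ C * R ^ |I|`, which fails as soon as `R` exceeds `C`.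
  set R := C + 1 with hR
  have h1 : ∀ᶠ n in atTop, ∀ j ∈ l.support.erase M,
      Z.pairing T G S.o (averagingBox Z.I K R) n ((S.B j).cochain hT hu Z.isProper) = 0 := by
    rw [Finset.eventually_all]
    intro j hj
    exact Z.eventually_pairing_earlier hT hu S G _
      (lt_of_le_of_ne (hmax j (Finset.mem_of_mem_erase hj)) (Finset.ne_of_mem_erase hj))
  obtain ⟨n, h2, h3, h4⟩ := (h1.and ((Z.eventually_pairing_own hT hu S G
    (averagingBox Z.I K R)).and (hC R (by omega)))).exists
  rw [← h, map_sum, ← Finset.add_sum_erase _ _ hM,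
    Finset.sum_eq_zero fun j hj => by rw [map_zsmul, h2 j hj, smul_zero], add_zero, map_zsmul,
    smul_eq_mul, abs_mul] at h4
  have h5 : (R : ℤ) ^ Z.I.card ≤
      Z.pairing T G S.o (averagingBox Z.I K R) n ((S.B M).cochain hT hu Z.isProper) := by
    refine le_trans ?_ h3
    have := le_card_filter_averagingBox Z.I hK R
    exact_mod_cast this
  have h6 : 1 ≤ |l M| := Int.one_le_abs (Finsupp.mem_support_iff.1 hM)
  have hRpos : (0 : ℤ) < (R : ℤ) := by positivity
  have h7 : (0 : ℤ) < (R : ℤ) ^ Z.I.card := pow_pos hRpos _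
  have h8 := h5.trans (le_abs_self _)
  have h9 : (R : ℤ) * (R : ℤ) ^ Z.I.card ≤ C * (R : ℤ) ^ Z.I.card := by
    refine le_trans (mul_le_mul_of_nonneg_left ?_ hRpos.le) h4
    calc (R : ℤ) ^ Z.I.card ≤ 1 * _ := by rw [one_mul]; exact h8
      _ ≤ _ := mul_le_mul_of_nonneg_right h6 (abs_nonneg _)
  have h10 := le_of_mul_le_mul_right h9 h7
  rw [hR] at h10
  push_cast at h10
  omega

/-- The cohomology class of a box. -/
def Splitting.boxClass (hT : Function.Injective T.fromStrip) (hu : u ∈ nonSingular E) {d : ℕ}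
    {δ : ℝ} (Z : 𝔉.Splitting d δ) (B : BoxData hEF u) : PatternCohomology T d :=
  QuotientAddGroup.mk ⟨B.cochain hT hu Z.isProper, B.coboundary_cochain hT hu Z.isProper⟩

theorem Splitting.linearIndependent_boxClass (hT : Function.Injective T.fromStrip)
    (hu : u ∈ nonSingular E) {d : ℕ} (S : 𝔉.BoxSequence u) (Z : 𝔉.Splitting (d + 1) S.r) :
    LinearIndependent ℤ fun j => Z.boxClass hT hu (S.B j) := by
  rw [linearIndependent_iff]
  intro l hl
  rw [Finsupp.linearCombination_apply, Finsupp.sum] at hl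
  have h1 : ∑ j ∈ l.support, l j • Z.boxClass hT hu (S.B j) =
      QuotientAddGroup.mk (∑ j ∈ l.support, l j • (⟨(S.B j).cochain hT hu Z.isProper,
        (S.B j).coboundary_cochain hT hu Z.isProper⟩ :
          cocycles (PatternGroupoid T) (d + 1))) := by
    rw [← QuotientAddGroup.mk'_apply, map_sum]
    rfl
  rw [h1, QuotientAddGroup.eq_zero_iff, AddSubgroup.mem_addSubgroupOf] at hl
  obtain ⟨b, hb⟩ := hl
  refine Z.eq_zero_of_sum_eq_coboundary hT hu S l b ?_
  rw [hb]
  push_cast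
  rfl

/-- If `E` were zero, then `Γ` would be zero, but `ℓ(Γ)` is dense in a space of positive dimension.
Positivity is needed to have coboundaries of cochains one degree lower. -/
theorem finrank_pos_of_isFree (𝔉 : Frame hEF) (h : ∃ i, 𝔉.IsFree i) : 0 < Module.finrank ℝ E := by
  obtain ⟨i, -⟩ := h
  by_contra hcon
  have hE : E = ⊥ := Submodule.finrank_eq_zero.1 (by omega)
  obtain ⟨γ, hγ, hγi⟩ := 𝔉.exists_coord_near (fun _ => 1) one_half_pos
  have h0 : γ = 0 := eq_zero_of_mem_translationGroup hEF hγ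
    ((Submodule.eq_bot_iff E).1 hE _ (Submodule.starProjection_apply_mem E γ))
  have := hγi i
  rw [h0, map_zero, Pi.zero_apply, zero_sub, abs_neg, abs_one] at this
  norm_num at this

end Frame

end CanonicalProjection

/-! ### Conclusion -/

theorem mainTheorem2 {N : ℕ} (E F : Submodule ℝ (CanonicalProjection.Space N)) (hEF : IsCompl E F)
    (u : CanonicalProjection.Space N) (hu : u ∈ CanonicalProjection.nonSingular E)
    (T : CanonicalProjection.ProjectionPattern E u)
    (hT : Function.Injective T.fromStrip)
    (hP : ¬ CanonicalProjection.SingularPointsFinitelyGenerated hEF u) :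
    ¬ AddGroup.FG (CanonicalProjection.PatternCohomology T (Module.finrank ℝ E)) ∧
    ¬ Module.Finite ℚ (ℚ ⊗[ℤ] CanonicalProjection.PatternCohomology T (Module.finrank ℝ E)) := by
  obtain ⟨𝔉, hfree⟩ := CanonicalProjection.exists_frame hEF hP
  obtain ⟨d, hd⟩ : ∃ d, Module.finrank ℝ E = d + 1 :=
    ⟨_, (Nat.succ_pred_eq_of_pos (𝔉.finrank_pos_of_isFree hfree)).symm⟩
  obtain ⟨S⟩ := 𝔉.exists_boxSequence hu hfree
  obtain ⟨Z⟩ := 𝔉.exists_splitting hd S.r_pos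
  rw [hd]
  have hindep := Z.linearIndependent_boxClass hT hu S
  have hfin : ¬ Module.Finite ℚ (ℚ ⊗[ℤ] CanonicalProjection.PatternCohomology T (d + 1)) := by
    intro _
    -- Flatness of `ℚ` over `ℤ` carries the infinite independent family to the rational space.
    -- Finite generation of the group would make that space finite dimensional, so the second claim
    -- implies the first.
    have h1 := Module.Flat.linearIndependent_one_tmul (S := ℚ) hindep
    have := h1.lt_aleph0_of_finiteDimensional
    simp at this
  refine ⟨fun hfg => hfin ?_, hfin⟩
  have : Module.Finite ℤ (CanonicalProjection.PatternCohomology T (d + 1)) :=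
    Module.Finite.iff_addGroup_fg.2 hfg
  infer_instance

end
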